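/- **Model.** Let $(E,\nu)$ be a standard Borel space with a $\sigma$-finite measure, let $\gamma(u,s),\varepsilon(u,s),\lambda(u,s,y)\ge 0$ be jointly measurable ($u\in E$, $s\in\mathbb R$, $y\in E\times\mathbb R$), $p\in[0,1]$, $q=1-p$. Put $a(y,t)=\int_E\lambda(u,t,y)\,\nu(du)$, $\varepsilon(t)=\int_E\varepsilon(u,t)\,\nu(du)$, and assume that $\int_E\gamma(u,\cdot)\,\nu(du)$ and $\varepsilon(\cdot)$ are integrable on $(0,t]$ and that, for every $y=(v,r)$ with $r\ge0$, $a(y,\cdot)$ is integrable on $(r,t]$, for all $t$. On a probability space $(\Omega,P)$ quakes are observed at times $0=\tau_0<\tau_1<\tau_2<\cdots$ (finitely many in bounded intervals; $\tau_k=\infty$ if there are fewer than $k$ quakes) with marks $u_k\in E$; write $y_k=(u_k,\tau_k)$. Each quake is, unobservably, a single quake or a cluster quake. $D_t\in\{0,1\}$ says whether a cluster is active, and $D_0=0$. A cluster quake occurring when $D=0$ initiates a cluster ($D$ becomes $1$) and is its mother quake; a cluster quake occurring when $D=1$ ends the cluster ($D$ becomes $0$) with probability $p$, independently of the past, and otherwise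 $D$ stays $1$. With respect to the joint history of all quakes, their types and $D$, single quakes have intensity $\gamma(u,s)\,\nu(du)\,ds$ and cluster quakes have intensity $\lambda(u,s,y)\,\nu(du)\,ds$ when a cluster with mother quake $y$ is active just before $s$, and $\varepsilon(u,s)\,\nu(du)\,ds$ when no cluster is active just before $s$. Let $\eta_t=\sum\delta_{(c_i,t_i)}$ and $h_t=\sum\delta_{(D_{t_i},t_i)}$, summed over the cluster quakes $(c_i,t_i)$ with $t_i\le t$, let $\alpha(h_t,\eta_t)=D_t$, and let $\theta_0(y)(h_t,\eta_t)$ be the indicator that $y$ is the mother quake of the cluster active at time $t$ ($0$ if none is active). Let $\mathcal F^O_t$ be generated by the times and marks of the quakes up to $t$. A *filter* is an $(\mathcal F^O_t)$-adapted process $(\pi_t)_{t\ge0}$ of probability measures on the space of pairs $(h,\eta)$ (finite histories) such that, with $\pi(f,t)=\int f\,d\pi_t$, $\pi(f,t)=E[f(h_t,\eta_t)\mid\mathcal F_t^O]$ a.s. for all $t\ge 0$ and all measurable $f$ with $f(h_t,\eta_t)$ integrable, and such that almost surely $t\mapsto\pi_t(B)$ is right-continuous for all measurable $B$. **Theorem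 3.2.** A filter exists, and for every filter, almost surely, the following holds for all functions $f$ of $(h,\eta)$ (all of which are $\pi_t$-integrable for all $t\ge0$) and all $k\ge0$ with $\tau_k<\infty$. First, $\pi(f,0)=f(0,0)$, where $(0,0)$ is the empty history. (i) For $\tau_k\le t<\tau_{k+1}$ and $1\le i\le k$, $$\pi(\theta_0(y_i)\alpha f,t)=\pi(\theta_0(y_i)\alpha f,\tau_k)\,e^{-\int_{\tau_k}^t (a(y_i,s)-\varepsilon(s))\,ds}\,b_k(t),$$ $$b_k(t)=\Big(\sum_{j=1}^k\pi(\theta_0(y_j)\alpha,\tau_k)e^{-\int_{\tau_k}^t (a(y_j,s)-\varepsilon(s))\,ds}+1-\sum_{j=1}^k\pi(\theta_0(y_j)\alpha,\tau_k)\Big)^{-1}.$$ (ii) On $[\tau_k,\tau_{k+1})$, $\pi(f,\cdot)$ satisfies $$\frac{d\pi(f,t)}{dt}=-\sum_{i=1}^k\pi(\theta_0(y_i)\alpha f,t)[a(y_i,t)-\varepsilon(t)]+\pi(f,t)\sum_{i=1}^k\pi(\theta_0(y_i)\alpha,t)[a(y_i,t)-\varepsilon(t)]\qquad(3.4)$$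 in integrated form for all $t$ (the right-hand side being integrable on $[\tau_k,t]$), in differential form for almost every $t$, and in differential form at every $t$ at which $a(y_1,\cdot),\dots,a(y_k,\cdot)$ and $\varepsilon(\cdot)$ are continuous (at $t=\tau_k$: right-continuous, with the right derivative). (iii) If $\tau_{k+1}<\infty$, the left limits $\pi(g,\tau_{k+1}-)=\lim_{t\uparrow\tau_{k+1}}\pi(g,t)$ exist for all $g$. Write $\gamma_{k+1}=\gamma(u_{k+1},\tau_{k+1})$, $\varepsilon_{k+1}=\varepsilon(u_{k+1},\tau_{k+1})$, $\lambda_{k+1,j}=\lambda(u_{k+1},\tau_{k+1},y_j)$, $d_{k+1}=\sum_{j=1}^k(\lambda_{k+1,j}-\varepsilon_{k+1})\pi(\theta_0(y_j)\alpha,\tau_{k+1}-)+\varepsilon_{k+1}+\gamma_{k+1}$, and for $D\in\{0,1\}$ let $f_D(h,\eta)=f(h+\delta_{(D,\tau_{k+1})},\eta+\delta_{y_{k+1}})$. Then $d_{k+1}>0$ and $$\pi(\theta_0(y_i)\alpha f,\tau_{k+1})=\frac{\gamma_{k+1}\,\pi(\theta_0(y_i)\alpha f,\tau_{k+1}-)+q\lambda_{k+1,i}\,\pi(f_1\theta_0(y_i)\alpha,\tau_{k+1}-)}{d_{k+1}},\quad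 1\le i\le k,$$ $$\pi(\theta_0(y_{k+1})\alpha f,\tau_{k+1})=\frac{\varepsilon_{k+1}\,\pi(f_1(1-\alpha),\tau_{k+1}-)}{d_{k+1}},$$ $$\pi(f,\tau_{k+1})=\frac{\gamma_{k+1}\,\pi(f,\tau_{k+1}-)+\varepsilon_{k+1}\,\pi(f_1(1-\alpha),\tau_{k+1}-)+\sum_{j=1}^k\lambda_{k+1,j}\,\pi([pf_0+qf_1]\theta_0(y_j)\alpha,\tau_{k+1}-)}{d_{k+1}}.$$ (iv) These equations determine the filter from the observed path: almost surely, any family $V(f,t)$ of real numbers that satisfies, for all $f$ and $k$, the initial condition and (i)–(iii) (with $V$ in place of $\pi$, with the existence of the left limits and $d_{k+1}>0$) equals $\pi(f,t)$ for all $f$ and all $t\ge0$. -/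

import Mathlib

open MeasureTheory Filter Topology Set
open scoped NNReal ENNReal

/-! ### Cluster histories -/

/-- The type of an observed quake: either a single quake (a point of `N`), or a cluster quake
(a point of `C`) together with the value `D` of the cluster indicator right after it
(`true`: the cluster is active). -/
inductive QuakeKind : Type
  | single : QuakeKind
  | cluster (D : Bool) : QuakeKind

instance QuakeKind.instMeasurableSpace : MeasurableSpace QuakeKind := ⊤

/-- Finite sequences carry the σ-algebra of the disjoint union of the powers of `X`. -/
instance listMeasurableSpace {X : Type*} [MeasurableSpace X] : MeasurableSpace (List X) :=
  MeasurableSpace.comap (List.equivSigmaTuple (α := X)) inferInstance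

/-- A value of the pair `(h, η)` of counting measures `h = ∑ δ_(D_{t_i}, t_i)` and
`η = ∑ δ_(c_i, t_i)`, both summed over the cluster quakes so far: the finite list of the triples
`(c_i, t_i, D_{t_i})` of mark, time and value of `D` right after the quake, the most recent one
first.  The occurrence times are distinct, so the list and the pair determine each other, and
adding `δ_(d, s)` to `h` and `δ_(v, s)` to `η` at a time `s` after all `t_i` is putting `(v, s, d)`
in front of the list. -/
abbrev ClusterHistory (E : Type*) : Type _ := List (E × ℝ × Bool)

namespace ClusterHistory

variable {E : Type*}

/-- The current value of the cluster indicator `D`; no cluster is active at time `0`. -/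
def active : ClusterHistory E → Bool
  | [] => false
  | (_, _, d) :: _ => d

/-- The mother quake `(mark, time)` of the currently active cluster, if there is one: the quake
that initiated it, that is, the cluster quake that came when no cluster was active. -/
def mother : ClusterHistory E → Option (E × ℝ)
  | [] => none
  | (v, s, d) :: l => if d then (if active l then mother l else some (v, s)) else none

/-- `α(h, η) = 1_{D = 1}`. -/
noncomputable def alpha (l : ClusterHistory E) : ℝ := if active l then 1 else 0

/-- `θ₀(y)`: the indicator that `y` is the mother quake of the currently active cluster
(`0` if no cluster is active). -/
noncomputable def theta (y : E × ℝ) : ClusterHistory E → ℝ :=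
  Set.indicator {l | mother l = some y} 1

end ClusterHistory

/-! ### The model -/

/-- The parameters of the mother-quake model on the mark space `E` with reference measure `ν`:
the intensity `γ(u, s)` of the single quakes, the intensity `ε(u, s)` with which clusters are
initiated, the intensity `λ(u, s, y)` of offspring of the mother quake `y = (mark, time)` and the
probability `p` that an offspring quake ends its cluster. -/
structure MotherQuakeRates (E : Type*) [MeasurableSpace E] (ν : Measure E) where
  γ : E → ℝ → ℝ≥0
  ε : E → ℝ → ℝ≥0
  lam : E → ℝ → E × ℝ → ℝ≥0
  p : ℝ≥0
  p_le_one : p ≤ 1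
  measurable_γ : Measurable fun x : E × ℝ => γ x.1 x.2
  measurable_ε : Measurable fun x : E × ℝ => ε x.1 x.2
  measurable_lam : Measurable fun x : E × ℝ × (E × ℝ) => lam x.1 x.2.1 x.2.2
  γ_finite : ∀ t : ℝ, ∫⁻ s in Ioc 0 t, ∫⁻ u, γ u s ∂ν ≠ ∞
  ε_finite : ∀ t : ℝ, ∫⁻ s in Ioc 0 t, ∫⁻ u, ε u s ∂ν ≠ ∞
  lam_finite : ∀ y : E × ℝ, 0 ≤ y.2 → ∀ t : ℝ, ∫⁻ s in Ioc y.2 t, ∫⁻ u, lam u s y ∂ν ≠ ∞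

namespace MotherQuakeRates

variable {E : Type*} [MeasurableSpace E] {ν : Measure E} (R : MotherQuakeRates E ν)

/-- The cluster intensity
`λ(u, s, D, η) = D ∑_i λ(u, s, y_i) θ₀(y_i) + (1 - D) ε(u, s)`:
at most one `θ₀(y_i)` is non-zero, and one is exactly when a cluster is active. -/
def clusterRate (l : ClusterHistory E) (u : E) (s : ℝ) : ℝ≥0 :=
  match l.mother with
  | some y => R.lam u s y
  | none => R.ε u s

/-- The probability that `D` has the value `D'` right after a cluster quake, if it had the value
`D` right before: a new cluster becomes active, an active one dies with probability `p`. -/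
def transition (D D' : Bool) : ℝ≥0 :=
  match D, D' with
  | false, true => 1
  | false, false => 0
  | true, true => 1 - R.p
  | true, false => R.p

/-- The intensity of quakes of each kind with mark `u` at time `s`, given the cluster history `l`
before `s`. -/
def rate (l : ClusterHistory E) (u : E) (s : ℝ) : QuakeKind → ℝ≥0
  | QuakeKind.single => R.γ u s
  | QuakeKind.cluster D' => R.clusterRate l u s * R.transition l.active D'

/-- `a(y, t) = ∫ λ(u, t, y) ν(du)`. -/
noncomputable def a (y : E × ℝ) (t : ℝ) : ℝ := ∫ u, (R.lam u t y : ℝ) ∂ν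

/-- `ε(t) = ∫ ε(u, t) ν(du)`. -/
noncomputable def epsTotal (t : ℝ) : ℝ := ∫ u, (R.ε u t : ℝ) ∂ν

end MotherQuakeRates

/-- The filtration generated by a marked point process with times `T 1 < T 2 < ⋯` and marks
`X 1, X 2, …`: the σ-algebra at time `t` is generated by the events `{T n ≤ s, X n ∈ A}` with
`s ≤ t`. -/
def pointFiltration {Ω M : Type*} [mΩ : MeasurableSpace Ω] [MeasurableSpace M]
    (T : ℕ → Ω → EReal) (X : ℕ → Ω → M) (hT : ∀ n, Measurable (T n))
    (hX : ∀ n, Measurable (X n)) : Filtration ℝ≥0 mΩ where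
  seq t := MeasurableSpace.generateFrom
    {G | ∃ (n : ℕ) (s : ℝ≥0) (A : Set M), 1 ≤ n ∧ s ≤ t ∧ MeasurableSet A ∧
      G = {ω | T n ω ≤ ((s : ℝ) : EReal) ∧ X n ω ∈ A}}
  mono' := by
    intro s t hst
    refine MeasurableSpace.generateFrom_mono ?_
    rintro G ⟨n, r, A, hn, hr, hA, rfl⟩
    exact ⟨n, r, A, hn, hr.trans hst, hA, rfl⟩
  le' := by
    intro t
    refine MeasurableSpace.generateFrom_le ?_
    rintro G ⟨n, r, A, hn, hr, hA, rfl⟩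
    exact (measurableSet_le (hT n) measurable_const).inter (hX n hA)

/-- A marked point process of quakes on `Ω`.  Quake `n ≥ 1` happens at time `T n > 0` (`⊤` if there
are fewer than `n` quakes), has the observable mark `mark n` and the hidden kind `kind n`;
`T 0 = 0` is a convention, and `mark 0`, `kind 0` have no meaning.  The observed point process `O`
consists of all quakes, `N` of the single quakes and `C` of the cluster quakes. -/
structure QuakeProcess (E Ω : Type*) [MeasurableSpace E] [MeasurableSpace Ω] where
  T : ℕ → Ω → EReal
  mark : ℕ → Ω → E
  kind : ℕ → Ω → QuakeKind
  measurable_T : ∀ n, Measurable (T n)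
  measurable_mark : ∀ n, Measurable (mark n)
  measurable_kind : ∀ n, Measurable (kind n)
  T_zero : ∀ ω, T 0 ω = 0
  T_le : ∀ n ω, T n ω ≤ T (n + 1) ω
  T_lt : ∀ n ω, T n ω ≠ ⊤ → T n ω < T (n + 1) ω
  /-- there are finitely many quakes in bounded time intervals -/
  T_unbounded : ∀ ω (t : ℝ), ∃ n, (t : EReal) < T n ω

namespace QuakeProcess

variable {E Ω : Type*} [MeasurableSpace E] [mΩ : MeasurableSpace Ω] (X : QuakeProcess E Ω)

/-- The cluster history after the first `n` quakes. -/
noncomputable def clusterHist (ω : Ω) : ℕ → ClusterHistory E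
  | 0 => []
  | n + 1 =>
    match X.kind (n + 1) ω with
    | QuakeKind.single => clusterHist ω n
    | QuakeKind.cluster D => (X.mark (n + 1) ω, (X.T (n + 1) ω).toReal, D) :: clusterHist ω n

/-- `(h_t, η_t)`: the cluster history at time `t`. -/
noncomputable def hist (t : ℝ) (ω : Ω) : ClusterHistory E :=
  X.clusterHist ω (Set.ncard {n : ℕ | 1 ≤ n ∧ X.T n ω ≤ (t : EReal)})

/-- `(h_{t-}, η_{t-})`: the cluster history just before time `t`. -/
noncomputable def histBefore (t : ℝ) (ω : Ω) : ClusterHistory E :=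
  X.clusterHist ω (Set.ncard {n : ℕ | 1 ≤ n ∧ X.T n ω < (t : EReal)})

/-- The history `ℱ_t` of all quakes and their kinds. -/
def fullFiltration : Filtration ℝ≥0 mΩ :=
  pointFiltration X.T (fun n ω => (X.mark n ω, X.kind n ω)) X.measurable_T
    fun n => (X.measurable_mark n).prodMk (X.measurable_kind n)

/-- The observed history `ℱ^O_t`, generated by the times and marks of all quakes. -/
def obsFiltration : Filtration ℝ≥0 mΩ :=
  pointFiltration X.T X.mark X.measurable_T X.measurable_mark

end QuakeProcess

/-- The law of the mother-quake model, through stochastic intensities with respect to the joint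
history `ℱ` of all quakes and their kinds: single quakes with mark in `du` come at time `s` with
intensity `γ(u, s) ν(du)`, cluster quakes with intensity `λ(u, s, D_{s-}, η_{s-}) ν(du)`, and at a
cluster quake `D` moves by `transition`, independently of the past.  As usual, `rate` is the
intensity if for every predictable `H ≥ 0`, indexed by mark and kind, the expected sum of `H` over
the points is the expected integral of `H * rate`.  (The intensity of `N` given the joint history is
deterministic, so `N` is a Poisson random measure with mean measure `γ(u, s) ν(du) ds`.) -/
def IsMotherQuakeModel {E Ω : Type*} [MeasurableSpace E] [MeasurableSpace Ω] {ν : Measure E}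
    (R : MotherQuakeRates E ν) (P : Measure Ω) (X : QuakeProcess E Ω) : Prop :=
  ∀ H : (ℝ≥0 × Ω) × (E × QuakeKind) → ℝ≥0∞,
    Measurable[X.fullFiltration.predictable.prod inferInstance] H →
    ∫⁻ ω, ∑' n : ℕ, (if X.T (n + 1) ω = ⊤ then 0 else
        H (((X.T (n + 1) ω).toReal.toNNReal, ω), (X.mark (n + 1) ω, X.kind (n + 1) ω))) ∂P
      = ∫⁻ ω, ∫⁻ s in Ioi (0 : ℝ), ∫⁻ u,
          (H ((s.toNNReal, ω), (u, QuakeKind.single))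
              * R.rate (X.histBefore s ω) u s QuakeKind.single
            + H ((s.toNNReal, ω), (u, QuakeKind.cluster true))
              * R.rate (X.histBefore s ω) u s (QuakeKind.cluster true)
            + H ((s.toNNReal, ω), (u, QuakeKind.cluster false))
              * R.rate (X.histBefore s ω) u s (QuakeKind.cluster false)) ∂ν ∂volume ∂P

/-! ### The filter -/

/-- `π` is the filter: `π t` is a regular conditional distribution of `(h_t, η_t)` given the
observations up to time `t`, so that `π(f, t) = ∫ f dπ_t = E[f(h_t, η_t) | ℱ^O_t]`, and its paths
are almost surely right-continuous (which makes it unique up to indistinguishability and gives a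
meaning to its values at the random times `T k`). -/
structure IsMotherQuakeFilter {E Ω : Type*} [MeasurableSpace E] [MeasurableSpace Ω]
    (P : Measure Ω) (X : QuakeProcess E Ω) (π : ℝ → Ω → Measure (ClusterHistory E)) : Prop where
  isProbabilityMeasure : ∀ t, 0 ≤ t → ∀ ω, IsProbabilityMeasure (π t ω)
  adapted : ∀ t : ℝ≥0, Measurable[X.obsFiltration t] (π t)
  condExp_eq : ∀ (t : ℝ≥0) (f : ClusterHistory E → ℝ), Measurable f →
    Integrable (fun ω => f (X.hist t ω)) P →
    (fun ω => ∫ l, f l ∂(π t ω)) =ᵐ[P] P[fun ω => f (X.hist t ω) | X.obsFiltration t]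
  right_continuous : ∀ᵐ ω ∂P, ∀ B : Set (ClusterHistory E), MeasurableSet B → ∀ t : ℝ, 0 ≤ t →
    ContinuousWithinAt (fun s => π s ω B) (Ici t) t

/-! ### The filter equations along one observed path -/

namespace MotherQuakeRates

open ClusterHistory

variable {E : Type*} [MeasurableSpace E] {ν : Measure E} (R : MotherQuakeRates E ν)

/-- `exp (- ∫_r^t (a(y, s) - ε(s)) ds)`. -/
noncomputable def decay (y : E × ℝ) (r t : ℝ) : ℝ :=
  Real.exp (-∫ s in r..t, (R.a y s - R.epsTotal s))

/-- `b_k(t)`, where `r = τ_k`, `y 1, …, y k` are the observations up to `r` and `Φ f = π(f, τ_k)`. -/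
noncomputable def b (y : ℕ → E × ℝ) (k : ℕ) (Φ : (ClusterHistory E → ℝ) → ℝ) (r t : ℝ) : ℝ :=
  1 / (∑ j ∈ Finset.Icc 1 k, Φ (fun l => theta (y j) l * alpha l) * R.decay (y j) r t
    + 1 - ∑ j ∈ Finset.Icc 1 k, Φ (fun l => theta (y j) l * alpha l))

/-- The right-hand side of the differential equation for `π(f, t)`; here `Φ f = π(f, t)`. -/
noncomputable def odeRhs (y : ℕ → E × ℝ) (k : ℕ) (Φ : (ClusterHistory E → ℝ) → ℝ)
    (f : ClusterHistory E → ℝ) (t : ℝ) : ℝ :=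
  -∑ i ∈ Finset.Icc 1 k, Φ (fun l => theta (y i) l * alpha l * f l) * (R.a (y i) t - R.epsTotal t)
    + Φ f * ∑ i ∈ Finset.Icc 1 k,
        Φ (fun l => theta (y i) l * alpha l) * (R.a (y i) t - R.epsTotal t)

/-- `d_{k+1}`, where `Φ f = π(f, τ_{k+1}-)`. -/
noncomputable def d (y : ℕ → E × ℝ) (k : ℕ) (Φ : (ClusterHistory E → ℝ) → ℝ) : ℝ :=
  ∑ j ∈ Finset.Icc 1 k, ((R.lam (y (k + 1)).1 (y (k + 1)).2 (y j) : ℝ)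
      - R.ε (y (k + 1)).1 (y (k + 1)).2) * Φ (fun l => theta (y j) l * alpha l)
    + R.ε (y (k + 1)).1 (y (k + 1)).2 + R.γ (y (k + 1)).1 (y (k + 1)).2

/-- The equations between two observations: `y 1, …, y k` are the observations so far,
`r = τ_k`, `r' = τ_{k+1}` (possibly `⊤`), and `V t f` stands for `π(f, t)`. -/
structure EvolutionEquations (y : ℕ → E × ℝ) (k : ℕ) (r : ℝ) (r' : EReal)
    (V : ℝ → (ClusterHistory E → ℝ) → ℝ) (f : ClusterHistory E → ℝ) : Prop where
  /-- `π(θ₀(y_i) α f, t)` evolves by the explicit factor. -/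
  cluster_eq : ∀ t : ℝ, r ≤ t → (t : EReal) < r' → ∀ i ∈ Finset.Icc 1 k,
    V t (fun l => theta (y i) l * alpha l * f l)
      = V r (fun l => theta (y i) l * alpha l * f l) * R.decay (y i) r t * R.b y k (V r) r t
  /-- The differential equation for `π(f, t)` in integrated form. -/
  ode_integrable : ∀ t : ℝ, r ≤ t → (t : EReal) < r' →
    IntervalIntegrable (fun s => R.odeRhs y k (V s) f s) volume r t
  ode_integral : ∀ t : ℝ, r ≤ t → (t : EReal) < r' →
    V t f = V r f + ∫ s in r..t, R.odeRhs y k (V s) f s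
  /-- It holds in differential form at almost every time. -/
  ode_ae : ∀ᵐ t : ℝ, r < t → (t : EReal) < r' →
    HasDerivAt (fun s => V s f) (R.odeRhs y k (V t) f t) t
  /-- It holds in differential form wherever its coefficients are continuous (at `τ_k`: from the
  right). -/
  ode_of_continuous : ∀ t : ℝ, r ≤ t → (t : EReal) < r' →
    (∀ i ∈ Finset.Icc 1 k, ContinuousWithinAt (R.a (y i)) (Ici r) t) →
    ContinuousWithinAt R.epsTotal (Ici r) t →
    HasDerivWithinAt (fun s => V s f) (R.odeRhs y k (V t) f t) (Ici r) t

/-- The equations at the observation `y (k + 1)`: `Φ f` is `π(f, τ_{k+1}-)`, `Ψ f` is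
`π(f, τ_{k+1})`.  Prolonging the history by `(u, s, true)` or `(u, s, false)`, where
`(u, s) = y (k + 1)`, gives `f(1, · + δ_{y_{k+1}})` and `f(0, · + δ_{y_{k+1}})`. -/
structure JumpEquations (y : ℕ → E × ℝ) (k : ℕ) (Φ Ψ : (ClusterHistory E → ℝ) → ℝ)
    (f : ClusterHistory E → ℝ) : Prop where
  old_mother : ∀ i ∈ Finset.Icc 1 k,
    Ψ (fun l => theta (y i) l * alpha l * f l)
      = (Φ (fun l => theta (y i) l * alpha l * f l) * R.γ (y (k + 1)).1 (y (k + 1)).2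
          + (1 - R.p) * R.lam (y (k + 1)).1 (y (k + 1)).2 (y i)
            * Φ (fun l => f (((y (k + 1)).1, (y (k + 1)).2, true) :: l)
                * (theta (y i) l * alpha l))) / R.d y k Φ
  new_mother :
    Ψ (fun l => theta (y (k + 1)) l * alpha l * f l)
      = Φ (fun l => f (((y (k + 1)).1, (y (k + 1)).2, true) :: l) * (1 - alpha l))
          * R.ε (y (k + 1)).1 (y (k + 1)).2 / R.d y k Φ
  total :
    Ψ f = (Φ f * R.γ (y (k + 1)).1 (y (k + 1)).2
          + Φ (fun l => f (((y (k + 1)).1, (y (k + 1)).2, true) :: l) * (1 - alpha l))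
            * R.ε (y (k + 1)).1 (y (k + 1)).2) / R.d y k Φ
        + (∑ j ∈ Finset.Icc 1 k, R.lam (y (k + 1)).1 (y (k + 1)).2 (y j)
            * Φ (fun l => (R.p * f (((y (k + 1)).1, (y (k + 1)).2, false) :: l)
                + (1 - R.p) * f (((y (k + 1)).1, (y (k + 1)).2, true) :: l))
                * (theta (y j) l * alpha l))) / R.d y k Φ

/-- All filter equations along an observed path with times `T k` and marks `u k`:
`V t f` stands for `π(f, t)`. -/
structure FilterEquations (T : ℕ → EReal) (u : ℕ → E)
    (V : ℝ → (ClusterHistory E → ℝ) → ℝ) : Prop where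
  /-- No cluster quake has happened at time `0`. -/
  initial : ∀ f, V 0 f = f []
  evolution : ∀ (k : ℕ) (r : ℝ), T k = r → ∀ f,
    R.EvolutionEquations (fun i => (u i, (T i).toReal)) k r (T (k + 1)) V f
  /-- The left limits `π(f, τ_{k+1}-)` exist, `d_{k+1}` is positive, and the jump equations hold. -/
  jump : ∀ (k : ℕ) (r : ℝ), T (k + 1) = r →
    ∃ Φ : (ClusterHistory E → ℝ) → ℝ,
      (∀ f, Tendsto (fun t => V t f) (𝓝[<] r) (𝓝 (Φ f))) ∧
      0 < R.d (fun i => (u i, (T i).toReal)) k Φ ∧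
      ∀ f, R.JumpEquations (fun i => (u i, (T i).toReal)) k Φ (V r) f

end MotherQuakeRates

/-!
Up to time `t` the hidden part of the model is the string `κ` of the kinds of the quakes so far.
Given a string `κ`, the likelihood of the observed marks and times is a product (`weight`) of the
intensities at the quakes and of the probabilities `exp (-∫ total intensity)` of seeing nothing in
between (`survival`). Testing the formula for the stochastic intensities with the reciprocal of the
survival probability gives the law of the next quake given the past, and hence all these likelihoods
by induction on the number of quakes. Bayes' formula then says that the filter is a finite mixture
of point masses, one for each string `κ`, with weights proportional to the likelihoods; as it is
supported on a finite set, it integrates every function.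

Between two observations only the survival probabilities change. They depend on `κ` through the
mother quake alone: compared with an inactive cluster, the mother quake `y` contributes the factor
`exp (-∫ (a(y, s) - ε(s)) ds)`. Normalizing gives the explicit solution `flow`, and differentiating
it gives the equation for `π(f, t)`. At an observation every weight is multiplied by an intensity,
and normalizing gives the jump equations; `d` is the ratio of the new normalizing constant to the
old one. For uniqueness, the explicit formula determines `π(θ₀(y_i) α f, t)` after an observation,
so that the difference of two solutions `π(f, t)` satisfies a homogeneous linear equation.
-/

/-! ### Measurability of lists -/

section ListMeasurable

lemma measurable_sigma_mk {ι : Type*} {β : ι → Type*} [∀ i, MeasurableSpace (β i)] (i : ι) :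
    Measurable (Sigma.mk i : β i → Sigma β) := fun _ hS =>
  MeasurableSpace.measurableSet_iInf.1 hS i

lemma measurableSet_sigma {ι : Type*} {β : ι → Type*} [∀ i, MeasurableSpace (β i)]
    {S : Set (Sigma β)} (hS : ∀ i, MeasurableSet (Sigma.mk i ⁻¹' S)) : MeasurableSet S :=
  MeasurableSpace.measurableSet_iInf.2 hS

lemma measurable_from_sigma {ι γ : Type*} {β : ι → Type*} [∀ i, MeasurableSpace (β i)]
    [MeasurableSpace γ] {f : Sigma β → γ} (hf : ∀ i, Measurable fun b => f ⟨i, b⟩) :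
    Measurable f := fun _ hS =>
  measurableSet_sigma fun i => hf i hS

lemma countablyGenerated_iSup {α ι : Type*} [Countable ι] {m : ι → MeasurableSpace α}
    (h : ∀ i, @MeasurableSpace.CountablyGenerated α (m i)) :
    @MeasurableSpace.CountablyGenerated α (⨆ i, m i) := by
  choose b hb hm using fun i => (h i).isCountablyGenerated
  refine @MeasurableSpace.CountablyGenerated.mk α (⨆ i, m i) ⟨⋃ i, b i, countable_iUnion hb, ?_⟩
  rw [← MeasurableSpace.iSup_generateFrom]
  exact iSup_congr hm

instance countablyGenerated_pi {ι : Type*} [Countable ι] {β : ι → Type*}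
    [∀ i, MeasurableSpace (β i)] [∀ i, MeasurableSpace.CountablyGenerated (β i)] :
    MeasurableSpace.CountablyGenerated (∀ i, β i) :=
  countablyGenerated_iSup fun _ => .comap _

variable {X : Type*}

/-- The code of a list: its length and an infinite sequence that prolongs it by the constant `x₀`.
It embeds the lists measurably into a countable product. -/
def listCode (x₀ : X) (l : List X) : ℕ × (ℕ → X) := (l.length, fun i => l.getD i x₀)

variable [MeasurableSpace X]

lemma measurable_equivSigmaTuple : Measurable (List.equivSigmaTuple (α := X)) :=
  comap_measurable _

lemma measurable_list_length : Measurable (List.length : List X → ℕ) := by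
  have h : Measurable fun q : Σ n, Fin n → X => q.1 :=
    measurable_from_sigma (β := fun n => Fin n → X) fun _ => measurable_const
  exact h.comp measurable_equivSigmaTuple

lemma measurable_list_getD (x₀ : X) (i : ℕ) : Measurable fun l : List X => l.getD i x₀ := by
  have h : Measurable fun q : Σ n, Fin n → X => if h : i < q.1 then q.2 ⟨i, h⟩ else x₀ := by
    refine measurable_from_sigma (β := fun n => Fin n → X) fun n => ?_
    by_cases hi : i < n
    · simpa only [hi, dif_pos] using measurable_pi_apply (X := fun _ : Fin n => X) ⟨i, hi⟩
    · simp only [hi, dif_neg, not_false_eq_true, measurable_const]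
  convert h.comp measurable_equivSigmaTuple using 1
  funext l
  by_cases hi : i < l.length <;> simp [List.equivSigmaTuple, hi]

lemma measurable_listCode (x₀ : X) : Measurable (listCode x₀) :=
  measurable_list_length.prodMk (measurable_pi_iff.2 fun i => measurable_list_getD x₀ i)

lemma listMeasurableSpace_eq_comap (x₀ : X) :
    (listMeasurableSpace : MeasurableSpace (List X)) =
      MeasurableSpace.comap (listCode x₀) inferInstance := by
  refine le_antisymm ?_ (measurable_listCode x₀).comap_le
  have decode_measurable :
      Measurable fun q : ℕ × (ℕ → X) => (⟨q.1, fun i => q.2 i⟩ : Σ n, Fin n → X) :=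
    measurable_from_prod_countable_right fun n =>
      (measurable_sigma_mk (β := fun n => Fin n → X) n).comp (by fun_prop)
  have decode_code (l : List X) :
      (⟨l.length, fun i => l.getD i x₀⟩ : Σ n, Fin n → X) = List.equivSigmaTuple l := by
    simp only [List.equivSigmaTuple, Equiv.coe_fn_mk, Sigma.mk.injEq, heq_eq_eq, true_and]
    funext i
    simp
  rintro _ ⟨S, hS, rfl⟩
  refine ⟨_, decode_measurable hS, ?_⟩
  ext l
  change (⟨l.length, fun i : Fin l.length => l.getD i x₀⟩ : Σ n, Fin n → X) ∈ S ↔ _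
  rw [decode_code, mem_preimage]

lemma measurable_list_cons : Measurable fun q : X × List X => q.1 :: q.2 := by
  rcases isEmpty_or_nonempty X with h | ⟨⟨x₀⟩⟩
  · exact measurable_of_empty _
  rw [listMeasurableSpace_eq_comap x₀, measurable_comap_iff, ← listMeasurableSpace_eq_comap x₀]
  refine Measurable.prodMk ?_ (measurable_pi_iff.2 fun i => ?_)
  · exact (measurable_from_top (f := fun n : ℕ => n + 1)).comp
      (measurable_list_length.comp measurable_snd)
  · cases i with
    | zero => simpa using measurable_fst
    | succ i => exact (measurable_list_getD x₀ i).comp measurable_snd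

instance measurableSingletonClass_list [MeasurableSingletonClass X] :
    MeasurableSingletonClass (List X) where
  measurableSet_singleton l := by
    refine ⟨{List.equivSigmaTuple l}, measurableSet_sigma fun n => ?_, ?_⟩
    · refine Set.Subsingleton.measurableSet fun f hf g hg => ?_
      simpa using Eq.trans hf (Eq.symm hg)
    · ext m
      simp

instance countablyGenerated_list [MeasurableSpace.CountablyGenerated X] :
    MeasurableSpace.CountablyGenerated (List X) := by
  rcases isEmpty_or_nonempty X with h | ⟨⟨x₀⟩⟩
  · infer_instance
  · rw [listMeasurableSpace_eq_comap x₀]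
    exact MeasurableSpace.CountablyGenerated.comap _

end ListMeasurable

/-! ### Absolutely continuous functions -/

section AbsolutelyContinuous

variable {f : ℝ → ℝ} {a b : ℝ}

lemma absolutelyContinuousOnInterval_comp_of_lipschitzOnWith {X Y : Type*} [PseudoMetricSpace X]
    [PseudoMetricSpace Y] {f : ℝ → X} {Φ : X → Y} {s : Set X} {K : ℝ≥0}
    (hf : AbsolutelyContinuousOnInterval f a b) (hΦ : LipschitzOnWith K Φ s)
    (hs : MapsTo f (uIcc a b) s) : AbsolutelyContinuousOnInterval (fun x => Φ (f x)) a b := by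
  rw [absolutelyContinuousOnInterval_iff] at hf ⊢
  intro ε hε
  obtain ⟨δ, hδ, h⟩ := hf (ε / (K + 1)) (by positivity)
  refine ⟨δ, hδ, fun I hI hI' => ?_⟩
  calc
    _ ≤ ∑ i ∈ Finset.range I.1, K * dist (f (I.2 i).1) (f (I.2 i).2) :=
      Finset.sum_le_sum fun i hi =>
        hΦ.dist_le_mul _ (hs (hI.1 i hi).1) _ (hs (hI.1 i hi).2)
    _ = K * ∑ i ∈ Finset.range I.1, dist (f (I.2 i).1) (f (I.2 i).2) := by
      rw [Finset.mul_sum]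
    _ ≤ K * (ε / (K + 1)) := by gcongr; exact (h I hI hI').le
    _ < ε := by
      rw [mul_div_assoc', div_lt_iff₀ (by positivity)]
      nlinarith

lemma absolutelyContinuousOnInterval_exp (hf : AbsolutelyContinuousOnInterval f a b) :
    AbsolutelyContinuousOnInterval (fun x => Real.exp (f x)) a b := by
  obtain ⟨C, hC⟩ := hf.exists_bound
  obtain ⟨K, hK⟩ := Real.contDiff_exp.contDiffOn.exists_lipschitzOnWith one_ne_zero
    (convex_Icc (-C) C) isCompact_Icc
  exact absolutelyContinuousOnInterval_comp_of_lipschitzOnWith hf hK fun x hx =>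
    abs_le.1 (hC x hx)

lemma lipschitzOnWith_inv {𝕜 : Type*} [NormedDivisionRing 𝕜] {m : ℝ≥0} (hm : 0 < m) :
    LipschitzOnWith (m * m)⁻¹ (fun x : 𝕜 => x⁻¹) {x | m ≤ ‖x‖} := by
  refine LipschitzOnWith.of_dist_le_mul fun x hx y hy => ?_
  have hm' : (0 : ℝ) < m := hm
  have hx' : (m : ℝ) ≤ ‖x‖ := hx
  have hy' : (m : ℝ) ≤ ‖y‖ := hy
  rw [dist_inv_inv₀ (norm_pos_iff.1 (hm'.trans_le hx')) (norm_pos_iff.1 (hm'.trans_le hy')),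
    div_eq_inv_mul]
  push_cast
  gcongr

lemma absolutelyContinuousOnInterval_inv {𝕜 : Type*} [NormedDivisionRing 𝕜] {f : ℝ → 𝕜}
    (hf : AbsolutelyContinuousOnInterval f a b) (h0 : ∀ x ∈ uIcc a b, f x ≠ 0) :
    AbsolutelyContinuousOnInterval (fun x => (f x)⁻¹) a b := by
  obtain ⟨x₀, hx₀, hmin⟩ :=
    isCompact_uIcc.exists_isMinOn nonempty_uIcc hf.continuousOn.nnnorm
  exact absolutelyContinuousOnInterval_comp_of_lipschitzOnWith hf
    (lipschitzOnWith_inv (nnnorm_pos.2 (h0 x₀ hx₀))) fun x hx => hmin hx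

lemma integral_eq_sub_of_ae_hasDerivAt {g : ℝ → ℝ} (hf : AbsolutelyContinuousOnInterval f a b)
    (hg : ∀ᵐ x, x ∈ uIoc a b → HasDerivAt f (g x) x) :
    IntervalIntegrable g volume a b ∧ ∫ x in a..b, g x = f b - f a := by
  have deriv_eq : ∀ᵐ x, x ∈ uIoc a b → deriv f x = g x := hg.mono fun x hx h => (hx h).deriv
  refine ⟨hf.intervalIntegrable_deriv.congr_ae ((ae_restrict_iff' measurableSet_uIoc).2 deriv_eq),
    ?_⟩
  rw [← hf.integral_deriv_eq_sub]
  exact intervalIntegral.integral_congr_ae (deriv_eq.mono fun x hx h => (hx h).symm)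

lemma integral_exp_integral_mul {g : ℝ → ℝ} (hg : IntervalIntegrable g volume a b) :
    IntervalIntegrable (fun x => Real.exp (∫ v in a..x, g v) * g x) volume a b ∧
      ∫ x in a..b, Real.exp (∫ v in a..x, g v) * g x = Real.exp (∫ v in a..b, g v) - 1 := by
  have hac := absolutelyContinuousOnInterval_exp
    (hg.absolutelyContinuousOnInterval_intervalIntegral (c := a) left_mem_uIcc)
  obtain ⟨hint, hval⟩ := integral_eq_sub_of_ae_hasDerivAt hac
    (hg.ae_hasDerivAt_integral.mono fun x hx h => (hx (uIoc_subset_uIcc h) a left_mem_uIcc).exp)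
  exact ⟨hint, by rw [hval, intervalIntegral.integral_same, Real.exp_zero]⟩

lemma lintegral_exp_lintegral_mul_add_one {Λ : ℝ → ℝ≥0∞} (hΛ : Measurable Λ) {r t : ℝ}
    (hrt : r ≤ t) (hfin : ∫⁻ s in Ioc r t, Λ s ≠ ∞) :
    (∫⁻ s in Ioc r t, ENNReal.ofReal (Real.exp (∫⁻ x in Ioc r s, Λ x).toReal) * Λ s) + 1
      = ENNReal.ofReal (Real.exp (∫⁻ x in Ioc r t, Λ x).toReal) := by
  set g : ℝ → ℝ := fun s => (Λ s).toReal
  have hΛ_lt_top : ∀ᵐ s ∂volume.restrict (Ioc r t), Λ s < ∞ := ae_lt_top hΛ hfin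
  have hg : IntervalIntegrable g volume r t := by
    rw [intervalIntegrable_iff_integrableOn_Ioc_of_le hrt]
    exact integrable_toReal_of_lintegral_ne_top hΛ.aemeasurable hfin
  have toReal_lintegral : ∀ s ∈ Icc r t, (∫⁻ x in Ioc r s, Λ x).toReal = ∫ x in r..s, g x := by
    intro s hs
    rw [intervalIntegral.integral_of_le hs.1, integral_toReal hΛ.aemeasurable]
    exact ae_restrict_of_ae_restrict_of_subset (Ioc_subset_Ioc_right hs.2) hΛ_lt_top
  obtain ⟨hint, hval⟩ := integral_exp_integral_mul hg
  have ofReal_integral : ENNReal.ofReal (∫ x in r..t, Real.exp (∫ v in r..x, g v) * g x)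
      = ∫⁻ s in Ioc r t, ENNReal.ofReal (Real.exp (∫⁻ x in Ioc r s, Λ x).toReal) * Λ s := by
    rw [intervalIntegral.integral_of_le hrt, ofReal_integral_eq_lintegral_ofReal
      ((intervalIntegrable_iff_integrableOn_Ioc_of_le hrt).1 hint)
      (ae_of_all _ fun s => mul_nonneg (Real.exp_nonneg _) ENNReal.toReal_nonneg)]
    refine lintegral_congr_ae ?_
    filter_upwards [hΛ_lt_top, ae_restrict_mem measurableSet_Ioc] with s hs hs'
    rw [ENNReal.ofReal_mul (Real.exp_nonneg _), toReal_lintegral s (Ioc_subset_Icc_self hs'),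
      ENNReal.ofReal_toReal hs.ne]
  have one_le : 1 ≤ Real.exp (∫ v in r..t, g v) :=
    Real.one_le_exp (intervalIntegral.integral_nonneg hrt fun _ _ => ENNReal.toReal_nonneg)
  rw [← ofReal_integral, hval, toReal_lintegral t ⟨hrt, le_rfl⟩, ← ENNReal.ofReal_one,
    ← ENNReal.ofReal_add (sub_nonneg.2 one_le) zero_le_one, sub_add_cancel]

end AbsolutelyContinuous

/-! ### Histories from observed paths and hidden kinds -/

namespace QuakeKind

noncomputable instance instDecidableEq : DecidableEq QuakeKind := Classical.decEq _

noncomputable instance instFintype : Fintype QuakeKind where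
  elems := {single, cluster true, cluster false}
  complete k := by rcases k with _ | (_ | _) <;> simp

instance instDiscreteMeasurableSpace : DiscreteMeasurableSpace QuakeKind := ⟨fun _ => trivial⟩

lemma sum_eq {V : Type*} [AddCommMonoid V] (F : QuakeKind → V) :
    ∑ k, F k = F single + F (cluster true) + F (cluster false) := by
  change ∑ k ∈ {single, cluster true, cluster false}, F k = _
  rw [Finset.sum_insert (by simp), Finset.sum_insert (by simp), Finset.sum_singleton, add_assoc]

end QuakeKind

/-- The possible sequences of kinds of the first `n` quakes, the most recent quake first. -/
noncomputable def kindStrings : ℕ → Finset (List QuakeKind)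
  | 0 => {[]}
  | n + 1 => (kindStrings n ×ˢ Finset.univ).map
      ⟨fun q : List QuakeKind × QuakeKind => q.2 :: q.1, by rintro ⟨a, b⟩ ⟨c, d⟩ h; simp_all⟩

lemma mem_kindStrings {n : ℕ} {κ : List QuakeKind} : κ ∈ kindStrings n ↔ κ.length = n := by
  induction n generalizing κ with
  | zero => simp [kindStrings]
  | succ n ih =>
    cases κ with
    | nil => simp [kindStrings]
    | cons k κ =>
      simp only [kindStrings, Finset.mem_map, Finset.mem_product, ih, Finset.mem_univ, and_true,
        Prod.exists, List.length_cons, Nat.add_right_cancel_iff]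
      exact ⟨by rintro ⟨a, b, h, h'⟩; cases h'; exact h, fun h => ⟨κ, k, h, rfl⟩⟩

lemma sum_kindStrings_zero {V : Type*} [AddCommMonoid V] (F : List QuakeKind → V) :
    ∑ κ ∈ kindStrings 0, F κ = F [] := by simp [kindStrings]

lemma sum_kindStrings_succ {V : Type*} [AddCommMonoid V] (n : ℕ) (F : List QuakeKind → V) :
    ∑ κ ∈ kindStrings (n + 1), F κ = ∑ κ ∈ kindStrings n, ∑ k, F (k :: κ) := by
  rw [kindStrings, Finset.sum_map, Finset.sum_product]
  rfl

/-- The number of the mother quake of the cluster that is active after quakes of the given kinds,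
if there is one. -/
def motherIdx : List QuakeKind → Option ℕ
  | [] => none
  | QuakeKind.single :: κ => motherIdx κ
  | QuakeKind.cluster false :: _ => none
  | QuakeKind.cluster true :: κ => some ((motherIdx κ).getD (κ.length + 1))

lemma motherIdx_mem {κ : List QuakeKind} {i : ℕ} (h : motherIdx κ = some i) :
    i ∈ Finset.Icc 1 κ.length := by
  rw [Finset.mem_Icc]
  induction κ generalizing i with
  | nil => simp [motherIdx] at h
  | cons k κ ih =>
    rw [List.length_cons]
    rcases k with _ | (_ | _)
    · have := ih h
      lia
    · simp [motherIdx] at h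
    · cases hm : motherIdx κ with
      | none =>
        simp only [motherIdx, hm, Option.getD_none, Option.some.injEq] at h
        lia
      | some j =>
        have := ih hm
        simp only [motherIdx, hm, Option.getD_some, Option.some.injEq] at h
        lia

/-- Two paths `y`, `y'` of observed quakes, numbered from `1`, that cannot be distinguished by
their first `n` quakes.  Number `0` stands for the start of the observation: only its time has a
meaning. -/
def AgreeUpTo {E : Type*} (n : ℕ) (y y' : ℕ → E × ℝ) : Prop :=
  (y 0).2 = (y' 0).2 ∧ ∀ i, 1 ≤ i → i ≤ n → y i = y' i

namespace AgreeUpTo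

variable {E : Type*} {m n : ℕ} {y y' : ℕ → E × ℝ}

lemma symm (h : AgreeUpTo n y y') : AgreeUpTo n y' y :=
  ⟨h.1.symm, fun i h1 hi => (h.2 i h1 hi).symm⟩

lemma mono (h : AgreeUpTo n y y') (hmn : m ≤ n) : AgreeUpTo m y y' :=
  ⟨h.1, fun i hi him => h.2 i hi (him.trans hmn)⟩

lemma time_eq {i : ℕ} (h : AgreeUpTo n y y') (hi : i ≤ n) : (y i).2 = (y' i).2 := by
  rcases Nat.eq_zero_or_pos i with rfl | h0
  · exact h.1
  · rw [h.2 i h0 hi]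

lemma update (n : ℕ) (y : ℕ → E × ℝ) (x : E × ℝ) :
    AgreeUpTo n (Function.update y (n + 1) x) y :=
  ⟨by simp, fun i _ hi => by rw [Function.update_of_ne (by lia)]⟩

end AgreeUpTo

/-- The observation starts at time `0`, and the times of the first `n` quakes are positive and
increase. -/
def IncreasingUpTo {E : Type*} (n : ℕ) (y : ℕ → E × ℝ) : Prop :=
  (y 0).2 = 0 ∧ StrictMonoOn (fun i => (y i).2) (Iic n)

namespace IncreasingUpTo

variable {E : Type*} {m n i j : ℕ} {y y' : ℕ → E × ℝ}

lemma mono (h : IncreasingUpTo n y) (hmn : m ≤ n) : IncreasingUpTo m y :=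
  ⟨h.1, h.2.mono (Iic_subset_Iic.2 hmn)⟩

lemma lt (h : IncreasingUpTo n y) (hij : i < j) (hj : j ≤ n) : (y i).2 < (y j).2 :=
  h.2 (hij.le.trans hj) hj hij

lemma le (h : IncreasingUpTo n y) (hij : i ≤ j) (hj : j ≤ n) : (y i).2 ≤ (y j).2 :=
  h.2.monotoneOn (hij.trans hj) hj hij

lemma nonneg (h : IncreasingUpTo n y) (hi : i ≤ n) : 0 ≤ (y i).2 :=
  h.1 ▸ h.le (Nat.zero_le i) hi

lemma ne (h : IncreasingUpTo n y) (hi : i ≤ n) (hj : j ≤ n) (hij : i ≠ j) : y i ≠ y j :=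
  fun hy => hij (h.2.injOn hi hj (congrArg Prod.snd hy))

lemma congr (h : IncreasingUpTo n y) (hy : AgreeUpTo n y y') : IncreasingUpTo n y' :=
  ⟨hy.1 ▸ h.1, h.2.congr fun _ hi => hy.time_eq hi⟩

end IncreasingUpTo

namespace ClusterHistory

variable {E : Type*}

lemma isSome_mother (l : ClusterHistory E) : (mother l).isSome = active l := by
  induction l with
  | nil => rfl
  | cons x l ih =>
    obtain ⟨v, s, d⟩ := x
    cases d <;> cases h : active l <;> simp_all [mother, active]

/-- The cluster history of quakes with marks and times `y 1, y 2, …` and the given kinds, the most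
recent quake first. -/
def ofKinds (y : ℕ → E × ℝ) : List QuakeKind → ClusterHistory E
  | [] => []
  | QuakeKind.single :: κ => ofKinds y κ
  | QuakeKind.cluster D :: κ => ((y (κ.length + 1)).1, (y (κ.length + 1)).2, D) :: ofKinds y κ

lemma mother_ofKinds (y : ℕ → E × ℝ) (κ : List QuakeKind) :
    mother (ofKinds y κ) = (motherIdx κ).map y := by
  induction κ with
  | nil => rfl
  | cons k κ ih =>
    rcases k with _ | (_ | _)
    · exact ih
    · rfl
    · have h := isSome_mother (ofKinds y κ)
      rw [ih, Option.isSome_map] at h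
      cases hm : motherIdx κ <;> simp [ofKinds, mother, motherIdx, ← h, hm, ih]

lemma active_ofKinds (y : ℕ → E × ℝ) (κ : List QuakeKind) :
    active (ofKinds y κ) = (motherIdx κ).isSome := by
  rw [← isSome_mother, mother_ofKinds, Option.isSome_map]

lemma ofKinds_congr {κ : List QuakeKind} {y y' : ℕ → E × ℝ}
    (h : AgreeUpTo κ.length y y') : ofKinds y κ = ofKinds y' κ := by
  induction κ with
  | nil => rfl
  | cons k κ ih =>
    have ih' := ih (h.mono (by simp))
    cases k with
    | single => exact ih'
    | cluster D => simp [ofKinds, ih', h.2 (κ.length + 1) (by lia) (by simp)]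

lemma measurable_ofKinds [MeasurableSpace E] (κ : List QuakeKind) :
    Measurable fun y : ℕ → E × ℝ => ofKinds y κ := by
  induction κ with
  | nil => exact measurable_const
  | cons k κ ih =>
    cases k with
    | single => exact ih
    | cluster D => exact measurable_list_cons.comp (Measurable.prodMk (by fun_prop) ih)

end ClusterHistory

/-! ### Total intensities and the weights of the hidden kinds -/

namespace MotherQuakeRates

open ClusterHistory

variable {E : Type*} [MeasurableSpace E] {ν : Measure E} (R : MotherQuakeRates E ν)

lemma sum_rate (l : ClusterHistory E) (u : E) (s : ℝ) :
    ∑ k, R.rate l u s k = R.γ u s + R.clusterRate l u s := by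
  have transition_sum : R.transition l.active true + R.transition l.active false = 1 := by
    cases active l
    · simp [transition]
    · exact tsub_add_cancel_of_le R.p_le_one
  simp only [QuakeKind.sum_eq, rate]
  rw [add_assoc, ← mul_add, transition_sum, mul_one]

lemma clusterRate_ofKinds (y : ℕ → E × ℝ) (κ : List QuakeKind) (u : E) (s : ℝ) :
    R.clusterRate (ofKinds y κ) u s =
      match motherIdx κ with
      | some i => R.lam u s (y i)
      | none => R.ε u s := by
  unfold clusterRate
  rw [mother_ofKinds]
  cases motherIdx κ <;> rfl

lemma measurable_clusterRate (κ : List QuakeKind) :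
    Measurable fun x : (ℕ → E × ℝ) × E × ℝ => R.clusterRate (ofKinds x.1 κ) x.2.1 x.2.2 := by
  simp only [clusterRate_ofKinds]
  cases motherIdx κ with
  | none => exact R.measurable_ε.comp measurable_snd
  | some i =>
    exact R.measurable_lam.comp
      (f := fun x : (ℕ → E × ℝ) × E × ℝ => (x.2.1, x.2.2, x.1 i)) (by fun_prop)

lemma measurable_rate (κ : List QuakeKind) (k : QuakeKind) :
    Measurable fun x : (ℕ → E × ℝ) × E × ℝ => R.rate (ofKinds x.1 κ) x.2.1 x.2.2 k := by
  cases k with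
  | single => exact R.measurable_γ.comp measurable_snd
  | cluster D =>
    simp only [rate, active_ofKinds]
    exact (R.measurable_clusterRate κ).mul_const _

/-- The total intensity of quakes given the kinds of the previous quakes. -/
noncomputable def totalRate (y : ℕ → E × ℝ) (κ : List QuakeKind) (s : ℝ) : ℝ≥0∞ :=
  ∫⁻ u, ∑ k, (R.rate (ofKinds y κ) u s k : ℝ≥0∞) ∂ν

/-- The integral of the total intensity from the last quake to time `t`. -/
noncomputable def cumRate (y : ℕ → E × ℝ) (κ : List QuakeKind) (t : ℝ) : ℝ≥0∞ :=
  ∫⁻ s in Ioc (y κ.length).2 t, R.totalRate y κ s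

/-- The probability that no quake occurs from the last quake to time `t`. -/
noncomputable def survival (y : ℕ → E × ℝ) (κ : List QuakeKind) (t : ℝ) : ℝ≥0 :=
  (Real.exp (-(R.cumRate y κ t).toReal)).toNNReal

/-- The unnormalized conditional probability of the kinds `κ` given the observations `y`. -/
noncomputable def weight (y : ℕ → E × ℝ) : List QuakeKind → ℝ≥0
  | [] => 1
  | k :: κ => weight y κ * (R.survival y κ (y (κ.length + 1)).2
      * R.rate (ofKinds y κ) (y (κ.length + 1)).1 (y (κ.length + 1)).2 k)

lemma survival_pos (y : ℕ → E × ℝ) (κ : List QuakeKind) (t : ℝ) : 0 < R.survival y κ t :=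
  Real.toNNReal_pos.2 (Real.exp_pos _)

lemma coe_survival (y : ℕ → E × ℝ) (κ : List QuakeKind) (t : ℝ) :
    (R.survival y κ t : ℝ) = Real.exp (-(R.cumRate y κ t).toReal) :=
  Real.coe_toNNReal _ (Real.exp_nonneg _)

lemma inv_survival (y : ℕ → E × ℝ) (κ : List QuakeKind) (t : ℝ) :
    (R.survival y κ t : ℝ≥0∞)⁻¹ = ENNReal.ofReal (Real.exp (R.cumRate y κ t).toReal) := by
  change (ENNReal.ofReal _)⁻¹ = _
  rw [← ENNReal.ofReal_inv_of_pos (Real.exp_pos _), ← Real.exp_neg, neg_neg]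

lemma totalRate_eq (y : ℕ → E × ℝ) (κ : List QuakeKind) (s : ℝ) :
    R.totalRate y κ s
      = ∫⁻ u, (R.γ u s : ℝ≥0∞) ∂ν + ∫⁻ u, (R.clusterRate (ofKinds y κ) u s : ℝ≥0∞) ∂ν := by
  have hγ : Measurable fun u => (R.γ u s : ℝ≥0∞) :=
    (R.measurable_γ.comp (f := fun u => (u, s)) (by fun_prop)).coe_nnreal_ennreal
  rw [← lintegral_add_left hγ]
  refine lintegral_congr fun u => ?_
  exact_mod_cast R.sum_rate (ofKinds y κ) u s

lemma totalRate_congr {κ : List QuakeKind} {y y' : ℕ → E × ℝ} (h : AgreeUpTo κ.length y y')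
    (s : ℝ) : R.totalRate y κ s = R.totalRate y' κ s := by
  simp only [totalRate, ofKinds_congr h]

lemma cumRate_congr {κ : List QuakeKind} {y y' : ℕ → E × ℝ} (h : AgreeUpTo κ.length y y')
    (t : ℝ) : R.cumRate y κ t = R.cumRate y' κ t := by
  simp only [cumRate, R.totalRate_congr h, h.time_eq le_rfl]

lemma survival_congr {κ : List QuakeKind} {y y' : ℕ → E × ℝ} (h : AgreeUpTo κ.length y y')
    (t : ℝ) : R.survival y κ t = R.survival y' κ t := by
  simp only [survival, R.cumRate_congr h]

lemma weight_congr {κ : List QuakeKind} {y y' : ℕ → E × ℝ} (h : AgreeUpTo κ.length y y') :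
    R.weight y κ = R.weight y' κ := by
  induction κ with
  | nil => rfl
  | cons k κ ih =>
    have h' : AgreeUpTo κ.length y y' := h.mono (by simp)
    simp only [weight, ih h', R.survival_congr h', ofKinds_congr h',
      h.2 (κ.length + 1) (by lia) (by simp)]

lemma weight_update (k : QuakeKind) (κ : List QuakeKind) (y : ℕ → E × ℝ) (x : E × ℝ) :
    R.weight (Function.update y (κ.length + 1) x) (k :: κ)
      = R.weight y κ * (R.survival y κ x.2 * R.rate (ofKinds y κ) x.1 x.2 k) := by
  have h := AgreeUpTo.update κ.length y x
  simp [weight, R.weight_congr h, R.survival_congr h, ofKinds_congr h]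

lemma measurable_totalRate [SFinite ν] (κ : List QuakeKind) :
    Measurable fun x : (ℕ → E × ℝ) × ℝ => R.totalRate x.1 κ x.2 := by
  unfold totalRate
  refine Measurable.lintegral_prod_right'
    (f := fun z : ((ℕ → E × ℝ) × ℝ) × E =>
      ∑ k, (R.rate (ofKinds z.1.1 κ) z.2 z.1.2 k : ℝ≥0∞)) ?_
  refine Finset.measurable_sum _ fun k _ => ?_
  exact ((R.measurable_rate κ k).comp
    (f := fun z : ((ℕ → E × ℝ) × ℝ) × E => (z.1.1, z.2, z.1.2)) (by fun_prop)).coe_nnreal_ennreal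

lemma measurable_cumRate [SFinite ν] (κ : List QuakeKind) :
    Measurable fun x : (ℕ → E × ℝ) × ℝ => R.cumRate x.1 κ x.2 := by
  have eq_lintegral_indicator : (fun x : (ℕ → E × ℝ) × ℝ => R.cumRate x.1 κ x.2) = fun x => ∫⁻ s,
      {z : ((ℕ → E × ℝ) × ℝ) × ℝ | (z.1.1 κ.length).2 < z.2 ∧ z.2 ≤ z.1.2}.indicator
        (fun z => R.totalRate z.1.1 κ z.2) (x, s) := by
    funext x
    rw [cumRate, ← lintegral_indicator measurableSet_Ioc]
    rfl
  rw [eq_lintegral_indicator]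
  refine Measurable.lintegral_prod_right' (Measurable.indicator ?_ ?_)
  · exact (R.measurable_totalRate κ).comp
      (f := fun z : ((ℕ → E × ℝ) × ℝ) × ℝ => (z.1.1, z.2)) (by fun_prop)
  · have h₁ : Measurable fun z : ((ℕ → E × ℝ) × ℝ) × ℝ => (z.1.1 κ.length).2 := by fun_prop
    have h₂ : Measurable fun z : ((ℕ → E × ℝ) × ℝ) × ℝ => z.1.2 := by fun_prop
    exact (measurableSet_lt h₁ measurable_snd).inter (measurableSet_le measurable_snd h₂)

lemma measurable_survival [SFinite ν] (κ : List QuakeKind) :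
    Measurable fun x : (ℕ → E × ℝ) × ℝ => R.survival x.1 κ x.2 :=
  (Real.measurable_exp.comp (R.measurable_cumRate κ).ennreal_toReal.neg).real_toNNReal

lemma measurable_weight [SFinite ν] (κ : List QuakeKind) :
    Measurable fun y : ℕ → E × ℝ => R.weight y κ := by
  induction κ with
  | nil => exact measurable_const
  | cons k κ ih =>
    refine ih.mul (Measurable.mul ?_ ?_)
    · exact (R.measurable_survival κ).comp
        (f := fun y : ℕ → E × ℝ => (y, (y (κ.length + 1)).2)) (by fun_prop)
    · exact (R.measurable_rate κ k).comp
        (f := fun y : ℕ → E × ℝ => (y, (y (κ.length + 1)).1, (y (κ.length + 1)).2)) (by fun_prop)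

lemma measurable_lintegral_γ [SFinite ν] : Measurable fun s => ∫⁻ u, (R.γ u s : ℝ≥0∞) ∂ν :=
  Measurable.lintegral_prod_left' (f := fun x : E × ℝ => (R.γ x.1 x.2 : ℝ≥0∞))
    R.measurable_γ.coe_nnreal_ennreal

lemma measurable_lintegral_ε [SFinite ν] : Measurable fun s => ∫⁻ u, (R.ε u s : ℝ≥0∞) ∂ν :=
  Measurable.lintegral_prod_left' (f := fun x : E × ℝ => (R.ε x.1 x.2 : ℝ≥0∞))
    R.measurable_ε.coe_nnreal_ennreal

lemma measurable_lintegral_lam [SFinite ν] (x : E × ℝ) :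
    Measurable fun s => ∫⁻ u, (R.lam u s x : ℝ≥0∞) ∂ν :=
  Measurable.lintegral_prod_left' (f := fun z : E × ℝ => (R.lam z.1 z.2 x : ℝ≥0∞))
    (R.measurable_lam.comp (f := fun z : E × ℝ => (z.1, z.2, x)) (by fun_prop)).coe_nnreal_ennreal

lemma lintegral_lam_ne_top {x : E × ℝ} (hx : 0 ≤ x.2) {r : ℝ} (hr : x.2 ≤ r) (t : ℝ) :
    ∫⁻ s in Ioc r t, ∫⁻ u, (R.lam u s x : ℝ≥0∞) ∂ν ≠ ∞ :=
  ne_top_of_le_ne_top (R.lam_finite x hx t)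
    (lintegral_mono_set (Ioc_subset_Ioc_left hr))

lemma lintegral_ε_ne_top {r : ℝ} (hr : 0 ≤ r) (t : ℝ) :
    ∫⁻ s in Ioc r t, ∫⁻ u, (R.ε u s : ℝ≥0∞) ∂ν ≠ ∞ :=
  ne_top_of_le_ne_top (R.ε_finite t) (lintegral_mono_set (Ioc_subset_Ioc_left hr))

lemma lintegral_γ_ne_top {r : ℝ} (hr : 0 ≤ r) (t : ℝ) :
    ∫⁻ s in Ioc r t, ∫⁻ u, (R.γ u s : ℝ≥0∞) ∂ν ≠ ∞ :=
  ne_top_of_le_ne_top (R.γ_finite t) (lintegral_mono_set (Ioc_subset_Ioc_left hr))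

lemma cumRate_eq [SFinite ν] (y : ℕ → E × ℝ) (κ : List QuakeKind) (t : ℝ) :
    R.cumRate y κ t = (∫⁻ s in Ioc (y κ.length).2 t, ∫⁻ u, (R.γ u s : ℝ≥0∞) ∂ν)
      + ∫⁻ s in Ioc (y κ.length).2 t, ∫⁻ u,
          (R.clusterRate (ofKinds y κ) u s : ℝ≥0∞) ∂ν := by
  unfold cumRate
  rw [← lintegral_add_left R.measurable_lintegral_γ]
  exact lintegral_congr fun s => R.totalRate_eq y κ s

lemma cumRate_ne_top [SFinite ν] {y : ℕ → E × ℝ} {κ : List QuakeKind}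
    (hy : IncreasingUpTo κ.length y) (t : ℝ) : R.cumRate y κ t ≠ ∞ := by
  rw [R.cumRate_eq y κ t]
  refine ENNReal.add_ne_top.2 ⟨R.lintegral_γ_ne_top (hy.nonneg le_rfl) t, ?_⟩
  simp only [clusterRate_ofKinds]
  cases h : motherIdx κ with
  | none => exact R.lintegral_ε_ne_top (hy.nonneg le_rfl) t
  | some i =>
    have hi := (Finset.mem_Icc.1 (motherIdx_mem h)).2
    exact R.lintegral_lam_ne_top (hy.nonneg hi) (hy.le hi le_rfl) t

lemma survival_antitone [SFinite ν] {y : ℕ → E × ℝ} {κ : List QuakeKind}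
    (hy : IncreasingUpTo κ.length y) : Antitone (R.survival y κ) := by
  intro s t hst
  have cumRate_le : R.cumRate y κ s ≤ R.cumRate y κ t :=
    lintegral_mono_set (Ioc_subset_Ioc_right hst)
  exact Real.toNNReal_le_toNNReal (Real.exp_le_exp.2
    (neg_le_neg (ENNReal.toReal_mono (R.cumRate_ne_top hy t) cumRate_le)))

lemma lintegral_inv_survival_mul_totalRate_add_one [SFinite ν] {y : ℕ → E × ℝ}
    {κ : List QuakeKind} (hy : IncreasingUpTo κ.length y) {t : ℝ} (ht : (y κ.length).2 ≤ t) :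
    (∫⁻ s in Ioc (y κ.length).2 t, (R.survival y κ s : ℝ≥0∞)⁻¹ * R.totalRate y κ s) + 1
      = (R.survival y κ t : ℝ≥0∞)⁻¹ := by
  have measurable_rate_path : Measurable (R.totalRate y κ) :=
    (R.measurable_totalRate κ).comp measurable_prodMk_left
  simp only [inv_survival]
  exact lintegral_exp_lintegral_mul_add_one measurable_rate_path ht (R.cumRate_ne_top hy t)

end MotherQuakeRates

/-! ### The observed path and the kinds of the quakes -/

lemma measurable_comp_countable {α β γ K : Type*} {_ : MeasurableSpace α} [MeasurableSpace β]
    [MeasurableSpace γ] [MeasurableSpace K] [Countable K] [MeasurableSingletonClass K]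
    {g : K → β → γ} (hg : ∀ κ, Measurable (g κ)) {κ : α → K} (hκ : Measurable κ) {f : α → β}
    (hf : Measurable f) : Measurable fun a => g (κ a) (f a) :=
  (measurable_from_prod_countable_right (f := fun x : K × β => g x.1 x.2) hg).comp (hκ.prodMk hf)

instance QuakeKind.instCountable : Countable QuakeKind := Finite.to_countable

namespace QuakeProcess

open ClusterHistory

variable {E Ω : Type*} [MeasurableSpace E] [mΩ : MeasurableSpace Ω] (X : QuakeProcess E Ω)

lemma T_mono (ω : Ω) : Monotone fun n => X.T n ω := monotone_nat_of_le_succ fun n => X.T_le n ω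

lemma T_nonneg (n : ℕ) (ω : Ω) : 0 ≤ X.T n ω := X.T_zero ω ▸ X.T_mono ω (Nat.zero_le n)

lemma T_ne_bot (n : ℕ) (ω : Ω) : X.T n ω ≠ ⊥ :=
  fun h => by have := X.T_nonneg n ω; simp [h] at this

lemma coe_toReal_T {n : ℕ} {ω : Ω} (h : X.T n ω ≠ ⊤) : ((X.T n ω).toReal : EReal) = X.T n ω :=
  EReal.coe_toReal h (X.T_ne_bot n ω)

lemma T_lt_of_lt {m n : ℕ} (hmn : m < n) {ω : Ω} (h : X.T m ω ≠ ⊤) : X.T m ω < X.T n ω :=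
  (X.T_lt m ω h).trans_le (X.T_mono ω hmn)

lemma T_ne_top_of_le {m n : ℕ} (hmn : m ≤ n) {ω : Ω} (h : X.T n ω ≠ ⊤) : X.T m ω ≠ ⊤ :=
  ne_top_of_le_ne_top h (X.T_mono ω hmn)

lemma toReal_T_nonneg (n : ℕ) (ω : Ω) : 0 ≤ (X.T n ω).toReal :=
  EReal.toReal_nonneg (X.T_nonneg n ω)

/-- Marks and times of the quakes. -/
noncomputable def path (ω : Ω) (n : ℕ) : E × ℝ := (X.mark n ω, (X.T n ω).toReal)

/-- Marks and times of the first `n` quakes; all later ones are replaced by the value `(e₀, 0)`, so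
that this path depends on the first `n` quakes only. -/
noncomputable def pathUpTo (e₀ : E) (n : ℕ) (ω : Ω) (i : ℕ) : E × ℝ :=
  if 1 ≤ i ∧ i ≤ n then X.path ω i else (e₀, 0)

/-- The kinds of the first `n` quakes, the most recent quake first. -/
def kinds (ω : Ω) : ℕ → List QuakeKind
  | 0 => []
  | n + 1 => X.kind (n + 1) ω :: kinds ω n

@[simp] lemma length_kinds (ω : Ω) (n : ℕ) : (X.kinds ω n).length = n := by
  induction n with
  | zero => rfl
  | succ n ih => simp [kinds, ih]

lemma kinds_mem (ω : Ω) (n : ℕ) : X.kinds ω n ∈ kindStrings n :=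
  mem_kindStrings.2 (X.length_kinds ω n)

lemma agreeUpTo_pathUpTo (e₀ : E) (n : ℕ) (ω : Ω) :
    AgreeUpTo n (X.pathUpTo e₀ n ω) (X.path ω) :=
  ⟨by simp [pathUpTo, path, X.T_zero], fun i h1 hn => by simp [pathUpTo, h1, hn]⟩

lemma pathUpTo_succ (e₀ : E) (n : ℕ) (ω : Ω) :
    X.pathUpTo e₀ (n + 1) ω = Function.update (X.pathUpTo e₀ n ω) (n + 1)
      (X.mark (n + 1) ω, (X.T (n + 1) ω).toReal) := by
  funext i
  by_cases hi : i = n + 1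
  · simp [hi, pathUpTo, path]
  · rw [Function.update_of_ne hi]
    have le_iff : i ≤ n + 1 ↔ i ≤ n := by lia
    simp only [pathUpTo, le_iff]

lemma clusterHist_eq (ω : Ω) (n : ℕ) :
    X.clusterHist ω n = ofKinds (X.path ω) (X.kinds ω n) := by
  induction n with
  | zero => rfl
  | succ n ih =>
    unfold clusterHist kinds
    cases X.kind (n + 1) ω with
    | single => exact ih
    | cluster D => simp [ofKinds, ih, path]

lemma clusterHist_eq_pathUpTo (e₀ : E) (ω : Ω) (n : ℕ) :
    X.clusterHist ω n = ofKinds (X.pathUpTo e₀ n ω) (X.kinds ω n) := by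
  rw [clusterHist_eq]
  refine (ofKinds_congr ?_).symm
  simpa using X.agreeUpTo_pathUpTo e₀ n ω

lemma increasingUpTo_path {n : ℕ} {ω : Ω} (h : X.T n ω ≠ ⊤) : IncreasingUpTo n (X.path ω) := by
  refine ⟨by simp [path, X.T_zero], fun i hi j hj hij => ?_⟩
  have hT := X.T_lt_of_lt hij (X.T_ne_top_of_le hi h)
  rw [← X.coe_toReal_T (X.T_ne_top_of_le hi h), ← X.coe_toReal_T (X.T_ne_top_of_le hj h)] at hT
  exact EReal.coe_lt_coe_iff.1 hT

lemma increasingUpTo_pathUpTo (e₀ : E) {n : ℕ} {ω : Ω} (h : X.T n ω ≠ ⊤) :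
    IncreasingUpTo n (X.pathUpTo e₀ n ω) :=
  (X.increasingUpTo_path h).congr (X.agreeUpTo_pathUpTo e₀ n ω).symm

lemma pathUpTo_time (e₀ : E) (n : ℕ) (ω : Ω) : (X.pathUpTo e₀ n ω n).2 = (X.T n ω).toReal :=
  (X.agreeUpTo_pathUpTo e₀ n ω).time_eq le_rfl

lemma ncard_eq_of_T {p : EReal → Prop} {n : ℕ} {ω : Ω} (hp : Antitone p)
    (h : p (X.T n ω)) (h' : ¬ p (X.T (n + 1) ω)) :
    Set.ncard {m : ℕ | 1 ≤ m ∧ p (X.T m ω)} = n := by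
  have eq_Icc : {m : ℕ | 1 ≤ m ∧ p (X.T m ω)} = ((Finset.Icc 1 n : Finset ℕ) : Set ℕ) := by
    ext m
    simp only [mem_ofPred_eq, Finset.coe_Icc, mem_Icc]
    refine and_congr_right fun _ => ⟨fun hpm => ?_, fun hmn => hp (X.T_mono ω hmn) h⟩
    by_contra hlt
    exact h' (hp (X.T_mono ω (by lia)) hpm)
  rw [eq_Icc, Set.ncard_coe_finset, Nat.card_Icc, Nat.add_sub_cancel]

lemma histBefore_eq {n : ℕ} {ω : Ω} {s : ℝ} (h : X.T n ω < s) (h' : s ≤ X.T (n + 1) ω) :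
    X.histBefore s ω = X.clusterHist ω n := by
  rw [histBefore, X.ncard_eq_of_T (p := fun a => a < (s : EReal))
    (fun a b hab hb => hab.trans_lt hb) h (not_lt.2 h')]

lemma hist_eq {n : ℕ} {ω : Ω} {t : ℝ} (h : X.T n ω ≤ t) (h' : t < X.T (n + 1) ω) :
    X.hist t ω = X.clusterHist ω n := by
  rw [hist, X.ncard_eq_of_T (p := fun a => a ≤ (t : EReal)) (fun a b hab hb => hab.trans hb)
    h (not_le.2 h')]

lemma exists_T_le_lt (ω : Ω) {t : ℝ} (ht : 0 ≤ t) :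
    ∃ n, X.T n ω ≤ t ∧ (t : EReal) < X.T (n + 1) ω := by
  classical
  have hex : ∃ n, (t : EReal) < X.T (n + 1) ω := by
    obtain ⟨n, hn⟩ := X.T_unbounded ω t
    exact ⟨n, hn.trans_le (X.T_le n ω)⟩
  refine ⟨Nat.find hex, ?_, Nat.find_spec hex⟩
  cases h : Nat.find hex with
  | zero => rw [X.T_zero]; exact_mod_cast ht
  | succ m => exact not_lt.1 (Nat.find_min hex (m := m) (by lia))

lemma T_index_unique {ω : Ω} {t : ℝ} {m n : ℕ} (hm : X.T m ω ≤ t)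
    (hm' : (t : EReal) < X.T (m + 1) ω) (hn : X.T n ω ≤ t)
    (hn' : (t : EReal) < X.T (n + 1) ω) : m = n := by
  refine le_antisymm ?_ ?_ <;> by_contra! h
  · exact (hn'.trans_le ((X.T_mono ω h).trans hm)).false
  · exact (hm'.trans_le ((X.T_mono ω h).trans hn)).false

lemma measurable_path : Measurable X.path :=
  measurable_pi_iff.2 fun n => (X.measurable_mark n).prodMk (X.measurable_T n).ereal_toReal

lemma measurable_pathUpTo (e₀ : E) (n : ℕ) : Measurable (X.pathUpTo e₀ n) := by
  refine measurable_pi_iff.2 fun i => ?_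
  by_cases h : 1 ≤ i ∧ i ≤ n
  · simpa [pathUpTo, h] using measurable_pi_iff.1 X.measurable_path i
  · simp [pathUpTo, h]

lemma measurable_kinds (n : ℕ) : Measurable fun ω => X.kinds ω n := by
  induction n with
  | zero => exact measurable_const
  | succ n ih => exact measurable_list_cons.comp ((X.measurable_kind (n + 1)).prodMk ih)

lemma measurable_clusterHist (n : ℕ) : Measurable fun ω => X.clusterHist ω n := by
  simp only [clusterHist_eq]
  exact measurable_comp_countable (g := fun κ y => ofKinds y κ)
    (fun κ => measurable_ofKinds κ) (X.measurable_kinds n) X.measurable_path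

end QuakeProcess

/-! ### Predictability -/

namespace QuakeProcess

variable {E Ω : Type*} [MeasurableSpace E] [mΩ : MeasurableSpace Ω] (X : QuakeProcess E Ω)

/-- Marks and times of the quakes before time `s`, at a point `(s, ω)`: a predictable version of
`pathUpTo`. -/
noncomputable def predPath (e₀ : E) (x : ℝ≥0 × Ω) (i : ℕ) : E × ℝ :=
  if 1 ≤ i ∧ X.T i x.2 < ((x.1 : ℝ) : EReal) then X.path x.2 i else (e₀, 0)

/-- The kinds of the first `n` quakes, at a point `(s, ω)`, with the value `single` for those that
have not occurred before time `s`: a predictable version of `kinds`. -/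
noncomputable def predKinds : ℕ → ℝ≥0 × Ω → List QuakeKind
  | 0, _ => []
  | n + 1, x => (if X.T (n + 1) x.2 < ((x.1 : ℝ) : EReal) then X.kind (n + 1) x.2
      else QuakeKind.single) :: predKinds n x

lemma predPath_eq (e₀ : E) {n : ℕ} {x : ℝ≥0 × Ω} (h : X.T n x.2 < ((x.1 : ℝ) : EReal))
    (h' : ((x.1 : ℝ) : EReal) ≤ X.T (n + 1) x.2) : X.predPath e₀ x = X.pathUpTo e₀ n x.2 := by
  funext i
  have lt_iff : X.T i x.2 < ((x.1 : ℝ) : EReal) ↔ i ≤ n := by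
    refine ⟨fun hi => ?_, fun hi => (X.T_mono x.2 hi).trans_lt h⟩
    by_contra! hlt
    exact (hi.trans_le (h'.trans (X.T_mono x.2 hlt))).false
  simp only [predPath, pathUpTo, lt_iff]

lemma predKinds_eq {n : ℕ} {x : ℝ≥0 × Ω} (h : X.T n x.2 < ((x.1 : ℝ) : EReal)) :
    X.predKinds n x = X.kinds x.2 n := by
  induction n with
  | zero => rfl
  | succ n ih => simp [predKinds, kinds, h, ih ((X.T_le n x.2).trans_lt h)]

end QuakeProcess

section PointFiltration

variable {Ω M : Type*} [mΩ : MeasurableSpace Ω] [MeasurableSpace M]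
  {T : ℕ → Ω → EReal} {X : ℕ → Ω → M} {hT : ∀ n, Measurable (T n)} {hX : ∀ n, Measurable (X n)}

lemma measurableSet_pointFiltration {n : ℕ} (hn : 1 ≤ n) {s t : ℝ≥0} (hst : s ≤ t) {A : Set M}
    (hA : MeasurableSet A) :
    MeasurableSet[pointFiltration T X hT hX t] {ω | T n ω ≤ ((s : ℝ) : EReal) ∧ X n ω ∈ A} :=
  MeasurableSpace.measurableSet_generateFrom ⟨n, s, A, hn, hst, hA, rfl⟩

lemma measurable_predictable_fst (𝓕 : Filtration ℝ≥0 mΩ) :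
    Measurable[𝓕.predictable] (Prod.fst : ℝ≥0 × Ω → ℝ≥0) := by
  let _ := 𝓕.predictable
  refine measurable_of_Ioi fun c => ?_
  rw [← prod_univ]
  exact measurableSet_predictable_Ioi_prod MeasurableSet.univ

lemma measurableSet_predictable_point_lt {n : ℕ} (hn : 1 ≤ n) (h0 : ∀ ω, 0 ≤ T n ω) {A : Set M}
    (hA : MeasurableSet A) :
    MeasurableSet[(pointFiltration T X hT hX).predictable]
      {x : ℝ≥0 × Ω | T n x.2 < ((x.1 : ℝ) : EReal) ∧ X n x.2 ∈ A} := by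
  have eq_iUnion : {x : ℝ≥0 × Ω | T n x.2 < ((x.1 : ℝ) : EReal) ∧ X n x.2 ∈ A} = ⋃ q : ℚ,
      Ioi (Real.toNNReal q) ×ˢ {ω | T n ω ≤ ((Real.toNNReal q : ℝ) : EReal) ∧ X n ω ∈ A} := by
    ext ⟨s, ω⟩
    simp only [mem_ofPred_eq, mem_iUnion, mem_prod, mem_Ioi]
    refine ⟨fun ⟨hs, hω⟩ => ?_, fun ⟨q, hq, hT, hω⟩ => ⟨hT.trans_lt (by exact_mod_cast hq), hω⟩⟩
    obtain ⟨q, hTq, hqs⟩ := EReal.lt_iff_exists_rat_btwn.1 hs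
    have hq0 : (0 : ℝ) ≤ q := by exact_mod_cast (h0 ω).trans hTq.le
    refine ⟨q, ?_, ?_, hω⟩
    · rw [← NNReal.coe_lt_coe, Real.coe_toNNReal _ hq0]
      exact_mod_cast hqs
    · rw [Real.coe_toNNReal _ hq0]
      exact_mod_cast hTq.le
  rw [eq_iUnion]
  exact MeasurableSet.iUnion fun q =>
    measurableSet_predictable_Ioi_prod (measurableSet_pointFiltration hn le_rfl hA)

lemma measurableSet_predictable_point_lt_le {n : ℕ} (hn : 1 ≤ n) (h0 : ∀ ω, 0 ≤ T n ω)
    (c : ℝ≥0) :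
    MeasurableSet[(pointFiltration T X hT hX).predictable]
      {x : ℝ≥0 × Ω | T n x.2 < ((x.1 : ℝ) : EReal) ∧ T n x.2 ≤ ((c : ℝ) : EReal)} := by
  have eq_inter : {x : ℝ≥0 × Ω | T n x.2 < ((x.1 : ℝ) : EReal) ∧ T n x.2 ≤ ((c : ℝ) : EReal)}
      = {x : ℝ≥0 × Ω | T n x.2 < ((x.1 : ℝ) : EReal) ∧ X n x.2 ∈ univ} ∩
        (Prod.fst ⁻¹' Iic c ∪
          Ioi c ×ˢ {ω | T n ω ≤ ((c : ℝ) : EReal) ∧ X n ω ∈ univ}) := by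
    ext ⟨s, ω⟩
    simp only [mem_ofPred_eq, mem_inter_iff, mem_univ, and_true, mem_union, mem_preimage,
      mem_Iic, mem_prod, mem_Ioi]
    refine and_congr_right fun hs => ⟨fun hc => ?_, ?_⟩
    · exact (le_or_gt s c).imp_right fun h => ⟨h, hc⟩
    · rintro (h | h)
      · exact hs.le.trans (by exact_mod_cast h)
      · exact h.2
  rw [eq_inter]
  exact (measurableSet_predictable_point_lt hn h0 MeasurableSet.univ).inter
    ((measurable_predictable_fst _ measurableSet_Iic).union
      (measurableSet_predictable_Ioi_prod
        (measurableSet_pointFiltration hn le_rfl MeasurableSet.univ)))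

lemma measurable_ite_of_inter {α β : Type*} [MeasurableSpace α] [MeasurableSpace β]
    {D : Set α} [DecidablePred (· ∈ D)] {f : α → β} (b : β) (hD : MeasurableSet D)
    (hf : ∀ A, MeasurableSet A → MeasurableSet (D ∩ f ⁻¹' A)) :
    Measurable fun a => if a ∈ D then f a else b := by
  intro A hA
  have preimage_eq :
      (fun a => if a ∈ D then f a else b) ⁻¹' A = (D ∩ f ⁻¹' A) ∪ (Dᶜ ∩ {_a | b ∈ A}) := by
    ext a
    by_cases h : a ∈ D <;> simp [h]
  rw [preimage_eq]
  exact (hf A hA).union (hD.compl.inter (MeasurableSet.const _))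

lemma measurable_ite_point {α E : Type*} {_ : MeasurableSpace α} [MeasurableSpace E]
    {D : Set α} [DecidablePred (· ∈ D)] {m : α → E} {τ : α → EReal} (e₀ : E) (hD : MeasurableSet D)
    (hm : ∀ A, MeasurableSet A → MeasurableSet (D ∩ m ⁻¹' A))
    (hτ : ∀ c : ℝ≥0, MeasurableSet (D ∩ {a | τ a ≤ ((c : ℝ) : EReal)}))
    (h0 : ∀ a, 0 ≤ τ a) (htop : ∀ a ∈ D, τ a ≠ ⊤) :
    Measurable fun a => if a ∈ D then (m a, (τ a).toReal) else (e₀, 0) := by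
  have measurable_time : Measurable fun a => if a ∈ D then (τ a).toReal.toNNReal else 0 := by
    refine measurable_of_Iic fun c => ?_
    convert (hτ c).union hD.compl using 1
    ext a
    by_cases ha : a ∈ D
    · have le_iff : τ a ≤ ((c : ℝ) : EReal) ↔ (τ a).toReal ≤ c := by
        conv_lhs => rw [← EReal.coe_toReal (htop a ha) (EReal.bot_lt_zero.trans_le (h0 a)).ne']
        exact EReal.coe_le_coe_iff
      simp [ha, le_iff, Real.toNNReal_le_iff_le_coe]
    · simp [ha]
  convert (measurable_ite_of_inter e₀ hD hm).prodMk measurable_time.coe_nnreal_real using 1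
  funext a
  by_cases ha : a ∈ D
  · simp [ha, Real.coe_toNNReal _ (EReal.toReal_nonneg (h0 a))]
  · simp [ha]

end PointFiltration

namespace QuakeProcess

open ClusterHistory

variable {E Ω : Type*} [MeasurableSpace E] [mΩ : MeasurableSpace Ω] (X : QuakeProcess E Ω)

lemma measurableSet_predictable_quake_lt {n : ℕ} (hn : 1 ≤ n) {A : Set (E × QuakeKind)}
    (hA : MeasurableSet A) :
    MeasurableSet[X.fullFiltration.predictable]
      {x : ℝ≥0 × Ω | X.T n x.2 < ((x.1 : ℝ) : EReal) ∧ (X.mark n x.2, X.kind n x.2) ∈ A} :=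
  measurableSet_predictable_point_lt hn (X.T_nonneg n) hA

lemma measurableSet_predictable_T_lt (n : ℕ) :
    MeasurableSet[X.fullFiltration.predictable]
      {x : ℝ≥0 × Ω | X.T n x.2 < ((x.1 : ℝ) : EReal)} := by
  rcases Nat.eq_zero_or_pos n with rfl | hn
  · have eq_preimage : {x : ℝ≥0 × Ω | X.T 0 x.2 < ((x.1 : ℝ) : EReal)} = Prod.fst ⁻¹' Ioi 0 := by
      ext x
      simp [X.T_zero]
    rw [eq_preimage]
    exact measurable_predictable_fst _ measurableSet_Ioi
  · simpa only [mem_univ, and_true] using X.measurableSet_predictable_quake_lt hn MeasurableSet.univ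

lemma measurable_predPath (e₀ : E) : Measurable[X.fullFiltration.predictable] (X.predPath e₀) := by
  let _ := X.fullFiltration.predictable
  refine measurable_pi_iff.2 fun i => ?_
  by_cases hi : 1 ≤ i
  swap
  · simp only [predPath, hi, false_and, if_false]
    exact measurable_const
  convert measurable_ite_point (D := {x : ℝ≥0 × Ω | X.T i x.2 < ((x.1 : ℝ) : EReal)})
    (m := fun x => X.mark i x.2) (τ := fun x => X.T i x.2) e₀ (X.measurableSet_predictable_T_lt i)
    (fun A hA => ?_) (fun c => ?_) (fun x => X.T_nonneg i x.2)
    (fun x hx => (hx.trans_le le_top).ne) using 1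
  · funext x
    by_cases hx : X.T i x.2 < ((x.1 : ℝ) : EReal) <;> simp [predPath, path, hi, hx]
  · convert X.measurableSet_predictable_quake_lt hi (hA.prod MeasurableSet.univ) using 1
    ext x
    simp
  · exact measurableSet_predictable_point_lt_le hi (X.T_nonneg i) c

lemma measurable_predKinds (n : ℕ) :
    Measurable[X.fullFiltration.predictable] (X.predKinds n) := by
  let _ := X.fullFiltration.predictable
  induction n with
  | zero => exact measurable_const
  | succ n ih =>
    refine measurable_list_cons.comp (Measurable.prodMk ?_ ih)
    refine measurable_ite_of_inter (D := {x : ℝ≥0 × Ω | X.T (n + 1) x.2 < ((x.1 : ℝ) : EReal)})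
      (f := fun x => X.kind (n + 1) x.2) QuakeKind.single
      (X.measurableSet_predictable_T_lt (n + 1)) fun A hA => ?_
    convert X.measurableSet_predictable_quake_lt (Nat.le_add_left 1 n)
      (MeasurableSet.univ.prod hA) using 1
    ext x
    simp

end QuakeProcess

/-! ### The law of the next quake -/

namespace QuakeProcess

variable {E Ω : Type*} [MeasurableSpace E] [mΩ : MeasurableSpace Ω] (X : QuakeProcess E Ω)

lemma measurableSet_T_le (n : ℕ) (t : ℝ) : MeasurableSet {ω | X.T n ω ≤ t} :=
  measurableSet_le (X.measurable_T n) measurable_const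

lemma measurableSet_T_le_lt (n : ℕ) (t : ℝ) :
    MeasurableSet {ω | X.T n ω ≤ t ∧ (t : EReal) < X.T (n + 1) ω} :=
  (X.measurableSet_T_le n t).inter (measurableSet_lt measurable_const (X.measurable_T (n + 1)))

lemma measurableSet_T_ne_top (n : ℕ) : MeasurableSet {ω | X.T n ω ≠ ⊤} :=
  (X.measurable_T n (measurableSet_singleton ⊤)).compl

lemma setLIntegral_T_le (n : ℕ) (t : ℝ) (P : Measure Ω) (F : Ω → ℝ → ℝ≥0∞) :
    ∫⁻ ω in {ω | X.T n ω ≤ t}, F ω (X.T n ω).toReal ∂P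
      = ∫⁻ ω in {ω | X.T n ω ≠ ⊤}, (Iic t).indicator (F ω) (X.T n ω).toReal ∂P := by
  rw [← lintegral_indicator (X.measurableSet_T_le n t),
    ← lintegral_indicator (X.measurableSet_T_ne_top n)]
  refine lintegral_congr fun ω => ?_
  by_cases htop : X.T n ω = ⊤
  · simp [htop]
  · have le_iff : X.T n ω ≤ t ↔ (X.T n ω).toReal ≤ t := by
      rw [← EReal.coe_le_coe_iff, X.coe_toReal_T htop]
    simp only [indicator, mem_ofPred_eq, ne_eq, htop, not_false_eq_true, if_true, mem_Iic, le_iff]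

lemma measurable_comp_kinds_pathUpTo (e₀ : E) (n : ℕ)
    {β : Type*} [MeasurableSpace β] {ψ : List QuakeKind → (ℕ → E × ℝ) → β}
    (hψ : ∀ κ, Measurable (ψ κ)) :
    Measurable fun ω => ψ (X.kinds ω n) (X.pathUpTo e₀ n ω) :=
  measurable_comp_countable hψ (X.measurable_kinds n) (X.measurable_pathUpTo e₀ n)

/-- The predictable process that is equal to `g` on the time interval `]T n, T (n + 1)]`, during
which the first `n` quakes, and no others, have been seen, and to `0` elsewhere. -/
noncomputable def predIntegrand (e₀ : E) (n : ℕ)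
    (g : List QuakeKind → (ℕ → E × ℝ) → ℝ → E → QuakeKind → ℝ≥0∞) :
    (ℝ≥0 × Ω) × (E × QuakeKind) → ℝ≥0∞ :=
  {x | X.T n x.1.2 < ((x.1.1 : ℝ) : EReal) ∧ ((x.1.1 : ℝ) : EReal) ≤ X.T (n + 1) x.1.2}.indicator
    fun x => g (X.predKinds n x.1) (X.predPath e₀ x.1) x.1.1 x.2.1 x.2.2

variable {X} in
lemma predIntegrand_of_mem (e₀ : E) {n : ℕ}
    (g : List QuakeKind → (ℕ → E × ℝ) → ℝ → E → QuakeKind → ℝ≥0∞) {s : ℝ} (hs : 0 ≤ s) {ω : Ω}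
    (h : X.T n ω < s) (h' : s ≤ X.T (n + 1) ω) (u : E) (k : QuakeKind) :
    X.predIntegrand e₀ n g ((s.toNNReal, ω), (u, k))
      = g (X.kinds ω n) (X.pathUpTo e₀ n ω) s u k := by
  rw [predIntegrand, indicator_of_mem (by simpa [hs] using ⟨h, h'⟩), X.predKinds_eq (by simpa [hs]),
    X.predPath_eq (n := n) e₀ (by simpa [hs]) (by simpa [hs]), Real.coe_toNNReal _ hs]

variable {X} in
lemma predIntegrand_of_notMem (e₀ : E) {n : ℕ}
    (g : List QuakeKind → (ℕ → E × ℝ) → ℝ → E → QuakeKind → ℝ≥0∞) {s : ℝ} (hs : 0 ≤ s) {ω : Ω}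
    (h : ¬ (X.T n ω < s ∧ s ≤ X.T (n + 1) ω)) (u : E) (k : QuakeKind) :
    X.predIntegrand e₀ n g ((s.toNNReal, ω), (u, k)) = 0 :=
  indicator_of_notMem (by simpa [hs] using h) _

lemma measurable_predIntegrand (e₀ : E) (n : ℕ)
    {g : List QuakeKind → (ℕ → E × ℝ) → ℝ → E → QuakeKind → ℝ≥0∞}
    (hg : ∀ κ k, Measurable fun x : (ℕ → E × ℝ) × ℝ × E => g κ x.1 x.2.1 x.2.2 k) :
    Measurable[X.fullFiltration.predictable.prod inferInstance] (X.predIntegrand e₀ n g) := by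
  let _ := X.fullFiltration.predictable
  have measurable_time : Measurable fun x : ℝ≥0 × Ω => (x.1 : ℝ) :=
    (measurable_predictable_fst _).coe_nnreal_real
  have measurable_kinds : Measurable (X.predKinds n) := X.measurable_predKinds n
  have measurable_path : Measurable (X.predPath e₀) := X.measurable_predPath e₀
  refine Measurable.indicator ?_ (measurable_fst
    (t := {x : ℝ≥0 × Ω | X.T n x.2 < ((x.1 : ℝ) : EReal) ∧ ((x.1 : ℝ) : EReal) ≤ X.T (n + 1) x.2})
    ?_)
  · exact measurable_comp_countable
      (g := fun (z : List QuakeKind × QuakeKind) (x : (ℕ → E × ℝ) × ℝ × E) =>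
        g z.1 x.1 x.2.1 x.2.2 z.2) (fun z => hg z.1 z.2)
      (κ := fun x : (ℝ≥0 × Ω) × (E × QuakeKind) => (X.predKinds n x.1, x.2.2))
      (f := fun x : (ℝ≥0 × Ω) × (E × QuakeKind) => (X.predPath e₀ x.1, (x.1.1 : ℝ), x.2.1))
      ((measurable_kinds.comp measurable_fst).prodMk (measurable_snd.comp measurable_snd))
      ((measurable_path.comp measurable_fst).prodMk
        ((measurable_time.comp measurable_fst).prodMk (measurable_fst.comp measurable_snd)))
  · have h := (X.measurableSet_predictable_T_lt n).inter
      (X.measurableSet_predictable_T_lt (n + 1)).compl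
    simpa only [compl_ofPred, not_lt, ← ofPred_and] using h

lemma tsum_predIntegrand (e₀ : E) (n : ℕ)
    (g : List QuakeKind → (ℕ → E × ℝ) → ℝ → E → QuakeKind → ℝ≥0∞) (ω : Ω) :
    ∑' m, (if X.T (m + 1) ω = ⊤ then 0 else X.predIntegrand e₀ n g
        (((X.T (m + 1) ω).toReal.toNNReal, ω), (X.mark (m + 1) ω, X.kind (m + 1) ω)))
      = {ω | X.T (n + 1) ω ≠ ⊤}.indicator (fun ω => g (X.kinds ω n) (X.pathUpTo e₀ n ω)
          (X.T (n + 1) ω).toReal (X.mark (n + 1) ω) (X.kind (n + 1) ω)) ω := by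
  rw [tsum_eq_single n]
  · by_cases htop : X.T (n + 1) ω = ⊤
    · simp [htop]
    · have T_lt : X.T n ω < X.T (n + 1) ω := X.T_lt n ω (X.T_ne_top_of_le n.le_succ htop)
      rw [if_neg htop, indicator_of_mem (by exact htop)]
      refine predIntegrand_of_mem e₀ g (X.toReal_T_nonneg _ _) ?_ ?_ _ _
      · rwa [X.coe_toReal_T htop]
      · rw [X.coe_toReal_T htop]
  · intro m hmn
    split_ifs with htop
    · rfl
    refine predIntegrand_of_notMem e₀ g (X.toReal_T_nonneg _ _) ?_ _ _
    rw [X.coe_toReal_T htop]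
    rintro ⟨T_lt, T_le⟩
    rcases lt_or_gt_of_ne hmn with h | h
    · exact (T_lt.trans_le (X.T_mono ω h)).false
    · have T_succ_ne_top := X.T_ne_top_of_le (Nat.succ_le_succ h.le) htop
      exact (T_le.trans_lt (X.T_lt_of_lt (Nat.succ_lt_succ h) T_succ_ne_top)).false

end QuakeProcess

lemma Ioc_ereal_ae_eq (a b : EReal) :
    {s : ℝ | a < s ∧ s ≤ b} =ᵐ[volume] {s : ℝ | a ≤ s ∧ (s : EReal) < b} := by
  have ne_left : ∀ᵐ s : ℝ, s ≠ a.toReal := by simp [ae_iff]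
  have ne_right : ∀ᵐ s : ℝ, s ≠ b.toReal := by simp [ae_iff]
  filter_upwards [ne_left, ne_right] with s hsa hsb
  have hsa' : a ≠ s := fun h => hsa (by rw [h, EReal.toReal_coe])
  have hsb' : (s : EReal) ≠ b := fun h => hsb (by rw [← h, EReal.toReal_coe])
  refine propext ?_
  change a < s ∧ s ≤ b ↔ a ≤ s ∧ s < b
  rw [lt_iff_le_and_ne, lt_iff_le_and_ne]
  tauto

lemma measurableSet_ereal_Ico (a b : EReal) :
    MeasurableSet {s : ℝ | a ≤ s ∧ (s : EReal) < b} :=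
  (measurableSet_le measurable_const measurable_coe_real_ereal).inter
    (measurableSet_lt measurable_coe_real_ereal measurable_const)

namespace IsMotherQuakeModel

open ClusterHistory MotherQuakeRates

variable {E Ω : Type*} [MeasurableSpace E] [MeasurableSpace Ω] {ν : Measure E}
  {R : MotherQuakeRates E ν} {P : Measure Ω} {X : QuakeProcess E Ω}

lemma lintegral_next_quake (hX : IsMotherQuakeModel R P X) (e₀ : E) (n : ℕ)
    {g : List QuakeKind → (ℕ → E × ℝ) → ℝ → E → QuakeKind → ℝ≥0∞}
    (hg : ∀ κ k, Measurable fun x : (ℕ → E × ℝ) × ℝ × E => g κ x.1 x.2.1 x.2.2 k) :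
    ∫⁻ ω in {ω | X.T (n + 1) ω ≠ ⊤}, g (X.kinds ω n) (X.pathUpTo e₀ n ω)
        (X.T (n + 1) ω).toReal (X.mark (n + 1) ω) (X.kind (n + 1) ω) ∂P
      = ∫⁻ ω, ∫⁻ s in {s : ℝ | X.T n ω ≤ s ∧ (s : EReal) < X.T (n + 1) ω}, ∫⁻ u, ∑ k,
          g (X.kinds ω n) (X.pathUpTo e₀ n ω) s u k
            * R.rate (ofKinds (X.pathUpTo e₀ n ω) (X.kinds ω n)) u s k ∂ν ∂volume ∂P := by
  have intensity := hX _ (X.measurable_predIntegrand e₀ n hg)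
  simp only [X.tsum_predIntegrand] at intensity
  rw [← lintegral_indicator (X.measurableSet_T_ne_top (n + 1)), intensity]
  refine lintegral_congr fun ω => ?_
  have measurableSet_Ioc' : MeasurableSet {s : ℝ | X.T n ω < s ∧ s ≤ X.T (n + 1) ω} :=
    (measurableSet_lt measurable_const measurable_coe_real_ereal).inter
      (measurableSet_le measurable_coe_real_ereal measurable_const)
  rw [← setLIntegral_congr (Ioc_ereal_ae_eq _ _), ← lintegral_indicator measurableSet_Ioi,
    ← lintegral_indicator measurableSet_Ioc']
  refine lintegral_congr fun s => ?_
  by_cases hs : X.T n ω < s ∧ s ≤ X.T (n + 1) ω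
  · have hs0 : 0 < s := by exact_mod_cast (X.T_nonneg n ω).trans_lt hs.1
    rw [indicator_of_mem (by exact hs0), indicator_of_mem (by exact hs)]
    simp only [QuakeProcess.predIntegrand_of_mem e₀ g hs0.le hs.1 hs.2, X.histBefore_eq hs.1 hs.2,
      X.clusterHist_eq_pathUpTo e₀, QuakeKind.sum_eq]
  · rw [eq_comm, indicator_of_notMem (by exact hs), eq_comm]
    refine indicator_apply_eq_zero.2 fun hs0 => ?_
    simp only [QuakeProcess.predIntegrand_of_notMem e₀ g (le_of_lt hs0) hs, zero_mul, add_zero,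
      lintegral_zero]

end IsMotherQuakeModel

lemma Iic_inter_ereal_Ico_ae_eq {r t τ : ℝ} {b : EReal} (hτ : (τ : EReal) = min (t : EReal) b) :
    (Iic t ∩ {s : ℝ | (r : EReal) ≤ s ∧ (s : EReal) < b} : Set ℝ) =ᵐ[volume] Ioc r τ := by
  have ne_endpoint : ∀ᵐ s : ℝ, s ≠ τ := by simp [ae_iff]
  have ne_start : ∀ᵐ s : ℝ, s ≠ r := by simp [ae_iff]
  filter_upwards [ne_endpoint, ne_start] with s hsτ hsr
  refine propext ⟨fun h => ?_, fun h => ?_⟩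
  · have le_τ : (s : EReal) ≤ τ := hτ ▸ le_min (EReal.coe_le_coe_iff.2 h.1) h.2.2.le
    exact ⟨lt_of_le_of_ne (EReal.coe_le_coe_iff.1 h.2.1) hsr.symm, EReal.coe_le_coe_iff.1 le_τ⟩
  · have lt_min : (s : EReal) < min (t : EReal) b :=
      hτ ▸ EReal.coe_lt_coe_iff.2 (lt_of_le_of_ne h.2 hsτ)
    rw [lt_min_iff] at lt_min
    exact ⟨EReal.coe_le_coe_iff.1 lt_min.1.le, EReal.coe_le_coe_iff.2 h.1.le, lt_min.2⟩

namespace QuakeProcess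

variable {E Ω : Type*} [MeasurableSpace E] [MeasurableSpace Ω] {ν : Measure E}
  (R : MotherQuakeRates E ν) (X : QuakeProcess E Ω)

open ClusterHistory

-- The waiting time has hazard rate `totalRate`, so the reciprocal of its survival function grows
-- at rate `totalRate` until the next quake; stopping it at `t` gives a martingale identity.
lemma lintegral_inv_survival_add_indicator [SFinite ν] (e₀ : E) (n : ℕ) (t : ℝ) (ω : Ω) :
    (∫⁻ s in Iic t ∩ {s : ℝ | X.T n ω ≤ s ∧ (s : EReal) < X.T (n + 1) ω},
        (R.survival (X.pathUpTo e₀ n ω) (X.kinds ω n) s : ℝ≥0∞)⁻¹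
          * R.totalRate (X.pathUpTo e₀ n ω) (X.kinds ω n) s)
      + {ω | X.T n ω ≤ t}.indicator 1 ω
    = {ω | X.T (n + 1) ω ≤ t}.indicator (fun ω =>
        (R.survival (X.pathUpTo e₀ n ω) (X.kinds ω n) (X.T (n + 1) ω).toReal : ℝ≥0∞)⁻¹) ω
      + {ω | X.T n ω ≤ t ∧ (t : EReal) < X.T (n + 1) ω}.indicator (fun ω =>
        (R.survival (X.pathUpTo e₀ n ω) (X.kinds ω n) t : ℝ≥0∞)⁻¹) ω := by
  set y := X.pathUpTo e₀ n ω
  set κ := X.kinds ω n with hκ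
  by_cases ht : X.T n ω ≤ t
  swap
  · have not_le_succ : ¬ X.T (n + 1) ω ≤ t := fun h => ht ((X.T_le n ω).trans h)
    have eq_empty : Iic t ∩ {s : ℝ | X.T n ω ≤ s ∧ (s : EReal) < X.T (n + 1) ω} = ∅ :=
      eq_empty_of_forall_notMem fun s hs =>
        ht (hs.2.1.trans (EReal.coe_le_coe_iff.2 hs.1))
    simp [eq_empty, ht, not_le_succ]
  have hn : X.T n ω ≠ ⊤ := (ht.trans_lt (EReal.coe_lt_top t)).ne
  have coe_last : (((y κ.length).2 : ℝ) : EReal) = X.T n ω := by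
    rw [hκ, X.length_kinds, X.pathUpTo_time, X.coe_toReal_T hn]
  have increasing : IncreasingUpTo κ.length y := by
    simpa only [hκ, X.length_kinds] using X.increasingUpTo_pathUpTo e₀ hn
  have lintegral_upTo {τ : ℝ} (hτ : (τ : EReal) = min (t : EReal) (X.T (n + 1) ω)) :
      (∫⁻ s in Iic t ∩ {s : ℝ | X.T n ω ≤ s ∧ (s : EReal) < X.T (n + 1) ω},
        (R.survival y κ s : ℝ≥0∞)⁻¹ * R.totalRate y κ s) + 1 = (R.survival y κ τ : ℝ≥0∞)⁻¹ := by
    have last_le : (y κ.length).2 ≤ τ := by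
      rw [← EReal.coe_le_coe_iff, hτ, coe_last]
      exact le_min ht (X.T_le n ω)
    rw [← R.lintegral_inv_survival_mul_totalRate_add_one increasing last_le, ← coe_last,
      setLIntegral_congr (Iic_inter_ereal_Ico_ae_eq hτ)]
  rw [indicator_of_mem (show ω ∈ {ω | X.T n ω ≤ t} from ht), Pi.one_apply]
  rcases lt_or_ge (t : EReal) (X.T (n + 1) ω) with ht' | ht'
  · rw [indicator_of_notMem (by simpa using ht'), indicator_of_mem (by exact ⟨ht, ht'⟩), zero_add,
      lintegral_upTo (min_eq_left ht'.le).symm]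
  · have coe_next := X.coe_toReal_T (ht'.trans_lt (EReal.coe_lt_top t)).ne
    rw [indicator_of_mem (by exact ht'), indicator_of_notMem (fun h => h.2.not_ge ht'), add_zero,
      lintegral_upTo (coe_next.trans (min_eq_right ht').symm)]

lemma setLIntegral_survival_mul_inv_ne_top [SFinite ν] {P : Measure Ω} [IsFiniteMeasure P] (e₀ : E)
    (n : ℕ) (t : ℝ) {ψ : List QuakeKind → (ℕ → E × ℝ) → ℝ≥0∞} (hψ : ∀ κ y, ψ κ y ≤ 1) :
    ∫⁻ ω in {ω | X.T (n + 1) ω ≤ t}, ψ (X.kinds ω n) (X.pathUpTo e₀ n ω)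
        * R.survival (X.pathUpTo e₀ n ω) (X.kinds ω n) t
        * (R.survival (X.pathUpTo e₀ n ω) (X.kinds ω n) (X.T (n + 1) ω).toReal : ℝ≥0∞)⁻¹ ∂P
      ≠ ∞ := by
  refine ne_top_of_le_ne_top (measure_ne_top P {ω | X.T (n + 1) ω ≤ t})
    ((setLIntegral_mono' (X.measurableSet_T_le (n + 1) t) (g := 1) fun ω hω => ?_).trans (by simp))
  have next_ne_top : X.T (n + 1) ω ≠ ⊤ := (hω.trans_lt (EReal.coe_lt_top t)).ne
  have increasing : IncreasingUpTo (X.kinds ω n).length (X.pathUpTo e₀ n ω) := by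
    simpa only [X.length_kinds] using
      X.increasingUpTo_pathUpTo e₀ (X.T_ne_top_of_le n.le_succ next_ne_top)
  have next_le : (X.T (n + 1) ω).toReal ≤ t := by
    rw [← EReal.coe_le_coe_iff, X.coe_toReal_T next_ne_top]
    exact hω
  rw [mul_assoc, Pi.one_apply]
  refine mul_le_one' (hψ _ _) (ENNReal.div_le_of_le_mul ?_)
  rw [one_mul]
  exact_mod_cast R.survival_antitone increasing next_le

lemma lintegral_between_T [SFinite ν] (n : ℕ) (P : Measure Ω) [SFinite P]
    {F : (Ω × ℝ) × E → ℝ≥0∞} (hF : Measurable F) :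
    ∫⁻ ω, ∫⁻ s in {s : ℝ | X.T n ω ≤ s ∧ (s : EReal) < X.T (n + 1) ω},
        ∫⁻ u, F ((ω, s), u) ∂ν ∂volume ∂P
      = ∫⁻ s : ℝ, ∫⁻ u, ∫⁻ ω in {ω | X.T n ω ≤ s ∧ (s : EReal) < X.T (n + 1) ω},
          F ((ω, s), u) ∂P ∂ν ∂volume := by
  let between : Set (Ω × ℝ) := {x | X.T n x.1 ≤ x.2 ∧ (x.2 : EReal) < X.T (n + 1) x.1}
  have measurableSet_between : MeasurableSet between :=
    (measurableSet_le ((X.measurable_T n).comp measurable_fst) (by fun_prop)).inter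
      (measurableSet_lt (by fun_prop) ((X.measurable_T (n + 1)).comp measurable_fst))
  have measurable_inner : Measurable (between.indicator fun x => ∫⁻ u, F (x, u) ∂ν) :=
    (Measurable.lintegral_prod_right' hF).indicator measurableSet_between
  calc
    _ = ∫⁻ ω, ∫⁻ s : ℝ, between.indicator (fun x => ∫⁻ u, F (x, u) ∂ν) (ω, s) ∂volume ∂P :=
      lintegral_congr fun ω => (lintegral_indicator (measurableSet_ereal_Ico _ _) _).symm
    _ = ∫⁻ s : ℝ, ∫⁻ ω, between.indicator (fun x => ∫⁻ u, F (x, u) ∂ν) (ω, s) ∂P ∂volume :=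
      lintegral_lintegral_swap measurable_inner.aemeasurable
    _ = ∫⁻ s : ℝ, ∫⁻ ω in {ω | X.T n ω ≤ s ∧ (s : EReal) < X.T (n + 1) ω},
          ∫⁻ u, F ((ω, s), u) ∂ν ∂P ∂volume :=
      lintegral_congr fun s => lintegral_indicator (X.measurableSet_T_le_lt n s) _
    _ = _ := lintegral_congr fun s =>
      lintegral_lintegral_swap (hF.comp (f := fun x : Ω × E => ((x.1, s), x.2))
        (by fun_prop)).aemeasurable

lemma lintegral_T_le_eq_lintegral_Ioi (n : ℕ) (P : Measure Ω) (H : ℝ → E → Ω → ℝ≥0∞) :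
    ∫⁻ s : ℝ, ∫⁻ u, ∫⁻ ω in {ω | X.T n ω ≤ s}, H s u ω ∂P ∂ν ∂volume
      = ∫⁻ s in Ioi (0 : ℝ), ∫⁻ u, ∫⁻ ω in {ω | X.T n ω ≤ s}, H s u ω ∂P ∂ν ∂volume := by
  rw [← lintegral_indicator measurableSet_Ioi]
  refine lintegral_congr_ae ?_
  have ne_zero : ∀ᵐ s : ℝ, s ≠ 0 := by simp [ae_iff]
  filter_upwards [ne_zero] with s hs
  rcases lt_or_gt_of_ne hs with hs | hs
  · have eq_empty : {ω | X.T n ω ≤ s} = ∅ := eq_empty_of_forall_notMem fun ω hω =>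
      hs.not_ge (by exact_mod_cast (X.T_nonneg n ω).trans hω)
    simp [eq_empty, hs.not_gt]
  · rw [indicator_of_mem (by exact hs)]

end QuakeProcess

namespace IsMotherQuakeModel

open ClusterHistory MotherQuakeRates

variable {E Ω : Type*} [MeasurableSpace E] [MeasurableSpace Ω] {ν : Measure E} [SFinite ν]
  {R : MotherQuakeRates E ν} {P : Measure Ω} {X : QuakeProcess E Ω}

lemma lintegral_mul_inv_survival (hX : IsMotherQuakeModel R P X) (e₀ : E) (n : ℕ) (t : ℝ)
    {φ : List QuakeKind → (ℕ → E × ℝ) → ℝ≥0∞} (hφ : ∀ κ, Measurable (φ κ)) :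
    ∫⁻ ω in {ω | X.T (n + 1) ω ≤ t}, φ (X.kinds ω n) (X.pathUpTo e₀ n ω)
        * (R.survival (X.pathUpTo e₀ n ω) (X.kinds ω n) (X.T (n + 1) ω).toReal : ℝ≥0∞)⁻¹ ∂P
      = ∫⁻ ω, φ (X.kinds ω n) (X.pathUpTo e₀ n ω)
          * ∫⁻ s in Iic t ∩ {s : ℝ | X.T n ω ≤ s ∧ (s : EReal) < X.T (n + 1) ω},
            (R.survival (X.pathUpTo e₀ n ω) (X.kinds ω n) s : ℝ≥0∞)⁻¹
              * R.totalRate (X.pathUpTo e₀ n ω) (X.kinds ω n) s ∂volume ∂P := by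
  have next_quake := hX.lintegral_next_quake e₀ n
    (g := fun κ y s _ _ => (Iic t).indicator (fun s => φ κ y * (R.survival y κ s : ℝ≥0∞)⁻¹) s)
    fun κ _ => Measurable.indicator
      (((hφ κ).comp measurable_fst).mul ((R.measurable_survival κ).comp
        (f := fun x : (ℕ → E × ℝ) × ℝ × E => (x.1, x.2.1)) (by fun_prop)).coe_nnreal_ennreal.inv)
      (s := {x : (ℕ → E × ℝ) × ℝ × E | x.2.1 ≤ t})
      (measurableSet_le (by fun_prop) measurable_const)
  have measurable_rate_path (κ : List QuakeKind) (y : ℕ → E × ℝ) (s : ℝ) :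
      Measurable fun u => ∑ k, (R.rate (ofKinds y κ) u s k : ℝ≥0∞) :=
    Finset.measurable_sum _ fun k _ => ((R.measurable_rate κ k).comp (f := fun u => (y, u, s))
      (by fun_prop)).coe_nnreal_ennreal
  have measurable_survival_path (κ : List QuakeKind) (y : ℕ → E × ℝ) :
      Measurable fun s => (R.survival y κ s : ℝ≥0∞)⁻¹ * R.totalRate y κ s :=
    ((R.measurable_survival κ).comp measurable_prodMk_left).coe_nnreal_ennreal.inv.mul
      ((R.measurable_totalRate κ).comp measurable_prodMk_left)
  refine Eq.trans ?_ (next_quake.trans (lintegral_congr fun ω => ?_))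
  · exact X.setLIntegral_T_le (n + 1) t P fun ω s => φ (X.kinds ω n) (X.pathUpTo e₀ n ω)
      * (R.survival (X.pathUpTo e₀ n ω) (X.kinds ω n) s : ℝ≥0∞)⁻¹
  · simp only [← Finset.mul_sum, lintegral_const_mul _ (measurable_rate_path _ _ _)]
    rw [← lintegral_const_mul _ (measurable_survival_path _ _),
      ← setLIntegral_indicator measurableSet_Iic]
    refine lintegral_congr fun s => ?_
    by_cases hs : s ∈ Iic t <;> simp [hs, totalRate, mul_assoc]

lemma lintegral_survival_of_le_one [IsFiniteMeasure P] (hX : IsMotherQuakeModel R P X)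
    (e₀ : E) (n : ℕ) (t : ℝ) {ψ : List QuakeKind → (ℕ → E × ℝ) → ℝ≥0∞}
    (hψ : ∀ κ, Measurable (ψ κ)) (hψ1 : ∀ κ y, ψ κ y ≤ 1) :
    ∫⁻ ω in {ω | X.T n ω ≤ t ∧ (t : EReal) < X.T (n + 1) ω},
        ψ (X.kinds ω n) (X.pathUpTo e₀ n ω) ∂P
      = ∫⁻ ω in {ω | X.T n ω ≤ t}, ψ (X.kinds ω n) (X.pathUpTo e₀ n ω)
          * R.survival (X.pathUpTo e₀ n ω) (X.kinds ω n) t ∂P := by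
  let φ : List QuakeKind → (ℕ → E × ℝ) → ℝ≥0∞ := fun κ y => ψ κ y * R.survival y κ t
  have hφ κ : Measurable (φ κ) :=
    (hψ κ).mul ((R.measurable_survival κ).comp measurable_prodMk_right).coe_nnreal_ennreal
  have survival_ne_zero y κ s : (R.survival y κ s : ℝ≥0∞) ≠ 0 :=
    ENNReal.coe_ne_zero.2 (R.survival_pos y κ s).ne'
  have next_quake := hX.lintegral_mul_inv_survival e₀ n t hφ
  have finite := X.setLIntegral_survival_mul_inv_ne_top (R := R) (P := P) e₀ n t hψ1
  have path_identity := lintegral_congr (μ := P) fun ω => congrArg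
    (φ (X.kinds ω n) (X.pathUpTo e₀ n ω) * ·) (X.lintegral_inv_survival_add_indicator R e₀ n t ω)
  have measurable_start : Measurable fun ω => φ (X.kinds ω n) (X.pathUpTo e₀ n ω)
      * {ω | X.T n ω ≤ t}.indicator 1 ω :=
    (X.measurable_comp_kinds_pathUpTo e₀ n hφ).mul
      (measurable_one.indicator (X.measurableSet_T_le n t))
  have measurable_current : Measurable fun ω => φ (X.kinds ω n) (X.pathUpTo e₀ n ω)
      * {ω | X.T n ω ≤ t ∧ (t : EReal) < X.T (n + 1) ω}.indicator (fun ω =>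
        (R.survival (X.pathUpTo e₀ n ω) (X.kinds ω n) t : ℝ≥0∞)⁻¹) ω :=
    (X.measurable_comp_kinds_pathUpTo e₀ n hφ).mul
      ((X.measurable_comp_kinds_pathUpTo e₀ n (ψ := fun κ y => (R.survival y κ t : ℝ≥0∞)⁻¹)
        fun κ => ((R.measurable_survival κ).comp
          measurable_prodMk_right).coe_nnreal_ennreal.inv).indicator (X.measurableSet_T_le_lt n t))
  simp only [mul_add] at path_identity
  rw [lintegral_add_right _ measurable_start, lintegral_add_right _ measurable_current,
    ← next_quake, ← lintegral_indicator (X.measurableSet_T_le (n + 1) t)] at path_identity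
  rw [← lintegral_indicator (X.measurableSet_T_le (n + 1) t)] at finite
  have mul_indicator (s : Set Ω) (h : Ω → ℝ≥0∞) (ω : Ω) :
      φ (X.kinds ω n) (X.pathUpTo e₀ n ω) * s.indicator h ω
        = s.indicator (fun ω => φ (X.kinds ω n) (X.pathUpTo e₀ n ω) * h ω) ω :=
    (indicator_mul_right s (fun ω => φ (X.kinds ω n) (X.pathUpTo e₀ n ω)) h).symm
  simp only [mul_indicator, Pi.one_apply, mul_one] at path_identity
  have cancelled := (ENNReal.add_right_inj finite).1 path_identity
  rw [lintegral_indicator (X.measurableSet_T_le n t),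
    lintegral_indicator (X.measurableSet_T_le_lt n t)] at cancelled
  rw [cancelled]
  refine lintegral_congr fun ω => ?_
  rw [mul_assoc, ENNReal.mul_inv_cancel (survival_ne_zero _ _ _) ENNReal.coe_ne_top, mul_one]

lemma lintegral_survival [IsFiniteMeasure P] (hX : IsMotherQuakeModel R P X)
    (e₀ : E) (n : ℕ) (t : ℝ) {ψ : List QuakeKind → (ℕ → E × ℝ) → ℝ≥0∞}
    (hψ : ∀ κ, Measurable (ψ κ)) :
    ∫⁻ ω in {ω | X.T n ω ≤ t ∧ (t : EReal) < X.T (n + 1) ω},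
        ψ (X.kinds ω n) (X.pathUpTo e₀ n ω) ∂P
      = ∫⁻ ω in {ω | X.T n ω ≤ t}, ψ (X.kinds ω n) (X.pathUpTo e₀ n ω)
          * R.survival (X.pathUpTo e₀ n ω) (X.kinds ω n) t ∂P := by
  let Z : Ω → List QuakeKind × (ℕ → E × ℝ) := fun ω => (X.kinds ω n, X.pathUpTo e₀ n ω)
  have hZ : Measurable Z := (X.measurable_kinds n).prodMk (X.measurable_pathUpTo e₀ n)
  have measurable_S : Measurable fun z : List QuakeKind × (ℕ → E × ℝ) =>
      (R.survival z.2 z.1 t : ℝ≥0∞) :=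
    measurable_from_prod_countable_right fun κ =>
      ((R.measurable_survival κ).comp measurable_prodMk_right).coe_nnreal_ennreal
  have measurable_ψ : Measurable fun z : List QuakeKind × (ℕ → E × ℝ) => ψ z.1 z.2 :=
    measurable_from_prod_countable_right hψ
  have map_eq : (P.restrict {ω | X.T n ω ≤ t ∧ (t : EReal) < X.T (n + 1) ω}).map Z
      = ((P.restrict {ω | X.T n ω ≤ t}).map Z).withDensity fun z => R.survival z.2 z.1 t := by
    ext B hB
    have on_B := hX.lintegral_survival_of_le_one e₀ n t
      (ψ := fun κ y => B.indicator (fun _ => 1) (κ, y))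
      (fun κ => (measurable_const.indicator hB).comp measurable_prodMk_left)
      (fun κ y => indicator_le_self' (fun _ _ => zero_le) _)
    rw [withDensity_apply _ hB, ← lintegral_indicator hB,
      lintegral_map (measurable_S.indicator hB) hZ, ← lintegral_indicator_one hB,
      lintegral_map (measurable_one.indicator hB) hZ]
    refine Eq.trans on_B (lintegral_congr fun ω => ?_)
    by_cases hω : Z ω ∈ B <;> simp [Z, show (_, _) = Z ω from rfl, hω]
  rw [← lintegral_map measurable_ψ hZ, map_eq,
    lintegral_withDensity_eq_lintegral_mul _ measurable_S measurable_ψ,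
    lintegral_map (measurable_S.mul measurable_ψ) hZ]
  exact lintegral_congr fun ω => mul_comm _ _

lemma lintegral_next_quake_eq [IsFiniteMeasure P] (hX : IsMotherQuakeModel R P X)
    (e₀ : E) (n : ℕ) {g : List QuakeKind → (ℕ → E × ℝ) → ℝ → E → QuakeKind → ℝ≥0∞}
    (hg : ∀ κ k, Measurable fun x : (ℕ → E × ℝ) × ℝ × E => g κ x.1 x.2.1 x.2.2 k) :
    ∫⁻ ω in {ω | X.T (n + 1) ω ≠ ⊤}, g (X.kinds ω n) (X.pathUpTo e₀ n ω)
        (X.T (n + 1) ω).toReal (X.mark (n + 1) ω) (X.kind (n + 1) ω) ∂P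
      = ∫⁻ s in Ioi (0 : ℝ), ∫⁻ u, ∫⁻ ω in {ω | X.T n ω ≤ s},
          (∑ k, g (X.kinds ω n) (X.pathUpTo e₀ n ω) s u k
              * R.rate (ofKinds (X.pathUpTo e₀ n ω) (X.kinds ω n)) u s k)
            * R.survival (X.pathUpTo e₀ n ω) (X.kinds ω n) s ∂P ∂ν ∂volume := by
  let G : List QuakeKind → (ℕ → E × ℝ) × ℝ × E → ℝ≥0∞ := fun κ x =>
    ∑ k, g κ x.1 x.2.1 x.2.2 k * R.rate (ofKinds x.1 κ) x.2.2 x.2.1 k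
  have hG κ : Measurable (G κ) := Finset.measurable_sum _ fun k _ => (hg κ k).mul
    ((R.measurable_rate κ k).comp (f := fun x : (ℕ → E × ℝ) × ℝ × E => (x.1, x.2.2, x.2.1))
      (by fun_prop)).coe_nnreal_ennreal
  have measurable_integrand : Measurable fun x : (Ω × ℝ) × E =>
      G (X.kinds x.1.1 n) (X.pathUpTo e₀ n x.1.1, x.1.2, x.2) := by
    refine measurable_comp_countable hG ?_ (.prodMk ?_ ?_)
    · exact (X.measurable_kinds n).comp (measurable_fst.comp measurable_fst)
    · exact (X.measurable_pathUpTo e₀ n).comp (measurable_fst.comp measurable_fst)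
    · fun_prop
  rw [hX.lintegral_next_quake e₀ n hg, X.lintegral_between_T n P measurable_integrand,
    ← X.lintegral_T_le_eq_lintegral_Ioi]
  exact lintegral_congr fun s => lintegral_congr fun u => hX.lintegral_survival e₀ n s
    (ψ := fun κ y => G κ (y, s, u)) fun κ => (hG κ).comp (by fun_prop)

end IsMotherQuakeModel

/-! ### Bayes' formula -/

namespace MotherQuakeRates

open ClusterHistory

variable {E : Type*} [MeasurableSpace E] {ν : Measure E} (R : MotherQuakeRates E ν)

/-- The integral of `f` against the unnormalized conditional distribution of the kinds of the first
`n` quakes, given that these quakes are `y 1, …, y n`. -/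
noncomputable def bayes (n : ℕ) (y : ℕ → E × ℝ) (f : List QuakeKind → (ℕ → E × ℝ) → ℝ≥0∞) :
    ℝ≥0∞ :=
  ∑ κ ∈ kindStrings n, R.weight y κ * f κ y

lemma measurable_bayes [SFinite ν] (n : ℕ) {f : List QuakeKind → (ℕ → E × ℝ) → ℝ≥0∞}
    (hf : ∀ κ, Measurable (f κ)) : Measurable fun y => R.bayes n y f :=
  Finset.measurable_sum _ fun κ _ => (R.measurable_weight κ).coe_nnreal_ennreal.mul (hf κ)

/-- The adjoint of the addition of a quake `(u, s)`: `f` after that quake, weighted with the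
likelihood that the next quake occurs at time `s` with mark `u`. -/
noncomputable def likelihoodStep (s : ℝ) (u : E) (f : List QuakeKind → (ℕ → E × ℝ) → ℝ≥0∞)
    (κ : List QuakeKind) (y : ℕ → E × ℝ) : ℝ≥0∞ :=
  R.survival y κ s * ∑ k, R.rate (ofKinds y κ) u s k
    * f (k :: κ) (Function.update y (κ.length + 1) (u, s))

lemma measurable_likelihoodStep [SFinite ν] (s : ℝ) (u : E)
    {f : List QuakeKind → (ℕ → E × ℝ) → ℝ≥0∞} (hf : ∀ κ, Measurable (f κ)) (κ : List QuakeKind) :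
    Measurable (R.likelihoodStep s u f κ) := by
  refine ((R.measurable_survival κ).comp measurable_prodMk_right).coe_nnreal_ennreal.mul
    (Finset.measurable_sum _ fun k _ => Measurable.mul ?_ ((hf _).comp measurable_update_left))
  exact ((R.measurable_rate κ k).comp (f := fun y => (y, u, s))
    measurable_prodMk_right).coe_nnreal_ennreal

lemma bayes_succ_update (n : ℕ) (y : ℕ → E × ℝ) (s : ℝ) (u : E)
    (f : List QuakeKind → (ℕ → E × ℝ) → ℝ≥0∞) :
    R.bayes (n + 1) (Function.update y (n + 1) (u, s)) f
      = R.bayes n y (R.likelihoodStep s u f) := by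
  rw [bayes, bayes, sum_kindStrings_succ]
  refine Finset.sum_congr rfl fun κ hκ => ?_
  obtain rfl := mem_kindStrings.1 hκ
  simp only [likelihoodStep, Finset.mul_sum]
  refine Finset.sum_congr rfl fun k _ => ?_
  rw [R.weight_update]
  push_cast
  ring

end MotherQuakeRates

namespace IsMotherQuakeModel

open ClusterHistory MotherQuakeRates

variable {E Ω : Type*} [MeasurableSpace E] [MeasurableSpace Ω] {ν : Measure E} [SFinite ν]
  {R : MotherQuakeRates E ν} {P : Measure Ω} [IsFiniteMeasure P] {X : QuakeProcess E Ω}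

lemma lintegral_mul_bayes_succ (hX : IsMotherQuakeModel R P X) (e₀ : E) (n : ℕ) (t : ℝ)
    {f g : List QuakeKind → (ℕ → E × ℝ) → ℝ≥0∞} (hf : ∀ κ, Measurable (f κ))
    (hg : ∀ κ, Measurable (g κ)) :
    ∫⁻ ω in {ω | X.T (n + 1) ω ≤ t}, f (X.kinds ω (n + 1)) (X.pathUpTo e₀ (n + 1) ω)
        * R.bayes (n + 1) (X.pathUpTo e₀ (n + 1) ω) g ∂P
      = ∫⁻ s in Ioi (0 : ℝ), (Iic t).indicator (fun s => ∫⁻ u, ∫⁻ ω in {ω | X.T n ω ≤ s},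
          R.likelihoodStep s u f (X.kinds ω n) (X.pathUpTo e₀ n ω)
            * R.bayes n (X.pathUpTo e₀ n ω) (R.likelihoodStep s u g) ∂P ∂ν) s := by
  have measurable_update_quake : Measurable fun x : (ℕ → E × ℝ) × ℝ × E =>
      Function.update x.1 (n + 1) (x.2.2, x.2.1) := by
    refine measurable_pi_iff.2 fun i => ?_
    rcases eq_or_ne i (n + 1) with rfl | hi
    · simp only [Function.update_self]
      fun_prop
    · simp only [Function.update_of_ne hi]
      fun_prop
  let F : List QuakeKind → (ℕ → E × ℝ) → ℝ → E → QuakeKind → ℝ≥0∞ := fun κ y s u k =>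
    f (k :: κ) (Function.update y (n + 1) (u, s))
      * R.bayes (n + 1) (Function.update y (n + 1) (u, s)) g
  have measurable_F κ k : Measurable fun x : (ℕ → E × ℝ) × ℝ × E => F κ x.1 x.2.1 x.2.2 k :=
    ((hf _).comp measurable_update_quake).mul
      ((R.measurable_bayes (n + 1) hg).comp measurable_update_quake)
  have next_quake := hX.lintegral_next_quake_eq e₀ n
    (g := fun κ y s u k => (Iic t).indicator (fun s => F κ y s u k) s) fun κ k =>
    (measurable_F κ k).indicator (s := {x : (ℕ → E × ℝ) × ℝ × E | x.2.1 ≤ t})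
      (measurableSet_le (by fun_prop) measurable_const)
  simp only [X.pathUpTo_succ, QuakeProcess.kinds]
  refine (X.setLIntegral_T_le (n + 1) t P fun ω s => F (X.kinds ω n) (X.pathUpTo e₀ n ω) s
    (X.mark (n + 1) ω) (X.kind (n + 1) ω)).trans (next_quake.trans (lintegral_congr fun s => ?_))
  by_cases hs : s ∈ Iic t
  · simp only [indicator_of_mem hs]
    refine lintegral_congr fun u => lintegral_congr fun ω => ?_
    simp only [F, bayes_succ_update]
    rw [likelihoodStep, X.length_kinds, Finset.sum_mul, Finset.mul_sum, Finset.sum_mul]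
    exact Finset.sum_congr rfl fun k _ => by ring
  · simp only [indicator_of_notMem hs, zero_mul, Finset.sum_const_zero, lintegral_zero]

-- The symmetry in `f` and `g` says that `weight`, normalized, is the conditional distribution of
-- the kinds of the first `n` quakes given their times and marks.
lemma lintegral_mul_bayes (hX : IsMotherQuakeModel R P X) (e₀ : E) (n : ℕ) (t : ℝ)
    {f g : List QuakeKind → (ℕ → E × ℝ) → ℝ≥0∞} (hf : ∀ κ, Measurable (f κ))
    (hg : ∀ κ, Measurable (g κ)) :
    ∫⁻ ω in {ω | X.T n ω ≤ t}, f (X.kinds ω n) (X.pathUpTo e₀ n ω)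
        * R.bayes n (X.pathUpTo e₀ n ω) g ∂P
      = ∫⁻ ω in {ω | X.T n ω ≤ t}, g (X.kinds ω n) (X.pathUpTo e₀ n ω)
        * R.bayes n (X.pathUpTo e₀ n ω) f ∂P := by
  induction n generalizing f g t with
  | zero =>
    refine lintegral_congr fun ω => ?_
    simp only [bayes, sum_kindStrings_zero, weight, QuakeProcess.kinds]
    ring
  | succ n ih =>
    rw [hX.lintegral_mul_bayes_succ e₀ n t hf hg, hX.lintegral_mul_bayes_succ e₀ n t hg hf]
    simp only [ih _ (R.measurable_likelihoodStep _ _ hf) (R.measurable_likelihoodStep _ _ hg)]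

lemma lintegral_mul_bayes_survival (hX : IsMotherQuakeModel R P X) (e₀ : E) (n : ℕ) (t : ℝ)
    {f g : List QuakeKind → (ℕ → E × ℝ) → ℝ≥0∞} (hf : ∀ κ, Measurable (f κ))
    (hg : ∀ κ, Measurable (g κ)) :
    ∫⁻ ω in {ω | X.T n ω ≤ t ∧ (t : EReal) < X.T (n + 1) ω},
        f (X.kinds ω n) (X.pathUpTo e₀ n ω)
          * R.bayes n (X.pathUpTo e₀ n ω) (fun κ y => g κ y * R.survival y κ t) ∂P
      = ∫⁻ ω in {ω | X.T n ω ≤ t ∧ (t : EReal) < X.T (n + 1) ω},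
        g (X.kinds ω n) (X.pathUpTo e₀ n ω)
          * R.bayes n (X.pathUpTo e₀ n ω) (fun κ y => f κ y * R.survival y κ t) ∂P := by
  have mul_survival {f : List QuakeKind → (ℕ → E × ℝ) → ℝ≥0∞} (hf : ∀ κ, Measurable (f κ)) κ :
      Measurable fun y => f κ y * R.survival y κ t :=
    (hf κ).mul ((R.measurable_survival κ).comp measurable_prodMk_right).coe_nnreal_ennreal
  rw [hX.lintegral_survival e₀ n t (ψ := fun κ y => f κ y * R.bayes n y _)
      fun κ => (hf κ).mul (R.measurable_bayes n (mul_survival hg)),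
    hX.lintegral_survival e₀ n t (ψ := fun κ y => g κ y * R.bayes n y _)
      fun κ => (hg κ).mul (R.measurable_bayes n (mul_survival hf))]
  simp only [mul_right_comm _ (R.bayes n _ _)]
  exact hX.lintegral_mul_bayes e₀ n t (mul_survival hf) (mul_survival hg)

lemma ae_rate_ne_zero (hX : IsMotherQuakeModel R P X) :
    ∀ᵐ ω ∂P, ∀ n, X.T (n + 1) ω ≠ ⊤ → R.rate (ofKinds (X.path ω) (X.kinds ω n))
      (X.mark (n + 1) ω) (X.T (n + 1) ω).toReal (X.kind (n + 1) ω) ≠ 0 := by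
  rcases isEmpty_or_nonempty Ω with hΩ | ⟨⟨ω₀⟩⟩
  · exact ae_of_all _ fun ω => (hΩ.false ω).elim
  have e₀ := X.mark 0 ω₀
  rw [ae_all_iff]
  intro n
  let null (κ : List QuakeKind) (k : QuakeKind) : (ℕ → E × ℝ) × ℝ × E → ℝ≥0∞ :=
    {x | R.rate (ofKinds x.1 κ) x.2.2 x.2.1 k = 0}.indicator 1
  have measurable_null κ k : Measurable (null κ k) := measurable_one.indicator
    (((R.measurable_rate κ k).comp (f := fun x : (ℕ → E × ℝ) × ℝ × E => (x.1, x.2.2, x.2.1))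
      (by fun_prop)) (measurableSet_singleton 0))
  have null_mul_rate κ y s u k : null κ k (y, s, u) * R.rate (ofKinds y κ) u s k = 0 := by
    by_cases hr : R.rate (ofKinds y κ) u s k = 0
    · simp [hr]
    · simp only [null]
      rw [indicator_of_notMem (by exact hr), zero_mul]
  have law := hX.lintegral_next_quake_eq e₀ n (g := fun κ y s u k => null κ k (y, s, u))
    measurable_null
  simp only [null_mul_rate, Finset.sum_const_zero, zero_mul, lintegral_zero] at law
  have measurable_integrand : Measurable fun ω => null (X.kinds ω n) (X.kind (n + 1) ω)
      (X.pathUpTo e₀ n ω, (X.T (n + 1) ω).toReal, X.mark (n + 1) ω) :=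
    measurable_comp_countable (g := fun z : List QuakeKind × QuakeKind => null z.1 z.2)
      (fun z => measurable_null z.1 z.2)
      ((X.measurable_kinds n).prodMk (X.measurable_kind (n + 1)))
      ((X.measurable_pathUpTo e₀ n).prodMk ((X.measurable_T (n + 1)).ereal_toReal.prodMk
        (X.measurable_mark (n + 1))))
  rw [lintegral_eq_zero_iff measurable_integrand, EventuallyEq,
    ae_restrict_iff' (X.measurableSet_T_ne_top (n + 1))] at law
  filter_upwards [law] with ω hω htop hr
  have congr := ofKinds_congr (κ := X.kinds ω n) (y := X.pathUpTo e₀ n ω) (y' := X.path ω)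
    (by simpa only [X.length_kinds] using X.agreeUpTo_pathUpTo e₀ n ω)
  have null_eq_zero := hω htop
  simp only [null] at null_eq_zero
  rw [indicator_of_mem (by simpa only [mem_ofPred_eq, congr] using hr)] at null_eq_zero
  exact one_ne_zero null_eq_zero

lemma ae_weight_ne_zero (hX : IsMotherQuakeModel R P X) :
    ∀ᵐ ω ∂P, ∀ n, X.T n ω ≠ ⊤ → R.weight (X.path ω) (X.kinds ω n) ≠ 0 := by
  filter_upwards [hX.ae_rate_ne_zero] with ω hω n
  induction n with
  | zero => simp [QuakeProcess.kinds, weight]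
  | succ n ih =>
    intro htop
    simp only [QuakeProcess.kinds, weight, X.length_kinds]
    exact mul_ne_zero (ih (X.T_ne_top_of_le n.le_succ htop))
      (mul_ne_zero (R.survival_pos _ _ _).ne' (hω n htop))

end IsMotherQuakeModel

/-! ### Regular conditional distributions -/

section RegularConditional

variable {Ω Y : Type*} [MeasurableSpace Y] {m m0 : MeasurableSpace Ω}

lemma integral_ae_eq_condExp_of_setLIntegral {P : Measure Ω} [IsFiniteMeasure P] (hm : m ≤ m0)
    {κ : Ω → Measure Y} (hκ : Measurable[m] κ) {Z : Ω → Y} (hZ : Measurable[m0] Z)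
    (h : ∀ G, MeasurableSet[m] G → ∀ C, MeasurableSet C →
      ∫⁻ ω in G, κ ω C ∂P = P (G ∩ Z ⁻¹' C))
    {f : Y → ℝ} (hf : StronglyMeasurable f) (hint : Integrable (fun ω => f (Z ω)) P) :
    (fun ω => ∫ y, f y ∂(κ ω)) =ᵐ[P] P[fun ω => f (Z ω) | m] := by
  let K : ProbabilityTheory.Kernel Ω Y := ⟨κ, hκ.mono hm le_rfl⟩
  let Km : @ProbabilityTheory.Kernel Ω Y m _ := @ProbabilityTheory.Kernel.mk Ω Y m _ κ hκ
  have map_eq (G : Set Ω) (hG : MeasurableSet[m] G) : (P.restrict G).map Z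
      = (K.comp (ProbabilityTheory.Kernel.const Unit (P.restrict G))) () := by
    ext C hC
    rw [Measure.map_apply hZ hC, Measure.restrict_apply (hZ hC), inter_comm, ← h G hG C hC,
      ProbabilityTheory.Kernel.comp_apply, Measure.bind_apply hC K.measurable.aemeasurable]
    rfl
  have integrable_f (G : Set Ω) (hG : MeasurableSet[m] G) :
      Integrable f ((K.comp (ProbabilityTheory.Kernel.const Unit (P.restrict G))) ()) := by
    rw [← map_eq G hG, integrable_map_measure hf.aestronglyMeasurable hZ.aemeasurable]
    exact hint.mono_measure Measure.restrict_le_self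
  refine ae_eq_condExp_of_forall_setIntegral_eq hm hint
    (fun G hG _ => (integrable_f G hG).integral_comp) (fun G hG _ => ?_)
    (@StronglyMeasurable.integral_kernel Ω Y m _ Km ℝ _ _ f hf).aestronglyMeasurable
  calc ∫ ω in G, ∫ y, f y ∂(κ ω) ∂P
      = ∫ y, f y ∂((K.comp (ProbabilityTheory.Kernel.const Unit (P.restrict G))) ()) :=
        (ProbabilityTheory.Kernel.integral_comp (integrable_f G hG)).symm
    _ = ∫ ω in G, f (Z ω) ∂P := by
        rw [← map_eq G hG, integral_map hZ.aemeasurable hf.aestronglyMeasurable]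

lemma eq_of_forall_rat_gt_of_rightContinuous {α : Type*} [TopologicalSpace α] [T2Space α]
    {f g : ℝ → α} {t : ℝ} (hf : ContinuousWithinAt f (Ici t) t)
    (hg : ContinuousWithinAt g (Ici t) t) (h : ∀ q : ℚ, t < q → f q = g q) : f t = g t := by
  have eq_frequently : ∃ᶠ s in 𝓝[>] t, f s = g s := by
    refine frequently_iff.2 fun {U} hU => ?_
    obtain ⟨b, htb, hbU⟩ := mem_nhdsGT_iff_exists_Ioo_subset.1 hU
    obtain ⟨q, htq, hqb⟩ := exists_rat_btwn (show t < b from htb)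
    exact ⟨q, hbU ⟨htq, hqb⟩, h q htq⟩
  exact tendsto_nhds_unique_of_frequently_eq
    (hf.tendsto.mono_left (nhdsWithin_mono t Ioi_subset_Ici_self))
    (hg.tendsto.mono_left (nhdsWithin_mono t Ioi_subset_Ici_self)) eq_frequently

lemma ae_eq_of_forall_ae_eq_of_rightContinuous [MeasurableSpace.CountablyGenerated Y]
    {P : Measure Ω} {κ η : ℝ → Ω → Measure Y}
    (hκ : ∀ t, 0 ≤ t → ∀ ω, IsProbabilityMeasure (κ t ω))
    (hη : ∀ t, 0 ≤ t → ∀ ω, IsProbabilityMeasure (η t ω))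
    (hκc : ∀ᵐ ω ∂P, ∀ B, MeasurableSet B → ∀ t, 0 ≤ t →
      ContinuousWithinAt (fun s => κ s ω B) (Ici t) t)
    (hηc : ∀ᵐ ω ∂P, ∀ B, MeasurableSet B → ∀ t, 0 ≤ t →
      ContinuousWithinAt (fun s => η s ω B) (Ici t) t)
    (h : ∀ t, 0 ≤ t → ∀ B, MeasurableSet B → ∀ᵐ ω ∂P, κ t ω B = η t ω B) :
    ∀ᵐ ω ∂P, ∀ t, 0 ≤ t → κ t ω = η t ω := by
  let S := generateSetAlgebra (MeasurableSpace.countableGeneratingSet Y)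
  have countable_S : S.Countable :=
    countable_generateSetAlgebra MeasurableSpace.countable_countableGeneratingSet
  have generateFrom_S : MeasurableSpace.generateFrom S = ‹MeasurableSpace Y› := by
    rw [generateFrom_generateSetAlgebra_eq, MeasurableSpace.generateFrom_countableGeneratingSet]
  have measurableSet_S (B : Set Y) (hB : B ∈ S) : MeasurableSet B :=
    generateFrom_S.le B (MeasurableSpace.measurableSet_generateFrom hB)
  have eq_at_rat : ∀ᵐ ω ∂P, ∀ B ∈ S, ∀ q : ℚ, (0 : ℝ) ≤ q → κ q ω B = η q ω B := by
    refine (ae_ball_iff countable_S).2 fun B hB => ae_all_iff.2 fun q => ?_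
    by_cases hq : (0 : ℝ) ≤ q
    · filter_upwards [h q hq B (measurableSet_S B hB)] with ω hω _ using hω
    · exact ae_of_all _ fun ω hq' => (hq hq').elim
  filter_upwards [eq_at_rat, hκc, hηc] with ω eq_at_rat hκc hηc t ht
  have := hκ t ht ω
  have := hη t ht ω
  refine MeasureTheory.ext_of_generate_finite S generateFrom_S.symm
    (fun s hs t ht _ => isSetAlgebra_generateSetAlgebra.inter_mem hs ht) (fun B hB => ?_) (by simp)
  exact eq_of_forall_rat_gt_of_rightContinuous (f := fun s => κ s ω B) (g := fun s => η s ω B)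
    (hκc B (measurableSet_S B hB) t ht) (hηc B (measurableSet_S B hB) t ht)
    fun q hq => eq_at_rat B hB q (ht.trans hq.le)

end RegularConditional

/-! ### The filter as a finite mixture -/

namespace MotherQuakeRates

open ClusterHistory

variable {E : Type*} [MeasurableSpace E] {ν : Measure E} (R : MotherQuakeRates E ν)

/-- The normalizing constant of the filter: the likelihood of the quakes `y 1, …, y n` and of no
further quake until time `t`. -/
noncomputable def filterMass (y : ℕ → E × ℝ) (n : ℕ) (t : ℝ) : ℝ≥0 :=
  ∑ κ ∈ kindStrings n, R.weight y κ * R.survival y κ t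

open Classical in
/-- The conditional distribution of the cluster history at time `t` given that the quakes up to `t`
are `y 1, …, y n`; an arbitrary probability measure if these observations have likelihood `0`. -/
noncomputable def filterMeasure (y : ℕ → E × ℝ) (n : ℕ) (t : ℝ) : Measure (ClusterHistory E) :=
  if R.filterMass y n t = 0 then Measure.dirac [] else
    (R.filterMass y n t)⁻¹ •
      ∑ κ ∈ kindStrings n, (R.weight y κ * R.survival y κ t) • Measure.dirac (ofKinds y κ)

lemma filterMeasure_apply {y : ℕ → E × ℝ} {n : ℕ} {t : ℝ} (h : R.filterMass y n t ≠ 0)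
    {C : Set (ClusterHistory E)} (hC : MeasurableSet C) :
    R.filterMeasure y n t C = (((R.filterMass y n t)⁻¹ * ∑ κ ∈ kindStrings n,
      R.weight y κ * R.survival y κ t * C.indicator 1 (ofKinds y κ) : ℝ≥0) : ℝ≥0∞) := by
  rw [filterMeasure, if_neg h]
  simp only [Measure.smul_apply, Measure.coe_finsetSum, Finset.sum_apply, Measure.dirac_apply' _ hC,
    ENNReal.smul_def, smul_eq_mul]
  push_cast
  congr 1

lemma isProbabilityMeasure_filterMeasure (y : ℕ → E × ℝ) (n : ℕ) (t : ℝ) :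
    IsProbabilityMeasure (R.filterMeasure y n t) := by
  by_cases h : R.filterMass y n t = 0
  · rw [filterMeasure, if_pos h]
    infer_instance
  · refine ⟨?_⟩
    have sum_eq : ∑ κ ∈ kindStrings n, R.weight y κ * R.survival y κ t
        * (univ : Set (ClusterHistory E)).indicator 1 (ofKinds y κ) = R.filterMass y n t := by
      simp [filterMass]
    rw [R.filterMeasure_apply h MeasurableSet.univ, sum_eq, inv_mul_cancel₀ h, ENNReal.coe_one]

lemma integrable_filterMeasure [MeasurableSingletonClass E] (y : ℕ → E × ℝ) (n : ℕ) (t : ℝ)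
    (f : ClusterHistory E → ℝ) : Integrable f (R.filterMeasure y n t) := by
  unfold filterMeasure
  split_ifs
  · exact integrable_dirac (by simp)
  · exact .smul_measure_nnreal <| integrable_finsetSum_measure.2 fun κ _ =>
      (integrable_dirac (by simp)).smul_measure_nnreal

lemma integral_filterMeasure [MeasurableSingletonClass E] {y : ℕ → E × ℝ} {n : ℕ} {t : ℝ}
    (h : R.filterMass y n t ≠ 0) (f : ClusterHistory E → ℝ) :
    ∫ l, f l ∂(R.filterMeasure y n t) = (∑ κ ∈ kindStrings n,
      (R.weight y κ : ℝ) * R.survival y κ t * f (ofKinds y κ)) / R.filterMass y n t := by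
  rw [filterMeasure, if_neg h, integral_smul_nnreal_measure, integral_finsetSum_measure
    fun κ _ => (integrable_dirac (by simp)).smul_measure_nnreal]
  simp only [integral_smul_nnreal_measure, integral_dirac, NNReal.smul_def, smul_eq_mul]
  push_cast
  rw [div_eq_inv_mul]

lemma measurable_filterMass [SFinite ν] (n : ℕ) (t : ℝ) :
    Measurable fun y => R.filterMass y n t :=
  Finset.measurable_sum _ fun κ _ => (R.measurable_weight κ).mul
    ((R.measurable_survival κ).comp (f := fun y => (y, t)) measurable_prodMk_right)

lemma measurable_filterMeasure [SFinite ν] (n : ℕ) (t : ℝ) :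
    Measurable fun y => R.filterMeasure y n t := by
  classical
  refine Measure.measurable_of_measurable_coe _ fun C hC => ?_
  have apply_eq : (fun y => R.filterMeasure y n t C) = fun y => if R.filterMass y n t = 0
      then Measure.dirac [] C else (((R.filterMass y n t)⁻¹ * ∑ κ ∈ kindStrings n,
      R.weight y κ * R.survival y κ t * C.indicator 1 (ofKinds y κ) : ℝ≥0) : ℝ≥0∞) := by
    funext y
    split_ifs with h
    · rw [filterMeasure, if_pos h]
    · exact R.filterMeasure_apply h hC
  rw [apply_eq]
  refine Measurable.ite (R.measurable_filterMass n t (measurableSet_singleton 0))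
    measurable_const (Measurable.coe_nnreal_ennreal ?_)
  refine (R.measurable_filterMass n t).inv.mul (Finset.measurable_sum _ fun κ _ => ?_)
  exact ((R.measurable_weight κ).mul ((R.measurable_survival κ).comp (f := fun y => (y, t))
    measurable_prodMk_right)).mul ((measurable_one.indicator hC).comp (measurable_ofKinds κ))

lemma filterMass_congr {n : ℕ} {y y' : ℕ → E × ℝ} (h : AgreeUpTo n y y') (t : ℝ) :
    R.filterMass y n t = R.filterMass y' n t :=
  Finset.sum_congr rfl fun κ hκ => by
    obtain rfl := mem_kindStrings.1 hκ
    rw [R.weight_congr h, R.survival_congr h]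

lemma filterMeasure_congr {n : ℕ} {y y' : ℕ → E × ℝ} (h : AgreeUpTo n y y') (t : ℝ) :
    R.filterMeasure y n t = R.filterMeasure y' n t := by
  unfold filterMeasure
  rw [R.filterMass_congr h]
  congr 2
  refine Finset.sum_congr rfl fun κ hκ => ?_
  obtain rfl := mem_kindStrings.1 hκ
  rw [R.weight_congr h, R.survival_congr h, ofKinds_congr h]

lemma filterMass_ne_zero {y : ℕ → E × ℝ} {n : ℕ} {κ : List QuakeKind} (hκ : κ ∈ kindStrings n)
    (h : R.weight y κ ≠ 0) (t : ℝ) : R.filterMass y n t ≠ 0 := fun mass_eq_zero =>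
  mul_ne_zero h (R.survival_pos y κ t).ne' (Finset.sum_eq_zero_iff.1 mass_eq_zero κ hκ)

lemma intervalIntegrable_totalRate [SFinite ν] {y : ℕ → E × ℝ} {κ : List QuakeKind}
    (hy : IncreasingUpTo κ.length y) {t : ℝ} (ht : (y κ.length).2 ≤ t) :
    IntervalIntegrable (fun s => (R.totalRate y κ s).toReal) volume (y κ.length).2 t := by
  rw [intervalIntegrable_iff_integrableOn_Ioc_of_le ht]
  exact integrable_toReal_of_lintegral_ne_top
    ((R.measurable_totalRate κ).comp measurable_prodMk_left).aemeasurable (R.cumRate_ne_top hy t)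

lemma toReal_cumRate [SFinite ν] {y : ℕ → E × ℝ} {κ : List QuakeKind}
    (hy : IncreasingUpTo κ.length y) {t : ℝ} (ht : (y κ.length).2 ≤ t) :
    (R.cumRate y κ t).toReal = ∫ s in (y κ.length).2..t, (R.totalRate y κ s).toReal := by
  have hm : Measurable (R.totalRate y κ) := (R.measurable_totalRate κ).comp measurable_prodMk_left
  rw [intervalIntegral.integral_of_le ht,
    integral_toReal hm.aemeasurable (ae_lt_top hm (R.cumRate_ne_top hy t))]
  rfl

lemma continuousOn_survival [SFinite ν] {y : ℕ → E × ℝ} {κ : List QuakeKind}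
    (hy : IncreasingUpTo κ.length y) : ContinuousOn (R.survival y κ) (Ici (y κ.length).2) := by
  intro t ht
  rw [mem_Ici] at ht
  have Icc_mem : Icc (y κ.length).2 (t + 1) ∈ 𝓝[Ici (y κ.length).2] t := by
    rw [← Ici_inter_Iic]
    exact inter_mem_nhdsWithin _ (Iic_mem_nhds (lt_add_one t))
  refine ContinuousWithinAt.mono_of_mem_nhdsWithin ?_ Icc_mem
  have hle : (y κ.length).2 ≤ t + 1 := ht.trans (lt_add_one t).le
  have continuousOn_cumRate :
      ContinuousOn (fun s => (R.cumRate y κ s).toReal) (Icc (y κ.length).2 (t + 1)) := by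
    rw [← uIcc_of_le hle]
    refine (intervalIntegral.continuousOn_primitive_interval'
      (R.intervalIntegrable_totalRate hy hle) left_mem_uIcc).congr fun s hs => ?_
    rw [uIcc_of_le hle] at hs
    exact R.toReal_cumRate hy hs.1
  exact (continuous_real_toNNReal.comp Real.continuous_exp).continuousAt.comp_continuousWithinAt
    (continuousOn_cumRate t ⟨ht, (lt_add_one t).le⟩).neg

lemma continuousOn_filterMeasure [SFinite ν] {y : ℕ → E × ℝ} {n : ℕ} (hy : IncreasingUpTo n y)
    (hmass : ∀ t, R.filterMass y n t ≠ 0) {C : Set (ClusterHistory E)} (hC : MeasurableSet C) :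
    ContinuousOn (fun t => R.filterMeasure y n t C) (Ici (y n).2) := by
  have hs : ∀ κ ∈ kindStrings n, ContinuousOn (R.survival y κ) (Ici (y n).2) := fun κ hκ => by
    obtain rfl := mem_kindStrings.1 hκ
    exact R.continuousOn_survival hy
  simp only [fun t => R.filterMeasure_apply (hmass t) hC]
  refine ENNReal.continuous_coe.comp_continuousOn (.mul (.inv₀ ?_ fun t _ => hmass t) ?_)
  · exact continuousOn_finsetSum _ fun κ hκ => continuousOn_const.mul (hs κ hκ)
  · exact continuousOn_finsetSum _ fun κ hκ =>
      (continuousOn_const.mul (hs κ hκ)).mul continuousOn_const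

end MotherQuakeRates

namespace QuakeProcess

open ClusterHistory

variable {E Ω : Type*} [MeasurableSpace E] [mΩ : MeasurableSpace Ω] (X : QuakeProcess E Ω)

/-- Marks and times of the quakes up to time `t`, and `(e₀, 0)` from the next index on. -/
noncomputable def stoppedPath (e₀ : E) (t : ℝ) (ω : Ω) (i : ℕ) : E × ℝ :=
  if 1 ≤ i ∧ X.T i ω ≤ (t : EReal) then X.path ω i else (e₀, 0)

/-- The number of quakes up to time `t`. -/
noncomputable def count (t : ℝ) (ω : Ω) : ℕ :=
  Set.ncard {n : ℕ | 1 ≤ n ∧ X.T n ω ≤ (t : EReal)}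

lemma count_eq {n : ℕ} {ω : Ω} {t : ℝ} (h : X.T n ω ≤ t) (h' : t < X.T (n + 1) ω) :
    X.count t ω = n :=
  X.ncard_eq_of_T (p := fun a => a ≤ (t : EReal)) (fun _ _ hab hb => hab.trans hb) h
    (not_le.2 h')

lemma count_eq_iff {n : ℕ} {ω : Ω} {t : ℝ} (ht : 0 ≤ t) :
    X.count t ω = n ↔ X.T n ω ≤ t ∧ t < X.T (n + 1) ω := by
  refine ⟨fun h => ?_, fun h => X.count_eq h.1 h.2⟩
  obtain ⟨m, hm, hm'⟩ := X.exists_T_le_lt ω ht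
  rw [X.count_eq hm hm'] at h
  exact h ▸ ⟨hm, hm'⟩

lemma stoppedPath_eq (e₀ : E) {n : ℕ} {ω : Ω} {t : ℝ} (h : X.T n ω ≤ t)
    (h' : t < X.T (n + 1) ω) : X.stoppedPath e₀ t ω = X.pathUpTo e₀ n ω := by
  funext i
  have T_le_iff : X.T i ω ≤ (t : EReal) ↔ i ≤ n := by
    refine ⟨fun hi => ?_, fun hi => (X.T_mono ω hi).trans h⟩
    by_contra! hlt
    exact (h'.trans_le ((X.T_mono ω (Nat.succ_le_of_lt hlt)).trans hi)).false
  simp [stoppedPath, pathUpTo, T_le_iff]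

lemma measurableSet_T_le_obs (n : ℕ) (t : ℝ≥0) :
    MeasurableSet[X.obsFiltration t] {ω | X.T n ω ≤ ((t : ℝ) : EReal)} := by
  rcases Nat.eq_zero_or_pos n with rfl | hn
  · have eq_univ : {ω | X.T 0 ω ≤ ((t : ℝ) : EReal)} = univ := by
      ext ω
      simp only [X.T_zero, mem_ofPred_eq, mem_univ, iff_true]
      exact_mod_cast t.2
    rw [eq_univ]
    exact MeasurableSet.univ
  · convert measurableSet_pointFiltration (hT := X.measurable_T) (hX := X.measurable_mark) hn
      (le_refl t) MeasurableSet.univ using 1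
    · rfl
    · ext ω
      simp

lemma measurable_stoppedPath (e₀ : E) (t : ℝ≥0) :
    Measurable[X.obsFiltration t] (X.stoppedPath e₀ t) := by
  classical
  refine (@measurable_pi_iff _ _ _ (X.obsFiltration t) _ _).2 fun i => ?_
  by_cases hi : 1 ≤ i
  swap
  · simp only [stoppedPath, hi, false_and, if_false]
    exact @measurable_const _ _ _ (X.obsFiltration t) _
  convert measurable_ite_point (D := {ω | X.T i ω ≤ ((t : ℝ) : EReal)})
    (m := fun ω => X.mark i ω) (τ := fun ω => X.T i ω) e₀ (X.measurableSet_T_le_obs i t)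
    (fun A hA => ?_) (fun c => ?_) (fun ω => X.T_nonneg i ω)
    (fun ω hω => (hω.trans_lt (EReal.coe_lt_top _)).ne) using 1
  · funext ω
    by_cases hx : X.T i ω ≤ ((t : ℝ) : EReal) <;> simp [stoppedPath, path, hi, hx]
  · exact measurableSet_pointFiltration (hT := X.measurable_T) (hX := X.measurable_mark) hi
      (le_refl t) hA
  · convert measurableSet_pointFiltration (hT := X.measurable_T) (hX := X.measurable_mark) hi
      (min_le_left t c) MeasurableSet.univ using 1
    · rfl
    · ext ω
      rcases le_total t c with h | h
      · simpa [min_eq_left h] using fun hT => hT.trans (EReal.coe_le_coe h)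
      · simpa [min_eq_right h] using fun hT => hT.trans (EReal.coe_le_coe h)

lemma measurable_count (t : ℝ≥0) : Measurable[X.obsFiltration t] (X.count t) := by
  refine @measurable_to_countable' _ _ _ _ (X.obsFiltration t) _ fun n => ?_
  have preimage_eq : X.count t ⁻¹' {n} = {ω | X.T n ω ≤ ((t : ℝ) : EReal)}
      ∩ {ω | X.T (n + 1) ω ≤ ((t : ℝ) : EReal)}ᶜ := by
    ext ω
    simp [X.count_eq_iff t.coe_nonneg]
  rw [preimage_eq]
  exact (X.measurableSet_T_le_obs n t).inter (X.measurableSet_T_le_obs (n + 1) t).compl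

lemma exists_measurableSet_path (e₀ : E) (t : ℝ≥0) (n : ℕ) {G : Set Ω}
    (hG : MeasurableSet[X.obsFiltration t] G) :
    ∃ B : Set (ℕ → E × ℝ), MeasurableSet B ∧ ∀ ω, X.T n ω ≤ ((t : ℝ) : EReal) →
      ((t : ℝ) : EReal) < X.T (n + 1) ω → (ω ∈ G ↔ X.pathUpTo e₀ n ω ∈ B) := by
  induction G, hG using MeasurableSpace.generateFrom_induction with
  | hC G hG =>
    obtain ⟨m, s, A, hm, hs, hA, rfl⟩ := hG
    by_cases hmn : m ≤ n
    · refine ⟨{y | (y m).2 ≤ s ∧ (y m).1 ∈ A}, ?_, fun ω h _ => ?_⟩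
      · exact (measurableSet_le (f := fun y : ℕ → E × ℝ => (y m).2) (by fun_prop)
          measurable_const).inter (measurable_fst.comp (measurable_pi_apply m) hA)
      · have T_ne_top : X.T m ω ≠ ⊤ :=
          (((X.T_mono ω hmn).trans h).trans_lt (EReal.coe_lt_top _)).ne
        have T_le_iff : X.T m ω ≤ ((s : ℝ) : EReal) ↔ (X.T m ω).toReal ≤ s := by
          conv_lhs => rw [← X.coe_toReal_T T_ne_top]
          exact EReal.coe_le_coe_iff
        simp [pathUpTo, path, hm, hmn, T_le_iff]
    · refine ⟨∅, MeasurableSet.empty, fun ω _ h' => ?_⟩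
      simp only [mem_ofPred_eq, mem_empty_iff_false, iff_false, not_and]
      intro hTs
      have hTm : X.T (n + 1) ω ≤ X.T m ω := X.T_mono ω (by lia)
      exact absurd (hTm.trans (hTs.trans (by exact_mod_cast hs))) h'.not_ge
  | empty => exact ⟨∅, MeasurableSet.empty, fun ω _ _ => by simp⟩
  | compl G _ ih =>
    obtain ⟨B, hB, h⟩ := ih
    exact ⟨Bᶜ, hB.compl, fun ω hn hn' => by simp [h ω hn hn']⟩
  | iUnion G _ ih =>
    choose B hB h using ih
    exact ⟨⋃ i, B i, MeasurableSet.iUnion hB, fun ω hn hn' => by simp [h _ ω hn hn']⟩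

lemma lintegral_eq_tsum_T_le_lt (P : Measure Ω) {t : ℝ} (ht : 0 ≤ t) (f : Ω → ℝ≥0∞) :
    ∫⁻ ω, f ω ∂P
      = ∑' n, ∫⁻ ω in {ω | X.T n ω ≤ t ∧ (t : EReal) < X.T (n + 1) ω}, f ω ∂P := by
  have iUnion_eq : ⋃ n, {ω | X.T n ω ≤ t ∧ (t : EReal) < X.T (n + 1) ω} = univ :=
    eq_univ_of_forall fun ω => mem_iUnion.2 (X.exists_T_le_lt ω ht)
  rw [← setLIntegral_univ, ← iUnion_eq, lintegral_iUnion fun n => X.measurableSet_T_le_lt n t]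
  exact fun m n hmn => Set.disjoint_left.2 fun ω hm hn =>
    hmn (X.T_index_unique hm.1 hm.2 hn.1 hn.2)

variable {ν : Measure E} (R : MotherQuakeRates E ν)

/-- The filter, as an explicit function of the observations. -/
noncomputable def filter (e₀ : E) (t : ℝ) (ω : Ω) : Measure (ClusterHistory E) :=
  R.filterMeasure (X.stoppedPath e₀ t ω) (X.count t ω) t

lemma filter_eq_pathUpTo (e₀ : E) {n : ℕ} {ω : Ω} {t : ℝ} (h : X.T n ω ≤ t)
    (h' : t < X.T (n + 1) ω) :
    X.filter R e₀ t ω = R.filterMeasure (X.pathUpTo e₀ n ω) n t := by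
  rw [filter, X.count_eq h h', X.stoppedPath_eq e₀ h h']

lemma filter_eq (e₀ : E) {n : ℕ} {ω : Ω} {t : ℝ} (h : X.T n ω ≤ t) (h' : t < X.T (n + 1) ω) :
    X.filter R e₀ t ω = R.filterMeasure (X.path ω) n t := by
  rw [X.filter_eq_pathUpTo R e₀ h h']
  exact R.filterMeasure_congr (X.agreeUpTo_pathUpTo e₀ n ω) t

lemma measurable_filter [SFinite ν] (e₀ : E) (t : ℝ≥0) :
    Measurable[X.obsFiltration t] (X.filter R e₀ t) :=
  measurable_comp_countable (g := fun n y => R.filterMeasure y n t)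
    (fun n => R.measurable_filterMeasure n t) (X.measurable_count t) (X.measurable_stoppedPath e₀ t)

lemma measurable_hist (t : ℝ≥0) : Measurable (X.hist t) :=
  measurable_comp_countable (g := fun n ω => X.clusterHist ω n) X.measurable_clusterHist
    ((X.measurable_count t).mono (X.obsFiltration.le _) le_rfl) measurable_id

end QuakeProcess

namespace IsMotherQuakeModel

open ClusterHistory MotherQuakeRates

variable {E Ω : Type*} [MeasurableSpace E] [MeasurableSpace Ω] {ν : Measure E} [SFinite ν]
  {R : MotherQuakeRates E ν} {P : Measure Ω} [IsFiniteMeasure P] {X : QuakeProcess E Ω}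

lemma ae_filterMass_ne_zero (hX : IsMotherQuakeModel R P X) :
    ∀ᵐ ω ∂P, ∀ n, X.T n ω ≠ ⊤ → ∀ t, R.filterMass (X.path ω) n t ≠ 0 := by
  filter_upwards [hX.ae_weight_ne_zero] with ω hω n hn t
  exact R.filterMass_ne_zero (X.kinds_mem ω n) (hω n hn) t

lemma lintegral_mul_filterMeasure (hX : IsMotherQuakeModel R P X) (e₀ : E) (n : ℕ) (t : ℝ)
    {g : (ℕ → E × ℝ) → ℝ≥0∞} (hg : Measurable g) {C : Set (ClusterHistory E)}
    (hC : MeasurableSet C) :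
    ∫⁻ ω in {ω | X.T n ω ≤ t ∧ (t : EReal) < X.T (n + 1) ω},
        g (X.pathUpTo e₀ n ω) * R.filterMeasure (X.pathUpTo e₀ n ω) n t C ∂P
      = ∫⁻ ω in {ω | X.T n ω ≤ t ∧ (t : EReal) < X.T (n + 1) ω},
        g (X.pathUpTo e₀ n ω) * C.indicator 1 (X.hist t ω) ∂P := by
  let f (κ : List QuakeKind) (y : ℕ → E × ℝ) : ℝ≥0∞ :=
    g y * C.indicator 1 (ofKinds y κ) * (R.filterMass y n t : ℝ≥0∞)⁻¹
  have hf κ : Measurable (f κ) := (hg.mul ((measurable_one.indicator hC).comp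
    (measurable_ofKinds κ))).mul (R.measurable_filterMass n t).coe_nnreal_ennreal.inv
  have bayes_one y : R.bayes n y (fun κ y => 1 * R.survival y κ t) = R.filterMass y n t := by
    simp [bayes, filterMass]
  have bayes_f {y} (hy : R.filterMass y n t ≠ 0) :
      R.bayes n y (fun κ y => f κ y * R.survival y κ t) = g y * R.filterMeasure y n t C := by
    rw [R.filterMeasure_apply hy hC, bayes]
    push_cast
    rw [ENNReal.coe_inv hy, Finset.mul_sum, Finset.mul_sum]
    refine Finset.sum_congr rfl fun κ _ => ?_
    by_cases hκ : ofKinds y κ ∈ C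
    · simp only [f, indicator_of_mem hκ, Pi.one_apply, ENNReal.coe_one, mul_one]
      ring
    · simp [f, hκ]
  have mass_ne_zero : ∀ᵐ ω ∂P.restrict {ω | X.T n ω ≤ t ∧ (t : EReal) < X.T (n + 1) ω},
      R.filterMass (X.pathUpTo e₀ n ω) n t ≠ 0 := by
    rw [ae_restrict_iff' (X.measurableSet_T_le_lt n t)]
    filter_upwards [hX.ae_filterMass_ne_zero] with ω hω hS
    rw [R.filterMass_congr (X.agreeUpTo_pathUpTo e₀ n ω)]
    exact hω n (hS.1.trans_lt (EReal.coe_lt_top _)).ne t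
  calc _ = _ := lintegral_congr_ae (by
        filter_upwards [mass_ne_zero] with ω hω using by rw [← bayes_f hω, one_mul])
    _ = _ := (hX.lintegral_mul_bayes_survival e₀ n t hf fun _ => measurable_const).symm
    _ = _ := lintegral_congr_ae (by
        filter_upwards [mass_ne_zero, ae_restrict_mem (X.measurableSet_T_le_lt n t)] with ω hω hS
        rw [bayes_one, mul_assoc, ENNReal.inv_mul_cancel (by exact_mod_cast hω)
          ENNReal.coe_ne_top, mul_one, X.hist_eq hS.1 hS.2, X.clusterHist_eq_pathUpTo e₀])

lemma setLIntegral_filter (hX : IsMotherQuakeModel R P X) (e₀ : E) (t : ℝ≥0) {G : Set Ω}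
    (hG : MeasurableSet[X.obsFiltration t] G) {C : Set (ClusterHistory E)} (hC : MeasurableSet C) :
    ∫⁻ ω in G, X.filter R e₀ t ω C ∂P = P (G ∩ X.hist t ⁻¹' C) := by
  have hG' : MeasurableSet G := X.obsFiltration.le t G hG
  rw [← lintegral_indicator hG', ← lintegral_indicator_one (hG'.inter (X.measurable_hist t hC)),
    X.lintegral_eq_tsum_T_le_lt P t.coe_nonneg, X.lintegral_eq_tsum_T_le_lt P t.coe_nonneg]
  refine tsum_congr fun n => ?_
  obtain ⟨B, hB, mem_iff⟩ := X.exists_measurableSet_path e₀ t n hG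
  have indicator_eq {ω} (hS : X.T n ω ≤ (t : ℝ) ∧ ((t : ℝ) : EReal) < X.T (n + 1) ω) :
      B.indicator (1 : (ℕ → E × ℝ) → ℝ≥0∞) (X.pathUpTo e₀ n ω) = G.indicator 1 ω := by
    by_cases hω : ω ∈ G
    · simp [hω, (mem_iff ω hS.1 hS.2).1 hω]
    · simp [hω, mt (mem_iff ω hS.1 hS.2).2 hω]
  calc _ = ∫⁻ ω in {ω | X.T n ω ≤ (t : ℝ) ∧ ((t : ℝ) : EReal) < X.T (n + 1) ω},
          B.indicator 1 (X.pathUpTo e₀ n ω) * R.filterMeasure (X.pathUpTo e₀ n ω) n t C ∂P :=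
        setLIntegral_congr_fun (X.measurableSet_T_le_lt n t) fun ω hS => by
          rw [← X.filter_eq_pathUpTo R e₀ hS.1 hS.2, indicator_eq hS]
          by_cases hω : ω ∈ G <;> simp [hω]
    _ = ∫⁻ ω in {ω | X.T n ω ≤ (t : ℝ) ∧ ((t : ℝ) : EReal) < X.T (n + 1) ω},
          B.indicator 1 (X.pathUpTo e₀ n ω) * C.indicator 1 (X.hist t ω) ∂P :=
        hX.lintegral_mul_filterMeasure e₀ n t (measurable_one.indicator hB) hC
    _ = _ := setLIntegral_congr_fun (X.measurableSet_T_le_lt n t) fun ω hS => by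
          rw [indicator_eq hS, ← indicator_comp_right, Set.inter_indicator_one]
          rfl

theorem isMotherQuakeFilter_filter (hX : IsMotherQuakeModel R P X) (e₀ : E) :
    IsMotherQuakeFilter P X (X.filter R e₀) where
  isProbabilityMeasure _ _ _ := R.isProbabilityMeasure_filterMeasure _ _ _
  adapted t := X.measurable_filter R e₀ t
  condExp_eq t f hf hint :=
    integral_ae_eq_condExp_of_setLIntegral (X.obsFiltration.le t) (X.measurable_filter R e₀ t)
      (X.measurable_hist t) (fun _ hG _ hC => hX.setLIntegral_filter e₀ t hG hC)
      hf.stronglyMeasurable hint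
  right_continuous := by
    filter_upwards [hX.ae_filterMass_ne_zero] with ω mass_ne_zero B hB t ht
    obtain ⟨n, hn, hn'⟩ := X.exists_T_le_lt ω ht
    have T_ne_top : X.T n ω ≠ ⊤ := (hn.trans_lt (EReal.coe_lt_top t)).ne
    have time_le : (X.path ω n).2 ≤ t := by
      rw [← X.coe_toReal_T T_ne_top] at hn
      exact_mod_cast hn
    have continuousWithinAt_measure :=
      (R.continuousOn_filterMeasure (X.increasingUpTo_path T_ne_top) (mass_ne_zero n T_ne_top) hB
        t time_le).mono (Ici_subset_Ici.2 time_le)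
    have lt_next : ∀ᶠ s : ℝ in 𝓝[Ici t] t, (s : EReal) < X.T (n + 1) ω := nhdsWithin_le_nhds
      (continuous_coe_real_ereal.continuousAt.eventually_lt_const hn')
    refine continuousWithinAt_measure.congr_of_eventuallyEq ?_ (by rw [X.filter_eq R e₀ hn hn'])
    filter_upwards [lt_next, self_mem_nhdsWithin] with s hs hts
    rw [X.filter_eq R e₀ (hn.trans (by exact_mod_cast hts)) hs]

theorem ae_filter_eq [MeasurableSpace.CountablyGenerated E] (hX : IsMotherQuakeModel R P X)
    (e₀ : E) {π : ℝ → Ω → Measure (ClusterHistory E)} (hπ : IsMotherQuakeFilter P X π) :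
    ∀ᵐ ω ∂P, ∀ t, 0 ≤ t → π t ω = X.filter R e₀ t ω := by
  have hF := hX.isMotherQuakeFilter_filter e₀
  refine ae_eq_of_forall_ae_eq_of_rightContinuous hπ.isProbabilityMeasure hF.isProbabilityMeasure
    hπ.right_continuous hF.right_continuous fun t ht B hB => ?_
  have measurable_indicator : Measurable (B.indicator (1 : ClusterHistory E → ℝ)) :=
    measurable_one.indicator hB
  have integrable_indicator :
      Integrable (fun ω => B.indicator (1 : ClusterHistory E → ℝ) (X.hist t ω)) P :=
    (integrable_const (1 : ℝ)).mono'
      (measurable_indicator.comp (X.measurable_hist ⟨t, ht⟩)).aestronglyMeasurable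
      (ae_of_all _ fun ω => by by_cases h : X.hist t ω ∈ B <;> simp [h])
  filter_upwards [(hπ.condExp_eq ⟨t, ht⟩ _ measurable_indicator integrable_indicator).trans
    (hF.condExp_eq ⟨t, ht⟩ _ measurable_indicator integrable_indicator).symm] with ω hω
  have := hπ.isProbabilityMeasure t ht ω
  have := hF.isProbabilityMeasure t ht ω
  change ∫ l, _ ∂π t ω = ∫ l, _ ∂X.filter R e₀ t ω at hω
  rw [integral_indicator_one hB, integral_indicator_one hB] at hω
  exact (measureReal_eq_measureReal_iff).1 hω

end IsMotherQuakeModel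

section LinearOde

variable {ι : Type*} (I : Finset ι) {x : ι → ℝ → ℝ} {A C : ℝ} {c p : ι → ℝ}

lemma hasDerivWithinAt_const_add_sum_div {g : ι → ℝ} {t : ℝ} {S : Set ℝ}
    (hx : ∀ i ∈ I, HasDerivWithinAt (x i) (-g i * x i t) S t)
    (hB : C + ∑ i ∈ I, p i * (x i t - 1) ≠ 0) :
    HasDerivWithinAt
      (fun s => (A + ∑ i ∈ I, c i * (x i s - 1)) / (C + ∑ i ∈ I, p i * (x i s - 1)))
      (-∑ i ∈ I, c i * x i t / (C + ∑ i ∈ I, p i * (x i t - 1)) * g i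
        + (A + ∑ i ∈ I, c i * (x i t - 1)) / (C + ∑ i ∈ I, p i * (x i t - 1))
          * ∑ i ∈ I, p i * x i t / (C + ∑ i ∈ I, p i * (x i t - 1)) * g i) S t := by
  have hasDerivWithinAt_sum (c : ι → ℝ) : HasDerivWithinAt (fun s => ∑ i ∈ I, c i * (x i s - 1))
      (∑ i ∈ I, c i * (-g i * x i t)) S t :=
    HasDerivWithinAt.fun_sum fun i hi => ((hx i hi).sub_const 1).const_mul (c i)
  refine (((hasDerivWithinAt_sum c).const_add A).div
    ((hasDerivWithinAt_sum p).const_add C) hB).congr_deriv ?_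
  set B := C + ∑ i ∈ I, p i * (x i t - 1)
  have sum_div_mul (c : ι → ℝ) :
      ∑ i ∈ I, c i * x i t / B * g i = -(∑ i ∈ I, c i * (-g i * x i t)) / B := by
    rw [← Finset.sum_neg_distrib, Finset.sum_div]
    exact Finset.sum_congr rfl fun i _ => by ring
  rw [sum_div_mul, sum_div_mul]
  field_simp
  ring

variable {a b : ℝ}

lemma absolutelyContinuousOnInterval_const_add_sum
    (hx : ∀ i ∈ I, AbsolutelyContinuousOnInterval (x i) a b) :
    AbsolutelyContinuousOnInterval (fun s => A + ∑ i ∈ I, c i * (x i s - 1)) a b := by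
  classical
  have ac_const (C : ℝ) : AbsolutelyContinuousOnInterval (fun _ => C) a b :=
    (LipschitzWith.const C).lipschitzOnWith.absolutelyContinuousOnInterval
  induction I using Finset.induction_on with
  | empty => simpa using ac_const A
  | insert i I hi ih =>
    have ac_head := ((hx i (I.mem_insert_self i)).sub (ac_const 1)).const_mul (c i)
    have ac_tail := ih fun j hj => hx j (Finset.mem_insert_of_mem hj)
    simp only [Finset.sum_insert hi, add_left_comm A]
    exact ac_head.fun_add ac_tail

lemma absolutelyContinuousOnInterval_const_add_sum_div
    (hx : ∀ i ∈ I, AbsolutelyContinuousOnInterval (x i) a b)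
    (hB : ∀ t ∈ uIcc a b, C + ∑ i ∈ I, p i * (x i t - 1) ≠ 0) :
    AbsolutelyContinuousOnInterval
      (fun s => (A + ∑ i ∈ I, c i * (x i s - 1)) / (C + ∑ i ∈ I, p i * (x i s - 1))) a b := by
  simp only [div_eq_mul_inv]
  exact (absolutelyContinuousOnInterval_const_add_sum I hx).mul
    (absolutelyContinuousOnInterval_inv (absolutelyContinuousOnInterval_const_add_sum I hx) hB)

lemma eq_zero_of_eq_integral_mul {W g : ℝ → ℝ} (hab : a ≤ b) (hg : IntervalIntegrable g volume a b)
    (hWg : IntervalIntegrable (fun s => W s * g s) volume a b)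
    (hW : ∀ s ∈ Icc a b, W s = ∫ x in a..s, W x * g x) : W b = 0 := by
  have ac_W := hWg.absolutelyContinuousOnInterval_intervalIntegral (c := a) left_mem_uIcc
  have ac_exp := absolutelyContinuousOnInterval_exp
    ((hg.absolutelyContinuousOnInterval_intervalIntegral (c := a) left_mem_uIcc).const_mul (-1))
  -- `W s * exp (-∫_a^s g)` has derivative zero almost everywhere.
  obtain ⟨K, hK⟩ := (ac_W.mul ac_exp).const_of_ae_hasDerivAt_zero (by
    filter_upwards [hWg.ae_hasDerivAt_integral, hg.ae_hasDerivAt_integral] with x hx hx' hxm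
    refine ((hx hxm a left_mem_uIcc).mul
      ((hx' hxm a left_mem_uIcc).const_mul (-1)).exp).congr_deriv ?_
    rw [uIcc_of_le hab] at hxm
    rw [← hW x hxm]
    ring)
  have K_eq_zero := hK a left_mem_uIcc
  simp only [intervalIntegral.integral_same, zero_mul, Pi.mul_apply] at K_eq_zero
  have prod_eq_zero := hK b right_mem_uIcc
  rw [← K_eq_zero] at prod_eq_zero
  rw [hW b ⟨hab, le_rfl⟩]
  exact (mul_eq_zero.1 prod_eq_zero).resolve_right (Real.exp_ne_zero _)

end LinearOde

namespace ClusterHistory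

variable {E : Type*}

lemma theta_apply [DecidableEq (Option (E × ℝ))] (y : E × ℝ) (l : ClusterHistory E) :
    theta y l = if mother l = some y then 1 else 0 := by
  unfold theta
  by_cases h : mother l = some y <;> simp [h]

lemma theta_mul_alpha (y : E × ℝ) (l : ClusterHistory E) : theta y l * alpha l = theta y l := by
  classical
  rw [theta_apply]
  split_ifs with hy
  · have active_eq := isSome_mother l
    rw [hy] at active_eq
    simp [alpha, ← active_eq]
  · exact zero_mul _

lemma theta_mul_theta_self (y : E × ℝ) (l : ClusterHistory E) :
    theta y l * theta y l = theta y l := by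
  classical
  rw [theta_apply]
  split_ifs <;> simp

lemma theta_mul_theta_of_ne {y z : E × ℝ} (h : y ≠ z) (l : ClusterHistory E) :
    theta y l * theta z l = 0 := by
  classical
  simp only [theta_apply]
  split_ifs with hy hz
  · exact absurd (Option.some_injective _ (hy.symm.trans hz)) h
  all_goals simp

open Classical in
lemma theta_ofKinds {y : ℕ → E × ℝ} {κ : List QuakeKind} {n : ℕ} (hy : IncreasingUpTo n y)
    (hκ : κ.length ≤ n) {i : ℕ} (hi : i ≤ n) :
    theta (y i) (ofKinds y κ) = if motherIdx κ = some i then 1 else 0 := by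
  rw [theta_apply, mother_ofKinds]
  congr 1
  cases h : motherIdx κ with
  | none => simp
  | some j =>
    have hj : j ≤ n := (Finset.mem_Icc.1 (motherIdx_mem h)).2.trans hκ
    simp only [Option.map_some, Option.some.injEq, eq_iff_iff]
    exact ⟨fun heq => by_contra fun hne => hy.ne hj hi hne heq, congrArg y⟩

lemma sum_theta_ofKinds {y : ℕ → E × ℝ} {κ : List QuakeKind} (hy : IncreasingUpTo κ.length y)
    (c : ℕ → ℝ) :
    ∑ i ∈ Finset.Icc 1 κ.length, theta (y i) (ofKinds y κ) * c i
      = match motherIdx κ with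
        | some i => c i
        | none => 0 := by
  classical
  have summand_eq : ∀ i ∈ Finset.Icc 1 κ.length, theta (y i) (ofKinds y κ) * c i
      = if motherIdx κ = some i then c i else 0 := fun i hi => by
    rw [theta_ofKinds hy le_rfl (Finset.mem_Icc.1 hi).2, ite_mul, one_mul, zero_mul]
  rw [Finset.sum_congr rfl summand_eq]
  cases h : motherIdx κ with
  | none => simp
  | some j =>
    simp only [Option.some.injEq, Finset.sum_ite_eq]
    rw [if_pos (motherIdx_mem h)]

end ClusterHistory

/-! ### The evolution between two observations -/

namespace MotherQuakeRates

open ClusterHistory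

variable {E : Type*} [MeasurableSpace E] {ν : Measure E} (R : MotherQuakeRates E ν)

lemma a_eq_toReal (x : E × ℝ) (s : ℝ) : R.a x s = (∫⁻ u, (R.lam u s x : ℝ≥0∞) ∂ν).toReal := by
  rw [a, integral_eq_lintegral_of_nonneg_ae (ae_of_all _ fun u => NNReal.coe_nonneg _)]
  · simp only [ENNReal.ofReal_coe_nnreal]
  · exact (R.measurable_lam.comp (f := fun u : E => (u, s, x))
      (by fun_prop)).coe_nnreal_real.aestronglyMeasurable

lemma epsTotal_eq_toReal (s : ℝ) : R.epsTotal s = (∫⁻ u, (R.ε u s : ℝ≥0∞) ∂ν).toReal := by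
  rw [epsTotal, integral_eq_lintegral_of_nonneg_ae (ae_of_all _ fun u => NNReal.coe_nonneg _)]
  · simp only [ENNReal.ofReal_coe_nnreal]
  · exact (R.measurable_ε.comp (f := fun u : E => (u, s))
      (by fun_prop)).coe_nnreal_real.aestronglyMeasurable

section SFinite

variable [SFinite ν]

lemma measurable_a (x : E × ℝ) : Measurable (R.a x) := by
  rw [funext (R.a_eq_toReal x)]
  exact (R.measurable_lintegral_lam x).ennreal_toReal

lemma measurable_epsTotal : Measurable R.epsTotal := by
  rw [funext R.epsTotal_eq_toReal]
  exact R.measurable_lintegral_ε.ennreal_toReal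

variable {x : E × ℝ} {r t : ℝ}

lemma intervalIntegrable_a (hx : 0 ≤ x.2) (hr : x.2 ≤ r) (hrt : r ≤ t) :
    IntervalIntegrable (R.a x) volume r t := by
  rw [funext (R.a_eq_toReal x), intervalIntegrable_iff_integrableOn_Ioc_of_le hrt]
  exact integrable_toReal_of_lintegral_ne_top (R.measurable_lintegral_lam x).aemeasurable
    (R.lintegral_lam_ne_top hx hr t)

lemma intervalIntegrable_epsTotal (hr : 0 ≤ r) (hrt : r ≤ t) :
    IntervalIntegrable R.epsTotal volume r t := by
  rw [funext R.epsTotal_eq_toReal, intervalIntegrable_iff_integrableOn_Ioc_of_le hrt]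
  exact integrable_toReal_of_lintegral_ne_top R.measurable_lintegral_ε.aemeasurable
    (R.lintegral_ε_ne_top hr t)

lemma intervalIntegrable_a_sub_epsTotal (hx : 0 ≤ x.2) (hr : x.2 ≤ r) (hrt : r ≤ t) :
    IntervalIntegrable (fun s => R.a x s - R.epsTotal s) volume r t :=
  (R.intervalIntegrable_a hx hr hrt).sub (R.intervalIntegrable_epsTotal (hx.trans hr) hrt)

lemma toReal_lintegral_lam (hx : 0 ≤ x.2) (hr : x.2 ≤ r) (hrt : r ≤ t) :
    (∫⁻ s in Ioc r t, ∫⁻ u, (R.lam u s x : ℝ≥0∞) ∂ν).toReal = ∫ s in r..t, R.a x s := by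
  rw [intervalIntegral.integral_of_le hrt, ← integral_toReal
    (R.measurable_lintegral_lam x).aemeasurable
    (ae_lt_top (R.measurable_lintegral_lam x) (R.lintegral_lam_ne_top hx hr t))]
  simp only [a_eq_toReal]

lemma toReal_lintegral_ε (hr : 0 ≤ r) (hrt : r ≤ t) :
    (∫⁻ s in Ioc r t, ∫⁻ u, (R.ε u s : ℝ≥0∞) ∂ν).toReal = ∫ s in r..t, R.epsTotal s := by
  rw [intervalIntegral.integral_of_le hrt, ← integral_toReal
    R.measurable_lintegral_ε.aemeasurable
    (ae_lt_top R.measurable_lintegral_ε (R.lintegral_ε_ne_top hr t))]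
  simp only [epsTotal_eq_toReal]

end SFinite

lemma hasDerivWithinAt_decay {x : E × ℝ} {r t : ℝ} {S : Set ℝ}
    (h : HasDerivWithinAt (fun u => ∫ s in r..u, (R.a x s - R.epsTotal s))
      (R.a x t - R.epsTotal t) S t) :
    HasDerivWithinAt (R.decay x r) (-(R.a x t - R.epsTotal t) * R.decay x r t) S t := by
  refine h.neg.exp.congr_deriv ?_
  simp only [decay, Pi.neg_apply]
  ring

variable {y : ℕ → E × ℝ} {k : ℕ} {r : ℝ} {Φ : (ClusterHistory E → ℝ) → ℝ}

/-- The normalizing denominator of `flow`, the reciprocal of the factor `b_k(t)`. -/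
noncomputable def flowDenom (y : ℕ → E × ℝ) (k : ℕ) (r : ℝ) (Φ : (ClusterHistory E → ℝ) → ℝ)
    (t : ℝ) : ℝ :=
  1 + ∑ i ∈ Finset.Icc 1 k, Φ (fun l => theta (y i) l * alpha l) * (R.decay (y i) r t - 1)

/-- The solution of the differential equation for `π(f, t)` that starts at time `r` from the
functional `Φ`. -/
noncomputable def flow (y : ℕ → E × ℝ) (k : ℕ) (r : ℝ) (Φ : (ClusterHistory E → ℝ) → ℝ) (t : ℝ)
    (f : ClusterHistory E → ℝ) : ℝ :=
  (Φ f + ∑ i ∈ Finset.Icc 1 k,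
      Φ (fun l => theta (y i) l * alpha l * f l) * (R.decay (y i) r t - 1)) / R.flowDenom y k r Φ t

lemma decay_self (x : E × ℝ) (r : ℝ) : R.decay x r r = 1 := by
  simp [decay]

lemma flow_self (y : ℕ → E × ℝ) (k : ℕ) (r : ℝ) (Φ : (ClusterHistory E → ℝ) → ℝ) :
    R.flow y k r Φ r = Φ := by
  funext f
  simp [flow, flowDenom, decay_self]

lemma b_eq_inv_flowDenom (t : ℝ) : R.b y k Φ r t = (R.flowDenom y k r Φ t)⁻¹ := by
  rw [b, one_div, flowDenom]
  simp only [mul_sub, mul_one, Finset.sum_sub_distrib]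
  ring

lemma flow_theta_mul (hΦ : Φ (fun _ => 0) = 0) (hy : IncreasingUpTo k y) (t : ℝ)
    (f : ClusterHistory E → ℝ) {i : ℕ} (hi : i ∈ Finset.Icc 1 k) :
    R.flow y k r Φ t (fun l => theta (y i) l * alpha l * f l)
      = Φ (fun l => theta (y i) l * alpha l * f l) * R.decay (y i) r t
        / R.flowDenom y k r Φ t := by
  have theta_same : (fun l => theta (y i) l * alpha l * (theta (y i) l * alpha l * f l))
      = fun l => theta (y i) l * alpha l * f l := by
    funext l
    rw [theta_mul_alpha, ← mul_assoc, theta_mul_theta_self]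
  have theta_other (j) (hj : j ∈ Finset.Icc 1 k) (hji : j ≠ i) :
      (fun l => theta (y j) l * alpha l * (theta (y i) l * alpha l * f l)) = fun _ => 0 := by
    funext l
    rw [theta_mul_alpha, theta_mul_alpha, ← mul_assoc, theta_mul_theta_of_ne
      (hy.ne (Finset.mem_Icc.1 hj).2 (Finset.mem_Icc.1 hi).2 hji), zero_mul]
  rw [flow, Finset.sum_eq_single_of_mem i hi fun j hj hji => by
    rw [theta_other j hj hji, hΦ, zero_mul], theta_same]
  ring

lemma flow_theta (hΦ : Φ (fun _ => 0) = 0) (hy : IncreasingUpTo k y) (t : ℝ)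
    {i : ℕ} (hi : i ∈ Finset.Icc 1 k) :
    R.flow y k r Φ t (fun l => theta (y i) l * alpha l)
      = Φ (fun l => theta (y i) l * alpha l) * R.decay (y i) r t / R.flowDenom y k r Φ t := by
  simpa only [mul_one] using R.flow_theta_mul hΦ hy t (fun _ => 1) hi

lemma hasDerivWithinAt_flow (hΦ : Φ (fun _ => 0) = 0) (hy : IncreasingUpTo k y) {t : ℝ}
    {S : Set ℝ} (hpos : R.flowDenom y k r Φ t ≠ 0)
    (hS : ∀ i ∈ Finset.Icc 1 k,
      HasDerivWithinAt (fun u => ∫ s in r..u, (R.a (y i) s - R.epsTotal s))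
        (R.a (y i) t - R.epsTotal t) S t) (f : ClusterHistory E → ℝ) :
    HasDerivWithinAt (fun s => R.flow y k r Φ s f) (R.odeRhs y k (R.flow y k r Φ t) f t) S t := by
  refine (hasDerivWithinAt_const_add_sum_div (Finset.Icc 1 k) (A := Φ f) (C := 1)
    (fun i hi => R.hasDerivWithinAt_decay (hS i hi)) hpos).congr_deriv ?_
  rw [odeRhs]
  congr 2
  · exact Finset.sum_congr rfl fun i hi => by rw [R.flow_theta_mul hΦ hy t f hi, flowDenom]
  · exact Finset.sum_congr rfl fun i hi => by rw [R.flow_theta hΦ hy t hi, flowDenom]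

variable [SFinite ν]

lemma ae_forall_hasDerivAt_integral (hy : IncreasingUpTo k y) (hr : (y k).2 ≤ r) :
    ∀ᵐ t : ℝ, r < t → ∀ i ∈ Finset.Icc 1 k,
      HasDerivAt (fun u => ∫ s in r..u, (R.a (y i) s - R.epsTotal s))
        (R.a (y i) t - R.epsTotal t) t := by
  have ae_of_lt (q : ℚ) : ∀ᵐ t : ℝ, r < t → t < q → ∀ i ∈ Finset.Icc 1 k,
      HasDerivAt (fun u => ∫ s in r..u, (R.a (y i) s - R.epsTotal s))
        (R.a (y i) t - R.epsTotal t) t := by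
    rcases lt_or_ge r q with hq | hq
    · have ae_forall := (Finset.eventually_all (Finset.Icc 1 k)).2 fun i hi =>
        have hik := (Finset.mem_Icc.1 hi).2
        (R.intervalIntegrable_a_sub_epsTotal (hy.nonneg hik) ((hy.le hik le_rfl).trans hr)
          hq.le).ae_hasDerivAt_integral
      filter_upwards [ae_forall] with t ht hrt htq i hi
      exact ht i hi (by rw [uIcc_of_le hq.le]; exact ⟨hrt.le, htq.le⟩) r left_mem_uIcc
    · exact ae_of_all _ fun t hrt htq => absurd (hrt.trans htq) hq.not_gt
  filter_upwards [ae_all_iff.2 ae_of_lt] with t ht hrt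
  obtain ⟨q, hq⟩ := exists_rat_gt t
  exact ht q hrt hq

lemma hasDerivWithinAt_integral_of_continuousWithinAt {x : E × ℝ} (hx : 0 ≤ x.2)
    (hxr : x.2 ≤ r) {t : ℝ} (hrt : r ≤ t)
    (hc : ContinuousWithinAt (fun s => R.a x s - R.epsTotal s) (Ici r) t) :
    HasDerivWithinAt (fun u => ∫ s in r..u, (R.a x s - R.epsTotal s))
      (R.a x t - R.epsTotal t) (Ici r) t := by
  have hm : StronglyMeasurable fun s => R.a x s - R.epsTotal s :=
    ((R.measurable_a x).sub R.measurable_epsTotal).stronglyMeasurable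
  have hint := R.intervalIntegrable_a_sub_epsTotal hx hxr hrt
  rcases hrt.eq_or_lt with rfl | hlt
  · exact intervalIntegral.integral_hasDerivWithinAt_right hint
      hm.stronglyMeasurableAtFilter (hc.mono Ioi_subset_Ici_self)
  · exact (intervalIntegral.integral_hasDerivAt_right hint
      hm.stronglyMeasurableAtFilter (hc.continuousAt (Ici_mem_nhds hlt))).hasDerivWithinAt

lemma integral_odeRhs_flow (hΦ : Φ (fun _ => 0) = 0) (hy : IncreasingUpTo k y)
    (hr : (y k).2 ≤ r) (hpos : ∀ t, r ≤ t → R.flowDenom y k r Φ t ≠ 0) {t : ℝ} (hrt : r ≤ t)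
    (f : ClusterHistory E → ℝ) :
    IntervalIntegrable (fun s => R.odeRhs y k (R.flow y k r Φ s) f s) volume r t ∧
      ∫ s in r..t, R.odeRhs y k (R.flow y k r Φ s) f s = R.flow y k r Φ t f - Φ f := by
  have ac_decay (i) (hi : i ∈ Finset.Icc 1 k) :
      AbsolutelyContinuousOnInterval (R.decay (y i) r) r t :=
    have hik := (Finset.mem_Icc.1 hi).2
    absolutelyContinuousOnInterval_exp (((R.intervalIntegrable_a_sub_epsTotal (hy.nonneg hik)
      ((hy.le hik le_rfl).trans hr) hrt).absolutelyContinuousOnInterval_intervalIntegral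
        left_mem_uIcc).neg)
  have ac_flow : AbsolutelyContinuousOnInterval (fun s => R.flow y k r Φ s f) r t :=
    absolutelyContinuousOnInterval_const_add_sum_div _ ac_decay fun s hs =>
      hpos s (by rw [uIcc_of_le hrt] at hs; exact hs.1)
  rw [← congrFun (R.flow_self y k r Φ) f]
  refine integral_eq_sub_of_ae_hasDerivAt ac_flow ?_
  filter_upwards [R.ae_forall_hasDerivAt_integral hy hr] with s hs hst
  rw [uIoc_of_le hrt] at hst
  rw [← hasDerivWithinAt_univ]
  exact R.hasDerivWithinAt_flow hΦ hy (hpos s hst.1.le)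
    (fun i hi => (hs hst.1 i hi).hasDerivWithinAt) f

theorem evolutionEquations_flow (hΦ : Φ (fun _ => 0) = 0) (hy : IncreasingUpTo k y)
    (hr : (y k).2 ≤ r) (hpos : ∀ t, r ≤ t → R.flowDenom y k r Φ t ≠ 0) (r' : EReal)
    (f : ClusterHistory E → ℝ) : R.EvolutionEquations y k r r' (R.flow y k r Φ) f where
  cluster_eq t _ _ i hi := by
    rw [flow_self, R.flow_theta_mul hΦ hy t f hi, b_eq_inv_flowDenom, div_eq_mul_inv]
  ode_integrable t hrt _ := (R.integral_odeRhs_flow hΦ hy hr hpos hrt f).1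
  ode_integral t hrt _ := by
    rw [flow_self, (R.integral_odeRhs_flow hΦ hy hr hpos hrt f).2, add_sub_cancel]
  ode_ae := by
    filter_upwards [R.ae_forall_hasDerivAt_integral hy hr] with t ht hrt _
    rw [← hasDerivWithinAt_univ]
    exact R.hasDerivWithinAt_flow hΦ hy (hpos t hrt.le)
      (fun i hi => (ht hrt i hi).hasDerivWithinAt) f
  ode_of_continuous t hrt _ hca hcε :=
    R.hasDerivWithinAt_flow hΦ hy (hpos t hrt) (fun i hi =>
      have hik := (Finset.mem_Icc.1 hi).2
      R.hasDerivWithinAt_integral_of_continuousWithinAt (hy.nonneg hik)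
        ((hy.le hik le_rfl).trans hr) hrt ((hca i hi).sub hcε)) f

end MotherQuakeRates

namespace MotherQuakeRates

open ClusterHistory

variable {E : Type*} [MeasurableSpace E] {ν : Measure E} {R : MotherQuakeRates E ν}

lemma EvolutionEquations.congr {y : ℕ → E × ℝ} {k : ℕ} {r : ℝ} {r' : EReal}
    {V W : ℝ → (ClusterHistory E → ℝ) → ℝ} {f : ClusterHistory E → ℝ}
    (h : R.EvolutionEquations y k r r' W f) (hr : (r : EReal) < r')
    (hVW : ∀ t : ℝ, r ≤ t → (t : EReal) < r' → ∀ f, V t f = W t f) :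
    R.EvolutionEquations y k r r' V f := by
  have V_eq (t : ℝ) (hrt : r ≤ t) (htr' : (t : EReal) < r') : V t = W t :=
    funext (hVW t hrt htr')
  have V_eq_r : V r = W r := V_eq r le_rfl hr
  have V_eq_of_mem_uIcc {t s : ℝ} (hrt : r ≤ t) (htr' : (t : EReal) < r') (hs : s ∈ uIcc r t) :
      V s = W s := by
    rw [uIcc_of_le hrt] at hs
    exact V_eq s hs.1 ((EReal.coe_le_coe_iff.2 hs.2).trans_lt htr')
  have eventually_lt (t : ℝ) (htr' : (t : EReal) < r') : ∀ᶠ s : ℝ in 𝓝 t, (s : EReal) < r' :=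
    continuous_coe_real_ereal.continuousAt.eventually_lt_const htr'
  refine ⟨fun t hrt htr' i hi => ?_, fun t hrt htr' => ?_, fun t hrt htr' => ?_, ?_,
    fun t hrt htr' hca hcε => ?_⟩
  · rw [V_eq t hrt htr', V_eq_r]
    exact h.cluster_eq t hrt htr' i hi
  · exact (h.ode_integrable t hrt htr').congr fun s hs => by
      rw [V_eq_of_mem_uIcc hrt htr' (uIoc_subset_uIcc hs)]
  · rw [V_eq t hrt htr', V_eq_r, h.ode_integral t hrt htr']
    exact congrArg _ (intervalIntegral.integral_congr fun s hs => by
      simp only [V_eq_of_mem_uIcc hrt htr' hs])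
  · filter_upwards [h.ode_ae] with t ht hrt htr'
    rw [V_eq t hrt.le htr']
    refine (ht hrt htr').congr_of_eventuallyEq ?_
    filter_upwards [lt_mem_nhds hrt, eventually_lt t htr'] with s hrs hsr'
    exact hVW s hrs.le hsr' f
  · rw [V_eq t hrt htr']
    refine (h.ode_of_continuous t hrt htr' hca hcε).congr_of_eventuallyEq ?_ (hVW t hrt htr' f)
    filter_upwards [self_mem_nhdsWithin, mem_nhdsWithin_of_mem_nhds (eventually_lt t htr')]
      with s hrs hsr'
    exact hVW s hrs hsr' f

lemma EvolutionEquations.continuousOn {y : ℕ → E × ℝ} {k : ℕ} {r : ℝ} {r' : EReal}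
    {V : ℝ → (ClusterHistory E → ℝ) → ℝ} {f : ClusterHistory E → ℝ}
    (h : R.EvolutionEquations y k r r' V f) {t : ℝ} (ht : r ≤ t) (ht' : (t : EReal) < r') :
    ContinuousOn (fun s => V s f) (Icc r t) := by
  have continuousOn_integral := intervalIntegral.continuousOn_primitive_interval'
    (h.ode_integrable t ht ht') left_mem_uIcc
  rw [uIcc_of_le ht] at continuousOn_integral
  exact ((continuousOn_const (c := V r f)).add continuousOn_integral).congr fun s hs =>
    h.ode_integral s hs.1 ((EReal.coe_le_coe_iff.2 hs.2).trans_lt ht')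

variable (R)

/-- The probability that in `(r, t]` there is no single quake and no cluster is initiated, given
that no cluster is active at time `r`. -/
noncomputable def idleSurvival (r t : ℝ) : ℝ :=
  Real.exp (-(∫⁻ s in Ioc r t, ∫⁻ u, (R.γ u s : ℝ≥0∞) ∂ν).toReal - ∫ s in r..t, R.epsTotal s)

lemma survival_self (y : ℕ → E × ℝ) (κ : List QuakeKind) :
    R.survival y κ (y κ.length).2 = 1 := by
  simp [survival, cumRate]

lemma survival_eq [SFinite ν] {y : ℕ → E × ℝ} {κ : List QuakeKind}
    (hy : IncreasingUpTo κ.length y) {t : ℝ} (ht : (y κ.length).2 ≤ t) :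
    (R.survival y κ t : ℝ)
      = R.idleSurvival (y κ.length).2 t
        * match motherIdx κ with
          | some i => R.decay (y i) (y κ.length).2 t
          | none => 1 := by
  have hr : 0 ≤ (y κ.length).2 := hy.nonneg le_rfl
  have cumRate_ne_top := R.cumRate_ne_top hy t
  rw [cumRate_eq, ENNReal.add_ne_top] at cumRate_ne_top
  rw [coe_survival, cumRate_eq, ENNReal.toReal_add cumRate_ne_top.1 cumRate_ne_top.2, idleSurvival]
  simp only [clusterRate_ofKinds]
  cases h : motherIdx κ with
  | none =>
    simp only [mul_one]
    rw [R.toReal_lintegral_ε hr ht]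
    congr 1
    ring
  | some i =>
    have hi : i ≤ κ.length := (Finset.mem_Icc.1 (motherIdx_mem h)).2
    have hi_nonneg : 0 ≤ (y i).2 := hy.nonneg hi
    have hi_le : (y i).2 ≤ (y κ.length).2 := hy.le hi le_rfl
    simp only
    rw [R.toReal_lintegral_lam hi_nonneg hi_le ht, decay, ← Real.exp_add,
      intervalIntegral.integral_sub (R.intervalIntegrable_a hi_nonneg hi_le ht)
        (R.intervalIntegrable_epsTotal hr ht)]
    congr 1
    ring

lemma survival_eq_sum [SFinite ν] {y : ℕ → E × ℝ} {κ : List QuakeKind}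
    (hy : IncreasingUpTo κ.length y) {t : ℝ} (ht : (y κ.length).2 ≤ t) :
    (R.survival y κ t : ℝ)
      = R.idleSurvival (y κ.length).2 t * (1 + ∑ i ∈ Finset.Icc 1 κ.length,
          theta (y i) (ofKinds y κ) * (R.decay (y i) (y κ.length).2 t - 1)) := by
  rw [R.survival_eq hy ht, sum_theta_ofKinds hy fun i => R.decay (y i) (y κ.length).2 t - 1]
  cases motherIdx κ <;> simp

variable [MeasurableSingletonClass E]

lemma integral_filterMeasure_congr {y : ℕ → E × ℝ} {n : ℕ} {t : ℝ} (h : R.filterMass y n t ≠ 0)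
    {f g : ClusterHistory E → ℝ} (hfg : ∀ κ ∈ kindStrings n, f (ofKinds y κ) = g (ofKinds y κ)) :
    ∫ l, f l ∂(R.filterMeasure y n t) = ∫ l, g l ∂(R.filterMeasure y n t) := by
  rw [R.integral_filterMeasure h, R.integral_filterMeasure h]
  exact congrArg (· / _) (Finset.sum_congr rfl fun κ hκ => by rw [hfg κ hκ])

lemma filterMass_mul_integral {y : ℕ → E × ℝ} {n : ℕ} {t : ℝ} (h : R.filterMass y n t ≠ 0)
    (f : ClusterHistory E → ℝ) :
    R.filterMass y n t * ∫ l, f l ∂(R.filterMeasure y n t)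
      = ∑ κ ∈ kindStrings n, (R.weight y κ : ℝ) * R.survival y κ t * f (ofKinds y κ) := by
  rw [R.integral_filterMeasure h, mul_div_cancel₀ _ (NNReal.coe_ne_zero.2 h)]

lemma filterMass_mul_integral_self {y : ℕ → E × ℝ} {n : ℕ} (h : R.filterMass y n (y n).2 ≠ 0)
    (f : ClusterHistory E → ℝ) :
    R.filterMass y n (y n).2 * ∫ l, f l ∂(R.filterMeasure y n (y n).2)
      = ∑ κ ∈ kindStrings n, (R.weight y κ : ℝ) * f (ofKinds y κ) := by
  rw [R.filterMass_mul_integral h]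
  refine Finset.sum_congr rfl fun κ hκ => ?_
  obtain rfl := mem_kindStrings.1 hκ
  rw [survival_self, NNReal.coe_one, mul_one]

variable [SFinite ν] {y : ℕ → E × ℝ} {n : ℕ}

lemma filterMass_mul_integral_eq (hy : IncreasingUpTo n y) (h : ∀ t, R.filterMass y n t ≠ 0)
    {t : ℝ} (ht : (y n).2 ≤ t) (f : ClusterHistory E → ℝ) :
    R.filterMass y n t * ∫ l, f l ∂(R.filterMeasure y n t)
      = R.idleSurvival (y n).2 t * (R.filterMass y n (y n).2
        * (∫ l, f l ∂(R.filterMeasure y n (y n).2) + ∑ i ∈ Finset.Icc 1 n,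
          (∫ l, theta (y i) l * alpha l * f l ∂(R.filterMeasure y n (y n).2))
            * (R.decay (y i) (y n).2 t - 1))) := by
  rw [R.filterMass_mul_integral (h t), mul_add, Finset.mul_sum]
  simp only [← mul_assoc (R.filterMass y n (y n).2 : ℝ), R.filterMass_mul_integral_self (h _),
    theta_mul_alpha, Finset.sum_mul]
  rw [Finset.sum_comm, ← Finset.sum_add_distrib, Finset.mul_sum]
  refine Finset.sum_congr rfl fun κ hκ => ?_
  obtain rfl := mem_kindStrings.1 hκ
  rw [R.survival_eq_sum hy ht]
  simp only [mul_add, add_mul, Finset.mul_sum, Finset.sum_mul]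
  congr 1
  · ring
  · exact Finset.sum_congr rfl fun i _ => by ring

lemma filterMass_eq (hy : IncreasingUpTo n y) (h : ∀ t, R.filterMass y n t ≠ 0) {t : ℝ}
    (ht : (y n).2 ≤ t) :
    (R.filterMass y n t : ℝ)
      = R.idleSurvival (y n).2 t * (R.filterMass y n (y n).2
        * R.flowDenom y n (y n).2 (fun f => ∫ l, f l ∂(R.filterMeasure y n (y n).2)) t) := by
  have := R.isProbabilityMeasure_filterMeasure y n
  simpa only [flowDenom, mul_one, integral_const, probReal_univ, smul_eq_mul]
    using R.filterMass_mul_integral_eq hy h ht fun _ => 1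

lemma flowDenom_filterMeasure_ne_zero (hy : IncreasingUpTo n y)
    (h : ∀ t, R.filterMass y n t ≠ 0) {t : ℝ} (ht : (y n).2 ≤ t) :
    R.flowDenom y n (y n).2 (fun f => ∫ l, f l ∂(R.filterMeasure y n (y n).2)) t ≠ 0 := by
  have mass_ne_zero := NNReal.coe_ne_zero.2 (h t)
  rw [R.filterMass_eq hy h ht] at mass_ne_zero
  exact right_ne_zero_of_mul (right_ne_zero_of_mul mass_ne_zero)

theorem integral_filterMeasure_eq_flow (hy : IncreasingUpTo n y)
    (h : ∀ t, R.filterMass y n t ≠ 0) {t : ℝ} (ht : (y n).2 ≤ t) (f : ClusterHistory E → ℝ) :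
    ∫ l, f l ∂(R.filterMeasure y n t)
      = R.flow y n (y n).2 (fun f => ∫ l, f l ∂(R.filterMeasure y n (y n).2)) t f := by
  rw [flow, eq_div_iff (R.flowDenom_filterMeasure_ne_zero hy h ht)]
  have factors_ne_zero : R.idleSurvival (y n).2 t * R.filterMass y n (y n).2 ≠ 0 :=
    mul_ne_zero (Real.exp_ne_zero _) (NNReal.coe_ne_zero.2 (h _))
  have mass_mul_integral := R.filterMass_mul_integral_eq hy h ht f
  rw [R.filterMass_eq hy h ht] at mass_mul_integral
  refine mul_left_cancel₀ factors_ne_zero ?_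
  linear_combination mass_mul_integral

theorem evolutionEquations_filterMeasure (hy : IncreasingUpTo n y)
    (h : ∀ t, R.filterMass y n t ≠ 0) {r' : EReal} (hr : ((y n).2 : EReal) < r')
    (f : ClusterHistory E → ℝ) :
    R.EvolutionEquations y n (y n).2 r' (fun t f => ∫ l, f l ∂(R.filterMeasure y n t)) f :=
  (R.evolutionEquations_flow (integral_zero _ _) hy le_rfl
    (fun _ ht => R.flowDenom_filterMeasure_ne_zero hy h ht) r' f).congr hr
      fun _ ht _ => R.integral_filterMeasure_eq_flow hy h ht

lemma tendsto_integral_filterMeasure (hy : IncreasingUpTo n y)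
    (h : ∀ t, R.filterMass y n t ≠ 0) (f : ClusterHistory E → ℝ) {t : ℝ} (ht : (y n).2 < t) :
    Tendsto (fun s => ∫ l, f l ∂(R.filterMeasure y n s)) (𝓝[<] t)
      (𝓝 (∫ l, f l ∂(R.filterMeasure y n t))) := by
  have continuousOn_integral := (R.evolutionEquations_filterMeasure hy h (EReal.coe_lt_top _) f
    ).continuousOn ht.le (EReal.coe_lt_top t)
  exact (continuousOn_integral t (right_mem_Icc.2 ht.le)).mono_left
    (nhdsWithin_le_iff.2 (Icc_mem_nhdsLT ht))

end MotherQuakeRates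

/-! ### The update at an observation -/

namespace ClusterHistory

variable {E : Type*}

lemma alpha_of_mother_eq_none {l : ClusterHistory E} (hl : mother l = none) : alpha l = 0 := by
  simp [alpha, ← isSome_mother, hl]

lemma alpha_of_mother_eq_some {l : ClusterHistory E} {y : E × ℝ} (hl : mother l = some y) :
    alpha l = 1 := by
  simp [alpha, ← isSome_mother, hl]

lemma mother_cons_false (x : E × ℝ) (l : ClusterHistory E) :
    mother ((x.1, x.2, false) :: l) = none := by
  simp [mother]

lemma mother_cons_true_of_eq_none {l : ClusterHistory E} (hl : mother l = none) (x : E × ℝ) :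
    mother ((x.1, x.2, true) :: l) = some x := by
  simp [mother, ← isSome_mother, hl]

lemma mother_cons_true_of_eq_some {l : ClusterHistory E} {y : E × ℝ} (hl : mother l = some y)
    (x : E × ℝ) : mother ((x.1, x.2, true) :: l) = some y := by
  simp [mother, ← isSome_mother, hl]

lemma alpha_ofKinds {y : ℕ → E × ℝ} {κ : List QuakeKind} (hy : IncreasingUpTo κ.length y) :
    alpha (ofKinds y κ)
      = ∑ j ∈ Finset.Icc 1 κ.length, theta (y j) (ofKinds y κ) * alpha (ofKinds y κ) := by
  rw [sum_theta_ofKinds hy fun _ => alpha (ofKinds y κ)]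
  have mother_eq := mother_ofKinds y κ
  cases h : motherIdx κ with
  | none => exact alpha_of_mother_eq_none (by rw [mother_eq, h, Option.map_none])
  | some i => rfl

end ClusterHistory

namespace MotherQuakeRates

open ClusterHistory

variable {E : Type*} [MeasurableSpace E] {ν : Measure E} (R : MotherQuakeRates E ν)

/-- The unnormalized transition operator of a quake: a history `l` just before an observation `x`
contributes `update x f l` to the unnormalized expectation of `f` just after it. -/
noncomputable def update (x : E × ℝ) (f : ClusterHistory E → ℝ) (l : ClusterHistory E) : ℝ :=
  R.γ x.1 x.2 * f l + R.clusterRate l x.1 x.2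
    * (R.transition (active l) true * f ((x.1, x.2, true) :: l)
      + R.transition (active l) false * f ((x.1, x.2, false) :: l))

lemma update_of_mother_eq_none {l : ClusterHistory E} (hl : mother l = none) (x : E × ℝ)
    (f : ClusterHistory E → ℝ) :
    R.update x f l = R.γ x.1 x.2 * f l + R.ε x.1 x.2 * f ((x.1, x.2, true) :: l) := by
  have active_eq : active l = false := by rw [← isSome_mother, hl, Option.isSome_none]
  simp [update, clusterRate, hl, active_eq, transition]

lemma update_of_mother_eq_some {l : ClusterHistory E} {y : E × ℝ} (hl : mother l = some y)
    (x : E × ℝ) (f : ClusterHistory E → ℝ) :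
    R.update x f l = R.γ x.1 x.2 * f l + R.lam x.1 x.2 y
      * (R.p * f ((x.1, x.2, false) :: l) + (1 - R.p) * f ((x.1, x.2, true) :: l)) := by
  have active_eq : active l = true := by rw [← isSome_mother, hl, Option.isSome_some]
  simp only [update, clusterRate, hl, active_eq, transition, NNReal.coe_sub R.p_le_one,
    NNReal.coe_one]
  ring

lemma update_theta_mul {x z : E × ℝ} (hxz : x ≠ z) (f : ClusterHistory E → ℝ)
    (l : ClusterHistory E) :
    R.update x (fun l => theta z l * alpha l * f l) l
      = R.γ x.1 x.2 * (theta z l * alpha l * f l)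
        + (1 - R.p) * R.lam x.1 x.2 z
          * (f ((x.1, x.2, true) :: l) * (theta z l * alpha l)) := by
  classical
  simp only [theta_mul_alpha]
  simp only [theta_apply]
  cases hl : mother l with
  | none => simp [R.update_of_mother_eq_none hl, mother_cons_true_of_eq_none hl, hxz, hl]
  | some y =>
    simp only [R.update_of_mother_eq_some hl, mother_cons_true_of_eq_some hl, mother_cons_false,
      hl, reduceCtorEq, if_false, Option.some.injEq]
    split_ifs with hyz
    · subst hyz
      ring
    · ring

lemma update_theta_self_mul {x : E × ℝ} {l : ClusterHistory E} (hl : mother l ≠ some x)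
    (f : ClusterHistory E → ℝ) :
    R.update x (fun l => theta x l * alpha l * f l) l
      = R.ε x.1 x.2 * (f ((x.1, x.2, true) :: l) * (1 - alpha l)) := by
  classical
  simp only [theta_mul_alpha]
  simp only [theta_apply]
  cases hl' : mother l with
  | none =>
    simp [R.update_of_mother_eq_none hl', mother_cons_true_of_eq_none hl', hl',
      alpha_of_mother_eq_none hl']
  | some y =>
    have hyx : y ≠ x := fun h => hl (h ▸ hl')
    simp [R.update_of_mother_eq_some hl', mother_cons_true_of_eq_some hl', mother_cons_false, hl',
      alpha_of_mother_eq_some hl', hyx]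

lemma update_ofKinds {y : ℕ → E × ℝ} {κ : List QuakeKind} (hy : IncreasingUpTo κ.length y)
    (x : E × ℝ) (f : ClusterHistory E → ℝ) :
    R.update x f (ofKinds y κ) = (fun l => R.γ x.1 x.2 * f l
      + R.ε x.1 x.2 * (f ((x.1, x.2, true) :: l) * (1 - alpha l))
      + ∑ j ∈ Finset.Icc 1 κ.length, R.lam x.1 x.2 (y j)
        * ((R.p * f ((x.1, x.2, false) :: l) + (1 - R.p) * f ((x.1, x.2, true) :: l))
          * (theta (y j) l * alpha l))) (ofKinds y κ) := by
  set l := ofKinds y κ with hl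
  have mother_eq : mother l = (motherIdx κ).map y := mother_ofKinds y κ
  have sum_lam_eq : ∑ j ∈ Finset.Icc 1 κ.length, (R.lam x.1 x.2 (y j) : ℝ)
        * ((R.p * f ((x.1, x.2, false) :: l) + (1 - R.p) * f ((x.1, x.2, true) :: l))
          * (theta (y j) l * alpha l))
      = (∑ j ∈ Finset.Icc 1 κ.length, theta (y j) l * R.lam x.1 x.2 (y j))
        * (R.p * f ((x.1, x.2, false) :: l) + (1 - R.p) * f ((x.1, x.2, true) :: l)) := by
    rw [Finset.sum_mul]
    exact Finset.sum_congr rfl fun j _ => by rw [theta_mul_alpha]; ring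
  simp only [sum_lam_eq]
  rw [hl, sum_theta_ofKinds hy fun j => (R.lam x.1 x.2 (y j) : ℝ), ← hl]
  cases h : motherIdx κ with
  | none =>
    have mother_eq_none : mother l = none := by rw [mother_eq, h, Option.map_none]
    rw [R.update_of_mother_eq_none mother_eq_none, alpha_of_mother_eq_none mother_eq_none]
    ring
  | some i =>
    have mother_eq_some : mother l = some (y i) := by rw [mother_eq, h, Option.map_some]
    rw [R.update_of_mother_eq_some mother_eq_some, alpha_of_mother_eq_some mother_eq_some]
    ring

lemma sum_weight_succ (y : ℕ → E × ℝ) (n : ℕ) (f : ClusterHistory E → ℝ) :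
    ∑ κ ∈ kindStrings (n + 1), (R.weight y κ : ℝ) * f (ofKinds y κ)
      = ∑ κ ∈ kindStrings n, (R.weight y κ : ℝ) * R.survival y κ (y (n + 1)).2
          * R.update (y (n + 1)) f (ofKinds y κ) := by
  rw [sum_kindStrings_succ]
  refine Finset.sum_congr rfl fun κ hκ => ?_
  obtain rfl := mem_kindStrings.1 hκ
  rw [QuakeKind.sum_eq]
  simp only [weight, ofKinds, rate, update, NNReal.coe_mul]
  ring

variable [MeasurableSingletonClass E] {y : ℕ → E × ℝ} {n : ℕ}

lemma integral_filterMeasure_succ (h : R.filterMass y n (y (n + 1)).2 ≠ 0)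
    (h' : R.filterMass y (n + 1) (y (n + 1)).2 ≠ 0) (f : ClusterHistory E → ℝ) :
    ∫ l, f l ∂(R.filterMeasure y (n + 1) (y (n + 1)).2)
      = (∫ l, R.update (y (n + 1)) f l ∂(R.filterMeasure y n (y (n + 1)).2))
        / (R.filterMass y (n + 1) (y (n + 1)).2 / R.filterMass y n (y (n + 1)).2) := by
  have mass_mul_integral : R.filterMass y (n + 1) (y (n + 1)).2
        * ∫ l, f l ∂(R.filterMeasure y (n + 1) (y (n + 1)).2)
      = R.filterMass y n (y (n + 1)).2
        * ∫ l, R.update (y (n + 1)) f l ∂(R.filterMeasure y n (y (n + 1)).2) := by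
    rw [R.filterMass_mul_integral_self h', R.sum_weight_succ, R.filterMass_mul_integral h]
  rw [div_div_eq_mul_div, eq_div_iff (NNReal.coe_ne_zero.2 h'), mul_comm, mass_mul_integral,
    mul_comm]

lemma integral_update {t : ℝ} (hy : IncreasingUpTo n y) (h : R.filterMass y n t ≠ 0)
    (x : E × ℝ) (f : ClusterHistory E → ℝ) :
    ∫ l, R.update x f l ∂(R.filterMeasure y n t)
      = (∫ l, f l ∂(R.filterMeasure y n t)) * R.γ x.1 x.2
        + (∫ l, f ((x.1, x.2, true) :: l) * (1 - alpha l) ∂(R.filterMeasure y n t)) * R.ε x.1 x.2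
        + ∑ j ∈ Finset.Icc 1 n, R.lam x.1 x.2 (y j)
          * ∫ l, (R.p * f ((x.1, x.2, false) :: l) + (1 - R.p) * f ((x.1, x.2, true) :: l))
            * (theta (y j) l * alpha l) ∂(R.filterMeasure y n t) := by
  have integrable := R.integrable_filterMeasure y n t
  rw [R.integral_filterMeasure_congr (g := fun l => R.γ x.1 x.2 * f l
      + R.ε x.1 x.2 * (f ((x.1, x.2, true) :: l) * (1 - alpha l))
      + ∑ j ∈ Finset.Icc 1 n, R.lam x.1 x.2 (y j)
        * ((R.p * f ((x.1, x.2, false) :: l) + (1 - R.p) * f ((x.1, x.2, true) :: l))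
          * (theta (y j) l * alpha l))) h fun κ hκ => by
    obtain rfl := mem_kindStrings.1 hκ
    exact R.update_ofKinds hy x f]
  rw [integral_add (integrable _) (integrable _), integral_add (integrable _) (integrable _),
    integral_finsetSum _ fun _ _ => integrable _]
  simp only [integral_const_mul]
  ring

lemma integral_one_sub_alpha_filterMeasure {t : ℝ} (hy : IncreasingUpTo n y)
    (h : R.filterMass y n t ≠ 0) :
    ∫ l, (1 - alpha l) ∂(R.filterMeasure y n t)
      = 1 - ∑ j ∈ Finset.Icc 1 n, ∫ l, theta (y j) l * alpha l ∂(R.filterMeasure y n t) := by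
  have := R.isProbabilityMeasure_filterMeasure y n t
  have integrable := R.integrable_filterMeasure y n t
  rw [integral_sub (integrable _) (integrable _), ← integral_finsetSum _ fun _ _ => integrable _,
    integral_const, probReal_univ, one_smul]
  refine congrArg _ (R.integral_filterMeasure_congr h fun κ hκ => ?_)
  obtain rfl := mem_kindStrings.1 hκ
  exact alpha_ofKinds hy

theorem d_filterMeasure (hy : IncreasingUpTo n y) (h : R.filterMass y n (y (n + 1)).2 ≠ 0)
    (h' : R.filterMass y (n + 1) (y (n + 1)).2 ≠ 0) :
    R.d y n (fun f => ∫ l, f l ∂(R.filterMeasure y n (y (n + 1)).2))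
      = R.filterMass y (n + 1) (y (n + 1)).2 / R.filterMass y n (y (n + 1)).2 := by
  have := R.isProbabilityMeasure_filterMeasure y n (y (n + 1)).2
  have := R.isProbabilityMeasure_filterMeasure y (n + 1) (y (n + 1)).2
  have ratio_ne_zero :
      (R.filterMass y (n + 1) (y (n + 1)).2 / R.filterMass y n (y (n + 1)).2 : ℝ) ≠ 0 :=
    div_ne_zero (NNReal.coe_ne_zero.2 h') (NNReal.coe_ne_zero.2 h)
  have integral_update_one := R.integral_filterMeasure_succ h h' fun _ => 1
  rw [R.integral_update hy h] at integral_update_one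
  simp only [integral_const, probReal_univ, smul_eq_mul, mul_one, one_mul, add_sub_cancel,
    R.integral_one_sub_alpha_filterMeasure hy h] at integral_update_one
  rw [eq_div_iff ratio_ne_zero, one_mul] at integral_update_one
  rw [integral_update_one, d]
  simp only [sub_mul, Finset.sum_sub_distrib, ← Finset.mul_sum]
  ring

theorem jumpEquations_filterMeasure (hy : IncreasingUpTo (n + 1) y)
    (h : R.filterMass y n (y (n + 1)).2 ≠ 0) (h' : R.filterMass y (n + 1) (y (n + 1)).2 ≠ 0)
    (f : ClusterHistory E → ℝ) :
    R.JumpEquations y n (fun f => ∫ l, f l ∂(R.filterMeasure y n (y (n + 1)).2))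
      (fun f => ∫ l, f l ∂(R.filterMeasure y (n + 1) (y (n + 1)).2)) f := by
  have hyn : IncreasingUpTo n y := hy.mono n.le_succ
  have integrable := R.integrable_filterMeasure y n (y (n + 1)).2
  have integral_succ (f : ClusterHistory E → ℝ) := R.integral_filterMeasure_succ h h' f
  simp only [← R.d_filterMeasure hyn h h'] at integral_succ
  refine ⟨fun i hi => ?_, ?_, ?_⟩
  · have hi' : i ≤ n := (Finset.mem_Icc.1 hi).2
    have hne : y (n + 1) ≠ y i := hy.ne le_rfl (hi'.trans n.le_succ) (by lia)
    simp only [integral_succ, R.update_theta_mul hne]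
    rw [integral_add (integrable _) (integrable _), integral_const_mul, integral_const_mul,
      mul_comm (R.γ _ _ : ℝ)]
  · have mother_ne (κ : List QuakeKind) (hκ : κ ∈ kindStrings n) :
        mother (ofKinds y κ) ≠ some (y (n + 1)) := by
      obtain rfl := mem_kindStrings.1 hκ
      rw [mother_ofKinds, Ne, Option.map_eq_some_iff]
      rintro ⟨i, hi, hyi⟩
      have hi' : i ≤ κ.length := (Finset.mem_Icc.1 (motherIdx_mem hi)).2
      exact hy.ne (hi'.trans (Nat.le_succ _)) le_rfl (by lia) hyi
    simp only [integral_succ]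
    rw [R.integral_filterMeasure_congr (g := fun l => R.ε (y (n + 1)).1 (y (n + 1)).2
        * (f (((y (n + 1)).1, (y (n + 1)).2, true) :: l) * (1 - alpha l))) h
      fun κ hκ => R.update_theta_self_mul (mother_ne κ hκ) f, integral_const_mul, mul_comm]
  · rw [integral_succ, R.integral_update hyn h, add_div]

end MotherQuakeRates

/-! ### The equations determine the filter -/

namespace MotherQuakeRates

open ClusterHistory

variable {E : Type*} [MeasurableSpace E] {ν : Measure E} {R : MotherQuakeRates E ν}

lemma EvolutionEquations.theta_mul_alpha_mul_unique {y : ℕ → E × ℝ} {k : ℕ} {r : ℝ} {r' : EReal}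
    {V V' : ℝ → (ClusterHistory E → ℝ) → ℝ} {f : ClusterHistory E → ℝ}
    (h : R.EvolutionEquations y k r r' V f) (h' : R.EvolutionEquations y k r r' V' f)
    (hr : V r = V' r) {t : ℝ} (ht : r ≤ t) (ht' : (t : EReal) < r') {i : ℕ}
    (hi : i ∈ Finset.Icc 1 k) :
    V t (fun l => theta (y i) l * alpha l * f l)
      = V' t (fun l => theta (y i) l * alpha l * f l) := by
  rw [h.cluster_eq t ht ht' i hi, h'.cluster_eq t ht ht' i hi, hr]

lemma odeRhs_sub_odeRhs {y : ℕ → E × ℝ} {k : ℕ} {Φ Ψ : (ClusterHistory E → ℝ) → ℝ}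
    {f : ClusterHistory E → ℝ}
    (h : ∀ i ∈ Finset.Icc 1 k, Φ (fun l => theta (y i) l * alpha l * f l)
      = Ψ (fun l => theta (y i) l * alpha l * f l))
    (h' : ∀ i ∈ Finset.Icc 1 k, Φ (fun l => theta (y i) l * alpha l)
      = Ψ (fun l => theta (y i) l * alpha l)) (t : ℝ) :
    R.odeRhs y k Φ f t - R.odeRhs y k Ψ f t
      = (Φ f - Ψ f) * ∑ i ∈ Finset.Icc 1 k,
          Φ (fun l => theta (y i) l * alpha l) * (R.a (y i) t - R.epsTotal t) := by
  have sum_mul_eq : ∑ i ∈ Finset.Icc 1 k,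
        Φ (fun l => theta (y i) l * alpha l * f l) * (R.a (y i) t - R.epsTotal t)
      = ∑ i ∈ Finset.Icc 1 k,
        Ψ (fun l => theta (y i) l * alpha l * f l) * (R.a (y i) t - R.epsTotal t) :=
    Finset.sum_congr rfl fun i hi => by rw [h i hi]
  have sum_eq : ∑ i ∈ Finset.Icc 1 k,
        Φ (fun l => theta (y i) l * alpha l) * (R.a (y i) t - R.epsTotal t)
      = ∑ i ∈ Finset.Icc 1 k,
        Ψ (fun l => theta (y i) l * alpha l) * (R.a (y i) t - R.epsTotal t) :=
    Finset.sum_congr rfl fun i hi => by rw [h' i hi]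
  rw [odeRhs, odeRhs, sum_mul_eq, sum_eq]
  ring

theorem EvolutionEquations.unique [SFinite ν] {y : ℕ → E × ℝ} {k : ℕ} {r : ℝ} {r' : EReal}
    (hy : IncreasingUpTo k y) (hyr : (y k).2 ≤ r) {V V' : ℝ → (ClusterHistory E → ℝ) → ℝ}
    (h : ∀ f, R.EvolutionEquations y k r r' V f) (h' : ∀ f, R.EvolutionEquations y k r r' V' f)
    (hr : V r = V' r) {t : ℝ} (ht : r ≤ t) (ht' : (t : EReal) < r') : V t = V' t := by
  funext f
  have lt_of_mem {s : ℝ} (hs : s ∈ Icc r t) : (s : EReal) < r' :=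
    (EReal.coe_le_coe_iff.2 hs.2).trans_lt ht'
  set g : ℝ → ℝ := fun s => ∑ i ∈ Finset.Icc 1 k,
    V s (fun l => theta (y i) l * alpha l) * (R.a (y i) s - R.epsTotal s) with hg
  have intervalIntegrable_g : IntervalIntegrable g volume r t := by
    rw [hg, ← Finset.sum_fn]
    refine IntervalIntegrable.sum _ fun i hi => ?_
    have hik : i ≤ k := (Finset.mem_Icc.1 hi).2
    refine (R.intervalIntegrable_a_sub_epsTotal (hy.nonneg hik) ((hy.le hik le_rfl).trans hyr) ht
      ).continuousOn_mul ?_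
    rw [uIcc_of_le ht]
    exact (h _).continuousOn ht ht'
  have odeRhs_sub {s : ℝ} (hs : s ∈ Icc r t) :
      R.odeRhs y k (V s) f s - R.odeRhs y k (V' s) f s = (V s f - V' s f) * g s := by
    refine odeRhs_sub_odeRhs (fun i hi => ?_) (fun i hi => ?_) s
    · exact (h f).theta_mul_alpha_mul_unique (h' f) hr hs.1 (lt_of_mem hs) hi
    · simpa only [mul_one] using
        (h fun _ => 1).theta_mul_alpha_mul_unique (h' fun _ => 1) hr hs.1 (lt_of_mem hs) hi
  have sub_eq_integral (s : ℝ) (hs : s ∈ Icc r t) :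
      V s f - V' s f = ∫ x in r..s, (V x f - V' x f) * g x := by
    rw [(h f).ode_integral s hs.1 (lt_of_mem hs), (h' f).ode_integral s hs.1 (lt_of_mem hs), hr,
      add_sub_add_left_eq_sub, ← intervalIntegral.integral_sub
        ((h f).ode_integrable s hs.1 (lt_of_mem hs)) ((h' f).ode_integrable s hs.1 (lt_of_mem hs))]
    refine intervalIntegral.integral_congr fun x hx => ?_
    rw [uIcc_of_le hs.1] at hx
    exact odeRhs_sub ⟨hx.1, hx.2.trans hs.2⟩
  refine sub_eq_zero.1 (eq_zero_of_eq_integral_mul (W := fun s => V s f - V' s f) ht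
    intervalIntegrable_g (intervalIntegrable_g.continuousOn_mul ?_) sub_eq_integral)
  rw [uIcc_of_le ht]
  exact ((h f).continuousOn ht ht').sub ((h' f).continuousOn ht ht')

end MotherQuakeRates

namespace QuakeProcess

open ClusterHistory MotherQuakeRates

variable {E Ω : Type*} [MeasurableSpace E] [mΩ : MeasurableSpace Ω] (X : QuakeProcess E Ω)
  {ν : Measure E} {R : MotherQuakeRates E ν} {ω : Ω}

section Uniqueness

variable [SFinite ν] {V V' : ℝ → (ClusterHistory E → ℝ) → ℝ}
  (h : R.FilterEquations (fun k => X.T k ω) (fun k => X.mark k ω) V)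
  (h' : R.FilterEquations (fun k => X.T k ω) (fun k => X.mark k ω) V')

include h h'

lemma eq_of_eq_at_T {n : ℕ} (hn : X.T n ω ≠ ⊤) (hV : V (X.path ω n).2 = V' (X.path ω n).2) {t : ℝ}
    (ht : (X.path ω n).2 ≤ t) (ht' : (t : EReal) < X.T (n + 1) ω) : V t = V' t :=
  EvolutionEquations.unique (X.increasingUpTo_path hn) le_rfl
    (h.evolution n _ (X.coe_toReal_T hn).symm) (h'.evolution n _ (X.coe_toReal_T hn).symm) hV ht ht'

lemma eq_at_T (n : ℕ) (hn : X.T n ω ≠ ⊤) : V (X.path ω n).2 = V' (X.path ω n).2 := by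
  induction n with
  | zero =>
    rw [(X.increasingUpTo_path hn).1]
    exact funext fun f => (h.initial f).trans (h'.initial f).symm
  | succ n ih =>
    have hn' : X.T n ω ≠ ⊤ := X.T_ne_top_of_le n.le_succ hn
    have hT : X.T (n + 1) ω = (X.path ω (n + 1)).2 := (X.coe_toReal_T hn).symm
    have time_lt : (X.path ω n).2 < (X.path ω (n + 1)).2 :=
      (X.increasingUpTo_path hn).lt n.lt_succ_self le_rfl
    obtain ⟨Φ, hΦ, -, jump⟩ := h.jump n _ hT
    obtain ⟨Φ', hΦ', -, jump'⟩ := h'.jump n _ hT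
    have leftLim_eq : Φ = Φ' := funext fun f => by
      refine tendsto_nhds_unique (hΦ f) ((hΦ' f).congr' ?_)
      filter_upwards [Ioo_mem_nhdsLT time_lt] with s hs
      rw [X.eq_of_eq_at_T h h' hn' (ih hn') hs.1.le (hT ▸ EReal.coe_lt_coe_iff.2 hs.2)]
    exact funext fun f => by rw [(jump f).total, (jump' f).total, leftLim_eq]

theorem eq_of_filterEquations {t : ℝ} (ht : 0 ≤ t) : V t = V' t := by
  obtain ⟨n, hn, hn'⟩ := X.exists_T_le_lt ω ht
  have T_ne_top : X.T n ω ≠ ⊤ := (hn.trans_lt (EReal.coe_lt_top t)).ne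
  rw [← X.coe_toReal_T T_ne_top, EReal.coe_le_coe_iff] at hn
  exact X.eq_of_eq_at_T h h' T_ne_top (X.eq_at_T h h' n T_ne_top) hn hn'

end Uniqueness

section Existence

variable [MeasurableSingletonClass E] {V : ℝ → (ClusterHistory E → ℝ) → ℝ}
  (hV : ∀ n, X.T n ω ≠ ⊤ → ∀ t, (X.path ω n).2 ≤ t → (t : EReal) < X.T (n + 1) ω →
    ∀ f, V t f = ∫ l, f l ∂(R.filterMeasure (X.path ω) n t))
  (hω : ∀ n, X.T n ω ≠ ⊤ → ∀ t, R.filterMass (X.path ω) n t ≠ 0)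

include hV hω

lemma initial_of_eq_integral (f : ClusterHistory E → ℝ) : V 0 f = f [] := by
  have T_ne_top : X.T 0 ω ≠ ⊤ := by simp [X.T_zero]
  have time_zero : (X.path ω 0).2 = 0 := (X.increasingUpTo_path T_ne_top).1
  have zero_lt : ((0 : ℝ) : EReal) < X.T 1 ω := by simpa [X.T_zero] using X.T_lt 0 ω T_ne_top
  have survival_ne_zero : (R.survival (X.path ω) [] 0 : ℝ) ≠ 0 :=
    NNReal.coe_ne_zero.2 (R.survival_pos _ _ _).ne'
  rw [hV 0 T_ne_top 0 time_zero.le zero_lt, R.integral_filterMeasure (hω 0 T_ne_top 0),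
    filterMass, sum_kindStrings_zero, sum_kindStrings_zero]
  simp only [weight, NNReal.coe_one, one_mul, ofKinds]
  exact mul_div_cancel_left₀ _ survival_ne_zero

variable [SFinite ν]

lemma evolutionEquations_of_eq_integral {n : ℕ} (hn : X.T n ω ≠ ⊤) (f : ClusterHistory E → ℝ) :
    R.EvolutionEquations (X.path ω) n (X.path ω n).2 (X.T (n + 1) ω) V f := by
  have time_lt : ((X.path ω n).2 : EReal) < X.T (n + 1) ω :=
    (X.coe_toReal_T hn).trans_lt (X.T_lt n ω hn)
  exact (R.evolutionEquations_filterMeasure (X.increasingUpTo_path hn) (hω n hn) time_lt f).congr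
    time_lt (hV n hn)

lemma jumpEquations_of_eq_integral {n : ℕ} (hn : X.T (n + 1) ω ≠ ⊤) :
    ∃ Φ : (ClusterHistory E → ℝ) → ℝ,
      (∀ f, Tendsto (fun t => V t f) (𝓝[<] (X.path ω (n + 1)).2) (𝓝 (Φ f))) ∧
      0 < R.d (X.path ω) n Φ ∧
      ∀ f, R.JumpEquations (X.path ω) n Φ (V (X.path ω (n + 1)).2) f := by
  have hn' : X.T n ω ≠ ⊤ := X.T_ne_top_of_le n.le_succ hn
  have hT : ((X.path ω (n + 1)).2 : EReal) = X.T (n + 1) ω := X.coe_toReal_T hn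
  have hy : IncreasingUpTo (n + 1) (X.path ω) := X.increasingUpTo_path hn
  have time_lt : (X.path ω n).2 < (X.path ω (n + 1)).2 := hy.lt n.lt_succ_self le_rfl
  refine ⟨fun f => ∫ l, f l ∂(R.filterMeasure (X.path ω) n (X.path ω (n + 1)).2), fun f => ?_, ?_,
    fun f => ?_⟩
  · refine (R.tendsto_integral_filterMeasure (hy.mono n.le_succ) (hω n hn') f time_lt).congr' ?_
    filter_upwards [Ioo_mem_nhdsLT time_lt] with s hs
    exact (hV n hn' s hs.1.le (hT ▸ EReal.coe_lt_coe_iff.2 hs.2) f).symm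
  · rw [R.d_filterMeasure (hy.mono n.le_succ) (hω n hn' _) (hω (n + 1) hn _)]
    exact div_pos (NNReal.coe_pos.2 (pos_of_ne_zero (hω (n + 1) hn _)))
      (NNReal.coe_pos.2 (pos_of_ne_zero (hω n hn' _)))
  · rw [funext (hV (n + 1) hn _ le_rfl (hT.trans_lt (X.T_lt (n + 1) ω hn)))]
    exact R.jumpEquations_filterMeasure hy (hω n hn' _) (hω (n + 1) hn _) f

theorem filterEquations_of_eq_integral :
    R.FilterEquations (fun k => X.T k ω) (fun k => X.mark k ω) V := by
  have T_ne_top {n : ℕ} {r : ℝ} (hr : X.T n ω = r) : X.T n ω ≠ ⊤ := hr ▸ EReal.coe_ne_top r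
  have time_eq {n : ℕ} {r : ℝ} (hr : X.T n ω = r) : (X.path ω n).2 = r := by
    rw [path, hr, EReal.toReal_coe]
  refine ⟨X.initial_of_eq_integral hV hω, fun n r hr f => ?_, fun n r hr => ?_⟩
  · exact time_eq hr ▸ X.evolutionEquations_of_eq_integral hV hω (T_ne_top hr) f
  · exact time_eq hr ▸ X.jumpEquations_of_eq_integral hV hω (T_ne_top hr)

end Existence

end QuakeProcess

theorem theorem3p2_general {E Ω : Type*} [MeasurableSpace E] [MeasurableSpace.CountablyGenerated E]
    [MeasurableSingletonClass E] [MeasurableSpace Ω] (ν : Measure E) [SFinite ν]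
    (R : MotherQuakeRates E ν) (P : Measure Ω) [IsProbabilityMeasure P]
    (X : QuakeProcess E Ω) (hX : IsMotherQuakeModel R P X) :
    (∃ π : ℝ → Ω → Measure (ClusterHistory E), IsMotherQuakeFilter P X π) ∧
    ∀ π : ℝ → Ω → Measure (ClusterHistory E), IsMotherQuakeFilter P X π →
      ∀ᵐ ω ∂P,
        (∀ t : ℝ, 0 ≤ t → ∀ f : ClusterHistory E → ℝ, Integrable f (π t ω)) ∧
        R.FilterEquations (fun k => X.T k ω) (fun k => X.mark k ω)
          (fun t f => ∫ l, f l ∂(π t ω)) ∧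
        ∀ V : ℝ → (ClusterHistory E → ℝ) → ℝ,
          R.FilterEquations (fun k => X.T k ω) (fun k => X.mark k ω) V →
          ∀ t : ℝ, 0 ≤ t → ∀ f : ClusterHistory E → ℝ, V t f = ∫ l, f l ∂(π t ω) := by
  obtain ⟨ω₀⟩ : Nonempty Ω := P.nonempty_of_neZero
  let e₀ : E := X.mark 0 ω₀
  refine ⟨⟨X.filter R e₀, hX.isMotherQuakeFilter_filter e₀⟩, fun π hπ => ?_⟩
  filter_upwards [hX.ae_filter_eq e₀ hπ, hX.ae_filterMass_ne_zero] with ω filter_eq mass_ne_zero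
  have filterEquations : R.FilterEquations (fun k => X.T k ω) (fun k => X.mark k ω)
      fun t f => ∫ l, f l ∂(π t ω) := by
    refine X.filterEquations_of_eq_integral (fun n hn t ht ht' f => ?_) mass_ne_zero
    have hT : X.T n ω ≤ t := X.coe_toReal_T hn ▸ EReal.coe_le_coe_iff.2 ht
    rw [filter_eq t (EReal.coe_nonneg.1 ((X.T_nonneg n ω).trans hT)), X.filter_eq R e₀ hT ht']
  refine ⟨fun t ht f => ?_, filterEquations,
    fun V hV t ht f => congrFun (X.eq_of_filterEquations hV filterEquations ht) f⟩
  rw [filter_eq t ht]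
  exact R.integrable_filterMeasure _ _ _ f

theorem theorem3p2 {E Ω : Type*} [MeasurableSpace E] [StandardBorelSpace E] [MeasurableSpace Ω]
    (ν : Measure E) [SigmaFinite ν] (R : MotherQuakeRates E ν)
    (P : Measure Ω) [IsProbabilityMeasure P]
    (X : QuakeProcess E Ω) (hX : IsMotherQuakeModel R P X) :
    (∃ π : ℝ → Ω → Measure (ClusterHistory E), IsMotherQuakeFilter P X π) ∧
    ∀ π : ℝ → Ω → Measure (ClusterHistory E), IsMotherQuakeFilter P X π →
      ∀ᵐ ω ∂P,
        (∀ t : ℝ, 0 ≤ t → ∀ f : ClusterHistory E → ℝ, Integrable f (π t ω)) ∧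
        R.FilterEquations (fun k => X.T k ω) (fun k => X.mark k ω)
          (fun t f => ∫ l, f l ∂(π t ω)) ∧
        ∀ V : ℝ → (ClusterHistory E → ℝ) → ℝ,
          R.FilterEquations (fun k => X.T k ω) (fun k => X.mark k ω) V →
          ∀ t : ℝ, 0 ≤ t → ∀ f : ClusterHistory E → ℝ, V t f = ∫ l, f l ∂(π t ω) :=
  theorem3p2_general ν R P X hX
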